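/- Let $D$ be a link diagram in the plane: finitely many piecewise smooth closed curves $\gamma_1,\dots,\gamma_\mu$ in $\mathbb{R}^2$ whose only intersections and self-intersections are finitely many transverse double points (the crossings), together with a choice, at each crossing, of which of the two strands is the underpassing one. The faces of $D$ are the arc components of $\mathbb{R}^2\setminus\bigcup_i\gamma_i$; the arcs of $D$ are the pieces into which the curves are cut at the underpasses. (Split diagrams and diagrams without crossings are allowed.) Let $s$ be a checkerboard shading of $D$, i.e. a division of the faces into shaded and unshaded ones such that, whenever the boundaries of two different faces share a segment of positive length, one of the two is shaded and the other is not. Let $A$ be an abelian group. A Dehn coloring of $D$ with values in $A$ is a function $d$ from the set of faces to $A$ such that, whenever the boundaries of two different faces $F,F'$ share a segment of positive length contained in an arc $a$, the sum $d(F)+d(F')$ depends only on $a$. The Dehn colorings form a group $\mathcal{D}_A(D)$ under pointwise addition. The Goeritz index $\eta(c)$ of a crossing $c$ is $1$ if the overpassing arc appears on the right-hand sides of the unshaded faces at $c$ (as seen when looking from such a face toward $c$), and $-1$ if it appears on their left-hand sides. The set of faces is finite; let $F_1,\dots,F_n$ be the unshaded faces. The unreduced Goeritz matrix $G(D,s)$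 is the $n\times n$ integer matrix with $G(D,s)_{ij}=-\sum_c\eta(c)$ for $i\ne j$, where $c$ runs over the crossings incident on both $F_i$ and $F_j$, and $G(D,s)_{ii}=-\sum_{k\neq i}G(D,s)_{ik}$. Put $\ker_A G(D,s)=\{x\in A^n : G(D,s)\cdot x=0\}$. Let $\beta_s(D)$ be the number of connected components of the graph whose vertices are the shaded faces and which has, for each crossing, an edge joining the shaded face(s) incident at it. Then $v(d)=(d(F_1),\dots,d(F_n))$ defines a surjective homomorphism $v:\mathcal{D}_A(D)\to\ker_A G(D,s)$, and $v$ splits: there is a homomorphism $u:\ker_A G(D,s)\to\mathcal{D}_A(D)$ with $v\circ u=\mathrm{id}$. Consequently $\mathcal{D}_A(D)$ is the internal direct sum of $\ker v$ and a subgroup isomorphic to $\ker_A G(D,s)$. Moreover $\ker v\cong A^{\beta_s(D)}$, and hence $$\mathcal{D}_A(D)\cong\ker_A G(D,s)\oplus A^{\beta_s(D)}.$$ -/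

import Mathlib

open Set Filter Topology

/-- A (tame, classical) link diagram in the plane `ℂ`: finitely many piecewise smooth closed
curves, whose only intersections and self-intersections are finitely many transverse double
points, together with the choice of the underpassing strand at each of these. -/
structure LinkDiagram where
  /-- The number of closed curves. -/
  μ : ℕ
  /-- The closed curves, parametrized by `ℝ / ℤ`. -/
  γ : Fin μ → UnitAddCircle → ℂ
  /-- Piecewise smooth: next to every parameter value, on either side of it, the curve is
  continuously differentiable up to that value, with a non-zero one-sided derivative there.
  As `ℝ / ℤ` is compact, only finitely many corners can occur. -/
  piecewise_smooth : ∀ (i : Fin μ) (t : ℝ), ∃ ε > 0,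
    ContDiffOn ℝ 1 (fun u : ℝ => γ i u) (Icc t (t + ε)) ∧
    derivWithin (fun u : ℝ => γ i u) (Icc t (t + ε)) t ≠ 0 ∧
    ContDiffOn ℝ 1 (fun u : ℝ => γ i u) (Icc (t - ε) t) ∧
    derivWithin (fun u : ℝ => γ i u) (Icc (t - ε) t) t ≠ 0
  /-- No point of the plane is passed more than twice. -/
  double : ∀ x : ℂ, {p : Fin μ × UnitAddCircle | γ p.1 p.2 = x}.encard ≤ 2
  /-- The two strands at a double point have linearly independent derivatives
  (in particular both are differentiable there). -/
  transverse : ∀ p q : Fin μ × UnitAddCircle, p ≠ q → γ p.1 p.2 = γ q.1 q.2 →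
    LinearIndependent ℝ ![deriv (fun t : ℝ => γ p.1 (p.2 + t)) 0,
      deriv (fun t : ℝ => γ q.1 (q.2 + t)) 0]
  /-- There are only finitely many double points. -/
  finite_double : {x : ℂ | ∃ p q : Fin μ × UnitAddCircle,
    p ≠ q ∧ γ p.1 p.2 = x ∧ γ q.1 q.2 = x}.Finite
  /-- The parameters of the underpassing strands at the double points. -/
  under : Set (Fin μ × UnitAddCircle)
  /-- Only double points are underpassed. -/
  under_double : ∀ p ∈ under, ∃ q, q ≠ p ∧ γ q.1 q.2 = γ p.1 p.2
  /-- At each double point exactly one of the two strands is the underpassing one. -/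
  under_iff : ∀ p q : Fin μ × UnitAddCircle, p ≠ q → γ p.1 p.2 = γ q.1 q.2 →
    (p ∈ under ↔ q ∉ under)

namespace LinkDiagram

variable (D : LinkDiagram)

/-- The parameter space of the diagram: the disjoint union of the parameter circles. -/
abbrev Param : Type := Fin D.μ × UnitAddCircle

/-- The point of the plane with a given parameter. -/
def point (p : D.Param) : ℂ := D.γ p.1 p.2

/-- The velocity of the curve at a given parameter. -/
noncomputable def velocity (p : D.Param) : ℂ := deriv (fun t : ℝ => D.γ p.1 (p.2 + t)) 0

/-- The union of the curves. -/
def support : Set ℂ := range D.point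

/-- The crossings: the points where two different strands meet. -/
def Crossing : Type := {x : ℂ // ∃ p q : D.Param, p ≠ q ∧ D.point p = x ∧ D.point q = x}

/-- The faces: the arc components of the complement of the union of the curves. -/
def Face : Type := {F : Set ℂ // ∃ x ∈ D.supportᶜ, F = pathComponentIn D.supportᶜ x}

/-- The arcs of the diagram. The curves are cut at the underpasses; an arc is given by
its set of parameters, an arc component of what remains of the parameter circles. (Whether a
point or a very short segment is cut out at an underpass makes no difference.) -/
def Arc : Type := {a : Set D.Param // ∃ p ∈ D.underᶜ, a = pathComponentIn D.underᶜ p}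

variable {D}

/-- The boundaries of the two (different) faces `F` and `F'` share a segment of positive length,
namely the image of the parameter interval `[s, t]` of the `i`-th curve. -/
def ShareSegment (F F' : D.Face) (i : Fin D.μ) (s t : ℝ) : Prop :=
  F ≠ F' ∧ s < t ∧ (fun u : ℝ => D.γ i u) '' Icc s t ⊆ frontier F.1 ∩ frontier F'.1

/-- The boundaries of the two (different) faces `F` and `F'` share a segment of positive length
which is contained in the arc `a`. -/
def ShareSegmentOn (F F' : D.Face) (a : D.Arc) : Prop :=
  ∃ (i : Fin D.μ) (s t : ℝ), ShareSegment F F' i s t ∧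
    ∀ u ∈ Icc s t, ((i, (u : UnitAddCircle)) : D.Param) ∈ a.1

/-- A crossing is incident on a face if it lies on the boundary of the face. -/
def Crossing.Incident (c : D.Crossing) (F : D.Face) : Prop := c.1 ∈ frontier F.1

variable (D) in
/-- The group of Dehn colorings with values in `A`: the functions `d` on the faces for which
`d F + d F'` depends only on `a` when the boundaries of `F` and `F'` share a segment of positive
length contained in the arc `a`. -/
def dehnColorings (A : Type*) [AddCommGroup A] : AddSubgroup (D.Face → A) where
  carrier := {d | ∀ (a : D.Arc) (F F' E E' : D.Face),
    ShareSegmentOn F F' a → ShareSegmentOn E E' a → d F + d F' = d E + d E'}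
  zero_mem' := by intro a F F' E E' _ _; rfl
  add_mem' := by
    intro d e hd he a F F' E E' h h'
    simp only [Pi.add_apply]
    rw [add_add_add_comm, hd a F F' E E' h h', he a F F' E E' h h', add_add_add_comm]
  neg_mem' := by
    intro d hd a F F' E E' h h'
    simp only [Pi.neg_apply]
    rw [← neg_add, hd a F F' E E' h h', neg_add]

variable (D) in
/-- A checkerboard shading of the faces: if the boundaries of two faces share a segment of
positive length, then one of them is shaded and the other one is not. -/
structure Shading where
  /-- The set of shaded faces. -/
  shaded : Set D.Face
  checkerboard : ∀ (F F' : D.Face) (i : Fin D.μ) (t t' : ℝ),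
    ShareSegment F F' i t t' → (F ∈ shaded ↔ F' ∉ shaded)

namespace Shading

variable (s : D.Shading)

/-- The unshaded faces. -/
abbrev Unshaded : Type := {F : D.Face // F ∉ s.shaded}

/-- The shaded faces. -/
abbrev Shaded : Type := {F : D.Face // F ∈ s.shaded}

/-- At the crossing `c`, the overpassing arc appears on the right-hand sides of the unshaded
faces, as seen by an observer who stands in such a face and looks at `c`. In other words,
some (equivalently, each) corner at `c` that one enters when turning clockwise from the
overpassing strand belongs to an unshaded face. If `a` and `b` are the velocities of the over-
and the underpassing strand, then one such corner is spanned by `a` and the one of the vectors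
`b` and `-b` that is clockwise from `a`; it is represented here by its diagonal. -/
def OverOnRight (c : D.Crossing) : Prop :=
  ∃ p q : D.Param, D.point p = c.1 ∧ D.point q = c.1 ∧ p ∉ D.under ∧ q ∈ D.under ∧
    ∃ F : s.Unshaded, ∀ᶠ r in 𝓝[>] (0 : ℝ),
      c.1 + r • (D.velocity p
        - Real.sign ((starRingEnd ℂ (D.velocity p) * D.velocity q).im) • D.velocity q) ∈ F.1.1

open Classical in
/-- The Goeritz index of a crossing. -/
noncomputable def goeritzIndex (c : D.Crossing) : ℤ := if s.OverOnRight c then 1 else -1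

/-- The off-diagonal entries of the Goeritz matrix (for `F ≠ F'`): minus the sum of the Goeritz
indices of the crossings that are incident on both faces. -/
noncomputable def goeritzOffDiag (F F' : s.Unshaded) : ℤ :=
  -∑ᶠ (c : D.Crossing) (_ : c.Incident F.1 ∧ c.Incident F'.1), s.goeritzIndex c

open Classical in
/-- The unreduced Goeritz matrix, indexed by the unshaded faces. -/
noncomputable def goeritz : Matrix s.Unshaded s.Unshaded ℤ := fun F F' =>
  if F = F' then -∑ᶠ (E : s.Unshaded) (_ : E ≠ F), s.goeritzOffDiag F E
  else s.goeritzOffDiag F F'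

/-- The kernel of the Goeritz matrix, acting on the functions from the unshaded
faces to `A`. -/
noncomputable def kerGoeritz [Finite D.Face] (A : Type*) [AddCommGroup A] :
    AddSubgroup (s.Unshaded → A) where
  carrier := {v | ∀ F, ∑ᶠ F' : s.Unshaded, s.goeritz F F' • v F' = 0}
  zero_mem' := by intro F; simp
  add_mem' := by
    intro v w hv hw F
    simp only [Pi.add_apply, smul_add]
    rw [finsum_add_distrib (Set.toFinite _) (Set.toFinite _), hv F, hw F, add_zero]
  neg_mem' := by
    intro v hv F
    simp only [Pi.neg_apply, smul_neg]
    rw [finsum_neg_distrib, hv F, neg_zero]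

/-- The shaded checkerboard graph: its vertices are the shaded faces, and two of them are joined
if some crossing is incident on both. (Loops and multiple edges are forgotten; they do not
matter for the connected components.) -/
def shadedGraph : SimpleGraph s.Shaded where
  Adj S S' := S ≠ S' ∧ ∃ c : D.Crossing, c.Incident S.1 ∧ c.Incident S'.1
  symm := ⟨fun _ _ h => ⟨h.1.symm, h.2.imp fun _ hc => hc.symm⟩⟩
  loopless := ⟨fun _ h => h.1 rfl⟩

/-- The number of connected components of the shaded checkerboard graph. -/
noncomputable def beta : ℕ := Nat.card s.shadedGraph.ConnectedComponent

end Shading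

end LinkDiagram

/-! At a crossing with corners C₀, …, C₃ in cyclic order, the Dehn condition along the overpassing
arc reads d(C₀) + d(C₃) = d(C₁) + d(C₂). The shading alternates around the crossing, so this says
that the difference of the two shaded values is η(c) times the difference of the two unshaded values
(`Shading.mem_dehnColorings_iff`). Values x on the unshaded faces thus prescribe a 1-cochain w on
the edges of the shaded graph, and x extends to a coloring exactly when w is a coboundary, i.e.
vanishes on all cycles.

The shaded graph and the graph on the unshaded faces are dual in the plane, so the cycles are the
integer combinations of the boundaries of unshaded faces. The Goeritz matrix is a weighted
Laplacian, and entry F of G·x is the sum of w around F (`Shading.mem_kerGoeritz_iff`). Hence x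
extends iff G·x = 0. Integrating w along chains from one base face per component, chosen
independently of x, gives the additive section u. If x = 0, the shaded values are only required to
be constant on components, which gives A^β.

Both halves of the duality are proved without Euler characteristic. Boundaries are cycles: along
closed curves, the jumps at the double points of any function of the pair (left face, right face)
cancel (`sum_jumps_eq_zero`, `sum_corners_eq_zero`). Cycles are boundaries: a cycle is realized by
paths through shaded faces and crossings, and its winding number is constant on each unshaded face
and jumps by the coefficient of c across c (`Shading.exists_potential`).

The geometric input is local. Near a point the branches are graphs in polar coordinates
(`IsBranch.exists_isPolar`) and cut a disc into as many sectors as there are branches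
(`exists_faces_of_fan`), two at a simple point and four at a crossing. That the two sides of a curve
are different faces is global and again follows from a winding number (`sides_fst_ne_snd`). -/

open scoped Pointwise

/-! ### Continuous logarithms along a path and their jumps -/

/-- A continuous function on a preconnected set whose values are logarithms of `1` is constant. -/
theorem IsPreconnected.eq_of_exp_eq_one {X : Type*} [TopologicalSpace X] {S : Set X}
    (hS : IsPreconnected S) {g : X → ℂ} (hg : ContinuousOn g S)
    (h1 : ∀ t ∈ S, Complex.exp (g t) = 1) {x y : X} (hx : x ∈ S) (hy : y ∈ S) : g x = g y := by
  have hc : ({z : ℂ | Complex.exp z = 1}).Countable := by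
    have : {z : ℂ | Complex.exp z = 1} ⊆ range fun n : ℤ => (n : ℂ) * (2 * Real.pi * Complex.I) := by
      intro z hz
      obtain ⟨n, hn⟩ := Complex.exp_eq_one_iff.1 hz
      exact ⟨n, hn.symm⟩
    exact (countable_range _).mono this
  have := (hc.mono (s₁ := g '' S) (by rintro _ ⟨t, ht, rfl⟩; exact h1 t ht)).isTotallyDisconnected
  exact this _ subset_rfl (hS.image g hg) (mem_image_of_mem _ hx) (mem_image_of_mem _ hy)

/-- `δ` is the change of a continuous logarithm of `f - z` along `[a, b]`. -/
def IsLogVar (f : ℝ → ℂ) (a b : ℝ) (z δ : ℂ) : Prop :=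
  ∃ g : ℝ → ℂ, ContinuousOn g (Icc a b) ∧ (∀ t ∈ Icc a b, Complex.exp (g t) = f t - z) ∧
    g b - g a = δ

theorem IsLogVar.unique {f : ℝ → ℂ} {a b : ℝ} (hab : a ≤ b) {z δ δ' : ℂ}
    (h : IsLogVar f a b z δ) (h' : IsLogVar f a b z δ') : δ = δ' := by
  obtain ⟨g, hg, he, rfl⟩ := h
  obtain ⟨g', hg', he', rfl⟩ := h'
  have := (isPreconnected_Icc (a := a) (b := b)).eq_of_exp_eq_one (hg.sub hg') (fun t ht => by
    rw [Pi.sub_apply, Complex.exp_sub, he t ht, he' t ht, div_self]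
    rw [← he t ht]; exact Complex.exp_ne_zero _) (right_mem_Icc.2 hab) (left_mem_Icc.2 hab)
  simp only [Pi.sub_apply] at this
  linear_combination this

theorem exists_isLogVar {f : ℝ → ℂ} {a b : ℝ} (hab : a ≤ b) (hf : ContinuousOn f (Icc a b)) {z : ℂ}
    (hz : ∀ t ∈ Icc a b, f t ≠ z) : ∃ δ, IsLogVar f a b z δ := by
  have hu : IsSimplyConnected (univ : Set ℝ) := by
    have : SimplyConnectedSpace (univ : Set ℝ) := (Homeomorph.Set.univ ℝ).toHomotopyEquiv.simplyConnectedSpace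
    exact this
  -- Extended by its end values, `f` is defined on the whole line, which is simply connected, so a
  -- continuous logarithm exists there.
  have hF : Continuous (IccExtend hab ((Icc a b).domRestrict f)) :=
    (continuousOn_iff_continuous_domRestrict.1 hf).Icc_extend'
  obtain ⟨g, hg, he⟩ := Complex.exists_continuousOn_eqOn_exp_comp hu isOpen_univ
    (g := fun t => IccExtend hab ((Icc a b).domRestrict f) t - z) (by fun_prop) (by
      rintro ⟨t, -, ht⟩
      exact hz _ (projIcc a b hab t).2 (sub_eq_zero.1 ht))
  refine ⟨_, g, hg.mono (subset_univ _), fun t ht => ?_, rfl⟩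
  have := he (mem_univ t)
  simpa [IccExtend_of_mem hab _ ht, domRestrict] using this

open Classical in
/-- The change of a continuous logarithm of `f - z` along `[a, b]`. -/
noncomputable def logVar (f : ℝ → ℂ) (a b : ℝ) (z : ℂ) : ℂ :=
  if h : ∃ δ, IsLogVar f a b z δ then h.choose else 0

theorem isLogVar_logVar {f : ℝ → ℂ} {a b : ℝ} (hab : a ≤ b) (hf : ContinuousOn f (Icc a b)) {z : ℂ}
    (hz : ∀ t ∈ Icc a b, f t ≠ z) : IsLogVar f a b z (logVar f a b z) := by
  rw [logVar, dif_pos (exists_isLogVar hab hf hz)]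
  exact (exists_isLogVar hab hf hz).choose_spec

theorem IsLogVar.logVar_eq {f : ℝ → ℂ} {a b : ℝ} (hab : a ≤ b) {z δ : ℂ}
    (h : IsLogVar f a b z δ) : logVar f a b z = δ := by
  have h' : ∃ δ, IsLogVar f a b z δ := ⟨δ, h⟩
  rw [logVar, dif_pos h']
  exact h'.choose_spec.unique hab h

theorem exp_logVar {f : ℝ → ℂ} {a b : ℝ} (hab : a ≤ b) (hf : ContinuousOn f (Icc a b)) {z : ℂ}
    (hz : ∀ t ∈ Icc a b, f t ≠ z) : Complex.exp (logVar f a b z) = (f b - z) / (f a - z) := by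
  obtain ⟨g, hg, he, h⟩ := isLogVar_logVar hab hf hz
  rw [← h, Complex.exp_sub, he b (right_mem_Icc.2 hab), he a (left_mem_Icc.2 hab)]

/-- The difference of two log variations is computed by any continuous logarithm of the ratio. -/
theorem logVar_sub_eq {f : ℝ → ℂ} {a b : ℝ} (hab : a ≤ b) (hf : ContinuousOn f (Icc a b)) {z w : ℂ}
    (hw : ∀ t ∈ Icc a b, f t ≠ w) {g : ℝ → ℂ}
    (hg : ContinuousOn g (Icc a b)) (he : ∀ t ∈ Icc a b, Complex.exp (g t) = (f t - z) / (f t - w)) :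
    logVar f a b z - logVar f a b w = g b - g a := by
  obtain ⟨k, hk, hke, h⟩ := isLogVar_logVar hab hf hw
  have : IsLogVar f a b z (logVar f a b w + (g b - g a)) := by
    refine ⟨k + g, hk.add hg, fun t ht => ?_, by rw [← h]; simp; ring⟩
    rw [Pi.add_apply, Complex.exp_add, hke t ht, he t ht]
    field_simp [sub_ne_zero.2 (hw t ht)]
  rw [this.logVar_eq hab]; ring

/-- If w is closer to z than the path is, then (f t − w)/(f t − z) stays in the unit disc around 1.
The principal logarithm of this ratio is then continuous along the path, and its two end values,
which depend continuously on w, give the change of the variation. -/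
theorem continuousAt_logVar {f : ℝ → ℂ} {a b : ℝ} (hab : a ≤ b) (hf : ContinuousOn f (Icc a b))
    {z : ℂ} (hz : ∀ t ∈ Icc a b, f t ≠ z) : ContinuousAt (logVar f a b) z := by
  obtain ⟨m, hm, hmz⟩ : ∃ m > 0, ∀ t ∈ Icc a b, m ≤ ‖f t - z‖ := by
    obtain ⟨t, ht, hmin⟩ := isCompact_Icc.exists_isMinOn (nonempty_Icc.2 hab)
      ((hf.sub continuousOn_const).norm : ContinuousOn (fun t => ‖f t - z‖) (Icc a b))
    exact ⟨_, norm_pos_iff.2 (sub_ne_zero.2 (hz t ht)), fun s hs => hmin hs⟩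
  have key : ∀ w ∈ Metric.ball z m, logVar f a b w =
      logVar f a b z + (Complex.log ((f b - w) / (f b - z)) - Complex.log ((f a - w) / (f a - z))) := by
    intro w hw
    have hw' : ∀ t ∈ Icc a b, f t ≠ w := by
      rintro t ht rfl
      have := hmz t ht
      rw [Metric.mem_ball, dist_eq_norm] at hw
      linarith
    have hsl : ∀ t ∈ Icc a b, (f t - w) / (f t - z) ∈ Complex.slitPlane := by
      intro t ht
      have h0 := sub_ne_zero.2 (hz t ht)
      have h1 : (f t - w) / (f t - z) = 1 + (z - w) / (f t - z) := by field_simp; ring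
      rw [h1]
      apply Complex.mem_slitPlane_of_norm_lt_one
      rw [norm_div, div_lt_one (norm_pos_iff.2 h0)]
      rw [Metric.mem_ball, dist_comm, dist_eq_norm] at hw
      exact hw.trans_le (hmz t ht)
    have := logVar_sub_eq hab hf hz (g := fun t => Complex.log ((f t - w) / (f t - z)))
      (((hf.sub continuousOn_const).div (hf.sub continuousOn_const)
        fun t ht => sub_ne_zero.2 (hz t ht)).clog hsl)
      (fun t ht => Complex.exp_log (Complex.slitPlane_ne_zero (hsl t ht)))
    linear_combination this
  have : ContinuousAt (fun w => logVar f a b z +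
      (Complex.log ((f b - w) / (f b - z)) - Complex.log ((f a - w) / (f a - z)))) z := by
    have h1 : ∀ t ∈ Icc a b, ContinuousAt (fun w => Complex.log ((f t - w) / (f t - z))) z := by
      intro t ht
      apply ContinuousAt.clog
      · exact (continuousAt_const.sub continuousAt_id).div_const _
      · simp [div_self (sub_ne_zero.2 (hz t ht))]
    exact continuousAt_const.add ((h1 b (right_mem_Icc.2 hab)).sub (h1 a (left_mem_Icc.2 hab)))
  exact this.congr (eventually_of_mem (Metric.ball_mem_nhds z hm) fun w hw => (key w hw).symm)

/-- The argument of w lies in (−π/2, π/2), so neither quarter turn reaches the cut and the arguments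
simply add. Together with its mirror image, this evaluates the jump at the two ends of a path. -/
theorem log_I_mul_sub_log_neg_I_mul_of_re_pos {w : ℂ} (hw : 0 < w.re) :
    Complex.log (Complex.I * w) - Complex.log (-Complex.I * w) = Real.pi * Complex.I := by
  have h0 : w ≠ 0 := by rintro rfl; simp at hw
  have ha := Complex.abs_arg_lt_pi_div_two_iff.2 (Or.inl hw)
  rw [abs_lt] at ha
  rw [Complex.log_mul Complex.I_ne_zero h0, Complex.log_mul (neg_ne_zero.2 Complex.I_ne_zero) h0]
  · rw [Complex.log_I, Complex.log_neg_I]; ring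
  · rw [Complex.arg_neg_I]; constructor <;> linarith
  · rw [Complex.arg_I]; constructor <;> linarith

theorem log_I_mul_sub_log_neg_I_mul_of_re_neg {w : ℂ} (hw : w.re < 0) :
    Complex.log (Complex.I * w) - Complex.log (-Complex.I * w) = -(Real.pi * Complex.I) := by
  have := log_I_mul_sub_log_neg_I_mul_of_re_pos (w := -w) (by simpa using hw)
  simp only [mul_neg, neg_mul, neg_neg] at this
  rw [← neg_mul] at this
  rw [← this]; ring

/-- The log variation along a path that crosses the point `f t₀` only once, in the direction `a`,
jumps by `2πi` there. -/
theorem tendsto_logVar_sub_logVar {f : ℝ → ℂ} {t₀ ε : ℝ} {a : ℂ} (hε : 0 < ε) (ha : a ≠ 0)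
    (hf : ContinuousOn f (Icc (t₀ - ε) (t₀ + ε)))
    (hb : ∀ t ∈ Icc (t₀ - ε) (t₀ + ε), ‖f t - f t₀ - (t - t₀) * a‖ ≤ ‖a‖ / 2 * |t - t₀|) :
    Tendsto (fun r : ℝ => logVar f (t₀ - ε) (t₀ + ε) (f t₀ + r • (Complex.I * a)) -
      logVar f (t₀ - ε) (t₀ + ε) (f t₀ - r • (Complex.I * a))) (𝓝[>] 0)
      (𝓝 (2 * Real.pi * Complex.I)) := by
  -- In the coordinate `q` the path runs along the real axis up to an error of half of |t − t₀|; in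
  -- particular it meets the imaginary axis only at 0.
  set q : ℝ → ℂ := fun t => (f t - f t₀) / a with hq
  have hqc : ContinuousOn q (Icc (t₀ - ε) (t₀ + ε)) := (hf.sub continuousOn_const).div_const _
  have hqb : ∀ t ∈ Icc (t₀ - ε) (t₀ + ε), ‖q t - ((t - t₀ : ℝ) : ℂ)‖ ≤ |t - t₀| / 2 := by
    intro t ht
    have h1 : q t - ((t - t₀ : ℝ) : ℂ) = (f t - f t₀ - (t - t₀) * a) / a := by
      simp only [hq]; push_cast; field_simp
    rw [h1, norm_div, div_le_iff₀ (norm_pos_iff.2 ha)]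
    calc _ ≤ _ := hb t ht
      _ = _ := by ring
  have hre : ∀ t ∈ Icc (t₀ - ε) (t₀ + ε), |(q t).re - (t - t₀)| ≤ |t - t₀| / 2 := by
    intro t ht
    have := (Complex.abs_re_le_norm _).trans (hqb t ht)
    simpa using this
  have hre0 : ∀ t ∈ Icc (t₀ - ε) (t₀ + ε), (q t).re = 0 → q t = 0 := by
    intro t ht h0
    have h := hre t ht
    rw [h0, zero_sub, abs_neg] at h
    have h2 : |t - t₀| = 0 := le_antisymm (by linarith) (abs_nonneg _)
    have h3 : t = t₀ := by rw [abs_eq_zero] at h2; linarith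
    simp [hq, h3]
  have hfq : ∀ t, f t = f t₀ + a * q t := fun t => by simp only [hq]; field_simp; ring
  -- the two logarithms, with the cuts on the two sides
  have hs1 : ∀ r > (0 : ℝ), ∀ t ∈ Icc (t₀ - ε) (t₀ + ε),
      Complex.I * (q t - r * Complex.I) ∈ Complex.slitPlane := by
    intro r hr t ht
    rw [Complex.mem_slitPlane_iff]
    by_cases h0 : (q t).re = 0
    · left; simp [hre0 t ht h0, mul_comm, hr]
    · right; simpa using h0
  have hs2 : ∀ r > (0 : ℝ), ∀ t ∈ Icc (t₀ - ε) (t₀ + ε),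
      -Complex.I * (q t + r * Complex.I) ∈ Complex.slitPlane := by
    intro r hr t ht
    rw [Complex.mem_slitPlane_iff]
    by_cases h0 : (q t).re = 0
    · left; simp [hre0 t ht h0, mul_comm, hr]
    · right; simpa using h0
  have hab : t₀ - ε ≤ t₀ + ε := by linarith
  -- The factors `I` and `-I` turn the cuts away from the path: upwards for the point on the left,
  -- downwards for the point on the right.
  set G : ℝ → ℝ → ℂ := fun r t => Complex.log (Complex.I * (q t - r * Complex.I)) -
      Complex.log (-Complex.I * (q t + r * Complex.I)) with hG
  have key : ∀ r > (0 : ℝ), logVar f (t₀ - ε) (t₀ + ε) (f t₀ + r • (Complex.I * a)) -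
      logVar f (t₀ - ε) (t₀ + ε) (f t₀ - r • (Complex.I * a)) =
      G r (t₀ + ε) - G r (t₀ - ε) := by
    intro r hr
    have e1 : ∀ t, f t - (f t₀ + r • (Complex.I * a)) = a * (q t - r * Complex.I) := fun t => by
      rw [hfq t]; simp only [Complex.real_smul]; ring
    have e2 : ∀ t, f t - (f t₀ - r • (Complex.I * a)) = a * (q t + r * Complex.I) := fun t => by
      rw [hfq t]; simp only [Complex.real_smul]; ring
    have n1 : ∀ t ∈ Icc (t₀ - ε) (t₀ + ε), q t - r * Complex.I ≠ 0 := fun t ht h => by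
      have := hs1 r hr t ht
      rw [h, mul_zero] at this
      exact Complex.slitPlane_ne_zero this rfl
    have n2 : ∀ t ∈ Icc (t₀ - ε) (t₀ + ε), q t + r * Complex.I ≠ 0 := fun t ht h => by
      have := hs2 r hr t ht
      rw [h, mul_zero] at this
      exact Complex.slitPlane_ne_zero this rfl
    have := logVar_sub_eq hab hf (z := f t₀ + r • (Complex.I * a)) (w := f t₀ - r • (Complex.I * a))
      (fun t ht h => mul_ne_zero ha (n2 t ht) (by rw [← e2, h, sub_self]))
      -- The quotient of the factors `I` and `-I` is −1; the constant πi corrects this sign and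
      -- drops out of the difference of the end values.
      (g := fun t => G r t + Real.pi * Complex.I) (by
        refine (ContinuousOn.sub ?_ ?_).add continuousOn_const
        · exact (continuousOn_const.mul (hqc.sub continuousOn_const)).clog (hs1 r hr)
        · exact (continuousOn_const.mul (hqc.add continuousOn_const)).clog (hs2 r hr))
      (fun t ht => by
        rw [Complex.exp_add, Complex.exp_pi_mul_I, Complex.exp_sub,
          Complex.exp_log (Complex.slitPlane_ne_zero (hs1 r hr t ht)),
          Complex.exp_log (Complex.slitPlane_ne_zero (hs2 r hr t ht)), e1, e2]
        have := n2 t ht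
        field_simp)
    rw [this]; ring
  have mp : t₀ + ε ∈ Icc (t₀ - ε) (t₀ + ε) := right_mem_Icc.2 hab
  have mm : t₀ - ε ∈ Icc (t₀ - ε) (t₀ + ε) := left_mem_Icc.2 hab
  have rp : 0 < (q (t₀ + ε)).re := by
    have := hre _ mp
    rw [show t₀ + ε - t₀ = ε by ring, abs_of_pos hε, abs_le] at this
    linarith
  have rm : (q (t₀ - ε)).re < 0 := by
    have := hre _ mm
    rw [show t₀ - ε - t₀ = -ε by ring, abs_neg, abs_of_pos hε, abs_le] at this
    linarith
  -- At the ends of the path the real part of `q` is not zero, so `r = 0` is harmless there although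
  -- the logarithms break down at `t₀`.
  have lim : ∀ t, (q t).re ≠ 0 → Tendsto (fun r => G r t) (𝓝[>] 0)
      (𝓝 (Complex.log (Complex.I * q t) - Complex.log (-Complex.I * q t))) := by
    intro t ht
    have : ContinuousAt (fun r : ℝ => G r t) 0 := by
      refine ContinuousAt.sub (ContinuousAt.clog (by fun_prop) ?_) (ContinuousAt.clog (by fun_prop) ?_)
      · rw [Complex.mem_slitPlane_iff]; right; simpa using ht
      · rw [Complex.mem_slitPlane_iff]; right; simpa using ht
    have h2 := this.tendsto.mono_left (nhdsWithin_le_nhds (s := Ioi 0))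
    simpa [hG] using h2
  have := (lim _ rp.ne').sub (lim _ rm.ne)
  rw [log_I_mul_sub_log_neg_I_mul_of_re_pos rp, log_I_mul_sub_log_neg_I_mul_of_re_neg rm] at this
  have e3 : (Real.pi : ℂ) * Complex.I - -(Real.pi * Complex.I) = 2 * Real.pi * Complex.I := by ring
  rw [e3] at this
  exact this.congr' (eventually_of_mem self_mem_nhdsWithin fun r hr => (key r hr).symm)

/-! ### Polar coordinates along a one-sided branch -/

/-- The image is an interval, and an order isomorphism between intervals is a homeomorphism. It
serves to use the radius as the parameter of a branch. -/
theorem exists_continuousOn_inverse {f : ℝ → ℝ} {a b : ℝ} (hab : a ≤ b)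
    (hf : ContinuousOn f (Icc a b)) (hm : StrictMonoOn f (Icc a b)) :
    ∃ g : ℝ → ℝ, ContinuousOn g (Icc (f a) (f b)) ∧
      (∀ y ∈ Icc (f a) (f b), g y ∈ Icc a b ∧ f (g y) = y) ∧ ∀ x ∈ Icc a b, g (f x) = x := by
  classical
  have him : f '' Icc a b = Icc (f a) (f b) := by
    apply Subset.antisymm
    · rintro _ ⟨x, hx, rfl⟩
      exact ⟨hm.monotoneOn (left_mem_Icc.2 hab) hx hx.1, hm.monotoneOn hx (right_mem_Icc.2 hab) hx.2⟩
    · exact intermediate_value_Icc hab hf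
  have : OrdConnected (f '' Icc a b) := by rw [him]; infer_instance
  let e := hm.orderIso f (Icc a b)
  have hes : Continuous e.symm := e.symm.continuous
  refine ⟨fun y => if hy : y ∈ f '' Icc a b then e.symm ⟨y, hy⟩ else a, ?_, ?_, ?_⟩
  · rw [← him, continuousOn_iff_continuous_domRestrict]
    convert (continuous_subtype_val.comp hes) using 1
    ext y
    simp only [domRestrict_apply, Function.comp_apply]
    rw [dif_pos y.2]
  · intro y hy
    rw [← him] at hy
    simp only [dif_pos hy]
    refine ⟨(e.symm ⟨y, hy⟩).2, ?_⟩
    exact congrArg Subtype.val (e.apply_symm_apply ⟨y, hy⟩)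
  · intro x hx
    have hy : f x ∈ f '' Icc a b := mem_image_of_mem f hx
    simp only [dif_pos hy]
    exact congrArg Subtype.val (e.symm_apply_apply ⟨x, hx⟩)

/-- `β` is (the germ of) a `C¹` curve that starts at the origin with the velocity `u`, with
derivative `β'`. -/
structure IsBranch (β β' : ℝ → ℂ) (u : ℂ) : Prop where
  zero : β 0 = 0
  ne : u ≠ 0
  hasDerivAt : ∀ᶠ h in 𝓝[>] (0 : ℝ), HasDerivAt β (β' h) h
  hasDerivWithinAt : HasDerivWithinAt β u (Ici 0) 0
  tendsto : Tendsto β' (𝓝[>] 0) (𝓝 u)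

/-- The part of the curve `β` over the interval `(0, h₀)` is, in polar coordinates, the graph of
the angle function `θ` over the interval `(0, R)` of radii. -/
structure IsPolar (β β' : ℝ → ℂ) (u : ℂ) (h₀ R : ℝ) (θ : ℝ → ℝ) : Prop where
  pos : 0 < h₀
  R_pos : 0 < R
  continuousOn : ContinuousOn θ (Ioo 0 R)
  tendsto : Tendsto θ (𝓝[>] 0) (𝓝 u.arg)
  mem : ∀ h ∈ Ioo 0 h₀, ‖β h‖ ∈ Ioo 0 R
  eq : ∀ h ∈ Ioo 0 h₀, β h = ‖β h‖ * Complex.exp (θ ‖β h‖ * Complex.I)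
  surj : ∀ r ∈ Ioo 0 R, ∃ h ∈ Ioo 0 h₀, ‖β h‖ = r
  hasDerivAt : ∀ h ∈ Ioo 0 h₀, HasDerivAt β (β' h) h
  ne : ∀ h ∈ Ioo 0 h₀, β' h ≠ 0
  radial : ∀ h ∈ Ioo 0 h₀, 0 < (starRingEnd ℂ (β h) * β' h).re

/-- Divided by `u`, the branch is h up to h/4 and its derivative is 1 up to 1/4. Hence the radial
component of the velocity is positive, the radius increases strictly and can replace the parameter.
-/
theorem IsBranch.exists_isPolar {β β' : ℝ → ℂ} {u : ℂ} (hb : IsBranch β β' u) {δ : ℝ} (hδ : 0 < δ) :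
    ∃ h₀ < δ, ∃ R θ, IsPolar β β' u h₀ R θ := by
  have hu : 0 < ‖u‖ := norm_pos_iff.2 hb.ne
  have hlin : ∀ᶠ h in 𝓝[>] (0 : ℝ), ‖β h - h * u‖ ≤ ‖u‖ / 4 * h := by
    have h1 := (hasDerivWithinAt_iff_isLittleO.1 hb.hasDerivWithinAt).def (c := ‖u‖ / 4) (by positivity)
    have h2 := h1.filter_mono (nhdsWithin_mono 0 (Ioi_subset_Ici_self (a := (0 : ℝ))))
    filter_upwards [h2, self_mem_nhdsWithin] with h hh hpos
    simpa [hb.zero, abs_of_pos (mem_Ioi.1 hpos)] using hh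
  have hder : ∀ᶠ h in 𝓝[>] (0 : ℝ), ‖β' h - u‖ < ‖u‖ / 4 := by
    have := hb.tendsto.eventually (Metric.ball_mem_nhds u (show 0 < ‖u‖ / 4 by positivity))
    filter_upwards [this] with h hh
    simpa [dist_eq_norm] using hh
  obtain ⟨h₁, h₁pos, hall⟩ := mem_nhdsGT_iff_exists_Ioo_subset.1 (hb.hasDerivAt.and (hlin.and hder))
  rw [mem_Ioi] at h₁pos
  set h₀ := min (h₁ / 2) (δ / 2) with hh₀
  have h₀pos : 0 < h₀ := by positivity
  have h₀δ : h₀ < δ := (min_le_right _ _).trans_lt (by linarith)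
  have h₀h₁ : h₀ < h₁ := (min_le_left _ _).trans_lt (by linarith)
  have H : ∀ h ∈ Ioc 0 h₀, HasDerivAt β (β' h) h ∧ ‖β h - h * u‖ ≤ ‖u‖ / 4 * h ∧
      ‖β' h - u‖ < ‖u‖ / 4 := fun h hh => hall ⟨hh.1, hh.2.trans_lt h₀h₁⟩
  -- everything is read off after division by `u`
  have hq : ∀ h ∈ Ioc 0 h₀, ‖β h / u - h‖ ≤ h / 4 := by
    intro h hh
    have e : β h / u - h = (β h - h * u) / u := by field_simp [hb.ne]
    rw [e, norm_div, div_le_iff₀ hu]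
    linarith [(H h hh).2.1]
  have hq' : ∀ h ∈ Ioc 0 h₀, ‖β' h / u - 1‖ < 1 / 4 := by
    intro h hh
    have e : β' h / u - 1 = (β' h - u) / u := by field_simp [hb.ne]
    rw [e, norm_div, div_lt_iff₀ hu]
    linarith [(H h hh).2.2]
  have hre : ∀ h ∈ Ioc 0 h₀, 3 / 4 * h ≤ (β h / u).re := by
    intro h hh
    have := (abs_le.1 ((Complex.abs_re_le_norm _).trans (hq h hh))).1
    simp only [Complex.sub_re, Complex.ofReal_re] at this
    linarith
  have him : ∀ h ∈ Ioc 0 h₀, |(β h / u).im| ≤ h / 4 := by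
    intro h hh
    have := (Complex.abs_im_le_norm _).trans (hq h hh)
    simpa using this
  have hre' : ∀ h ∈ Ioc 0 h₀, 3 / 4 < (β' h / u).re := by
    intro h hh
    have := (abs_lt.1 ((Complex.abs_re_le_norm _).trans_lt (hq' h hh))).1
    simp only [Complex.sub_re, Complex.one_re] at this
    linarith
  have him' : ∀ h ∈ Ioc 0 h₀, |(β' h / u).im| < 1 / 4 := by
    intro h hh
    have := (Complex.abs_im_le_norm _).trans_lt (hq' h hh)
    simpa using this
  have hrad : ∀ h ∈ Ioc 0 h₀, 0 < (starRingEnd ℂ (β h) * β' h).re := by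
    intro h hh
    have e : starRingEnd ℂ (β h) * β' h =
        (Complex.normSq u : ℂ) * (starRingEnd ℂ (β h / u) * (β' h / u)) := by
      rw [Complex.normSq_eq_conj_mul_self, map_div₀]
      have : starRingEnd ℂ u ≠ 0 := by simpa using hb.ne
      have := hb.ne
      field_simp
    rw [e, Complex.re_ofReal_mul]
    refine mul_pos (Complex.normSq_pos.2 hb.ne) ?_
    rw [Complex.mul_re, Complex.conj_re, Complex.conj_im]
    have a1 := hre h hh; have a2 := abs_le.1 (him h hh); have a3 := hre' h hh
    have a4 := abs_lt.1 (him' h hh)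
    -- The product of the real parts is at least 9h/16, that of the imaginary parts at most h/16 in
    -- absolute value.
    have : |(β h / u).im * (β' h / u).im| ≤ h / 4 * (1 / 4) := by
      rw [abs_mul]
      exact mul_le_mul (him h hh) (him' h hh).le (abs_nonneg _) (by linarith [hh.1])
    have b1 := (abs_le.1 this).1
    have b2 : 3 / 4 * h * (3 / 4) ≤ (β h / u).re * (β' h / u).re :=
      mul_le_mul a1 a3.le (by norm_num) (by linarith [hh.1])
    nlinarith [hh.1]
  have hne : ∀ h ∈ Ioc 0 h₀, β h ≠ 0 := by
    intro h hh h0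
    have := hre h hh
    rw [h0] at this
    simp at this
    linarith [hh.1]
  have hcβ : ContinuousOn β (Icc 0 h₀) := by
    intro h hh
    rcases hh.1.eq_or_lt with rfl | hpos
    · exact hb.hasDerivWithinAt.continuousWithinAt.mono fun x hx => hx.1
    · exact (H h ⟨hpos, hh.2⟩).1.continuousAt.continuousWithinAt
  have hcn : ContinuousOn (fun h => ‖β h‖) (Icc 0 h₀) := hcβ.norm
  have hmono2 : StrictMonoOn (fun h => ‖β h‖ ^ 2) (Icc 0 h₀) := by
    apply strictMonoOn_of_deriv_pos (convex_Icc _ _) (hcn.pow 2)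
    intro h hh
    rw [interior_Icc] at hh
    have hd := (H h ⟨hh.1, hh.2.le⟩).1
    have := hd.norm_sq
    rw [show (fun h => ‖β h‖) ^ 2 = fun h => ‖β h‖ ^ 2 from rfl, this.deriv, Complex.inner]
    have := hrad h ⟨hh.1, hh.2.le⟩
    rw [mul_comm] at this
    linarith
  have hmono : StrictMonoOn (fun h => ‖β h‖) (Icc 0 h₀) := by
    intro x hx y hy hxy
    exact lt_of_pow_lt_pow_left₀ 2 (norm_nonneg _) (hmono2 hx hy hxy)
  obtain ⟨g, hgc, hg1, hg2⟩ := exists_continuousOn_inverse h₀pos.le hcn hmono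
  simp only [hb.zero, norm_zero] at hgc hg1
  have hRpos : 0 < ‖β h₀‖ := norm_pos_iff.2 (hne h₀ ⟨h₀pos, le_rfl⟩)
  have hgpos : ∀ r ∈ Ioo 0 ‖β h₀‖, g r ∈ Ioo 0 h₀ := by
    intro r hr
    obtain ⟨a1, a2⟩ := hg1 r ⟨hr.1.le, hr.2.le⟩
    refine ⟨lt_of_le_of_ne a1.1 ?_, lt_of_le_of_ne a1.2 ?_⟩
    · intro h; rw [← h] at a2; simp [hb.zero] at a2; exact hr.1.ne a2
    · intro h; rw [h] at a2; exact hr.2.ne a2.symm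
  have hg0 : Tendsto g (𝓝[>] 0) (𝓝[>] 0) := by
    have c0 : g 0 = 0 := by
      have := hg2 0 ⟨le_rfl, h₀pos.le⟩
      simpa [hb.zero] using this
    refine tendsto_nhdsWithin_iff.2 ⟨?_, ?_⟩
    · have := hgc 0 ⟨le_rfl, hRpos.le⟩
      rw [ContinuousWithinAt, c0] at this
      refine this.mono_left ?_
      rw [← nhdsWithin_Ioo_eq_nhdsGT hRpos]
      exact nhdsWithin_mono _ Ioo_subset_Icc_self
    · filter_upwards [Ioo_mem_nhdsGT hRpos] with r hr using (hgpos r hr).1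
  -- Measuring the angle relative to `u` keeps `arg` away from its cut, since `β / u` has positive
  -- real part; the branch may well cross the negative real axis itself.
  refine ⟨h₀, h₀δ, ‖β h₀‖, fun r => u.arg + (β (g r) / u).arg, h₀pos, hRpos, ?_, ?_, ?_, ?_, ?_, ?_, ?_, ?_⟩
  · intro r hr
    have hr' := hgpos r hr
    have c1 : ContinuousAt g r := (hgc r ⟨hr.1.le, hr.2.le⟩).continuousAt (Icc_mem_nhds hr.1 hr.2)
    have c2 : ContinuousAt β (g r) := (H _ ⟨hr'.1, hr'.2.le⟩).1.continuousAt
    have c3 : ContinuousAt (fun r => β (g r) / u) r := (ContinuousAt.comp c2 c1).div_const u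
    refine (continuousAt_const.add (ContinuousAt.comp (Complex.continuousAt_arg ?_) c3)).continuousWithinAt
    rw [Complex.mem_slitPlane_iff]
    left
    have := hre _ ⟨hr'.1, hr'.2.le⟩
    linarith [hr'.1]
  · have l1 : Tendsto (fun h : ℝ => β h / h) (𝓝[>] 0) (𝓝 u) := by
      have := (hasDerivWithinAt_iff_tendsto_slope.1 hb.hasDerivWithinAt)
      have s : Ici (0 : ℝ) \ {0} = Ioi 0 := by ext; simp [lt_iff_le_and_ne, eq_comm]
      rw [s] at this
      refine this.congr fun h => ?_
      simp [slope, hb.zero, div_eq_inv_mul]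
    have l2 : Tendsto (fun h : ℝ => (β h / h / u).arg) (𝓝[>] 0) (𝓝 0) := by
      have := (l1.div_const u)
      rw [div_self hb.ne] at this
      have h2 := (Complex.continuousAt_arg Complex.one_mem_slitPlane).tendsto.comp this
      simpa [Function.comp_def] using h2
    have l3 : Tendsto (fun h : ℝ => (β h / u).arg) (𝓝[>] 0) (𝓝 0) := by
      refine l2.congr' ?_
      filter_upwards [self_mem_nhdsWithin] with h hh
      have e : β h / u = (h : ℝ) * (β h / h / u) := by
        have : (h : ℂ) ≠ 0 := by exact_mod_cast (mem_Ioi.1 hh).ne'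
        field_simp
      rw [e, Complex.arg_real_mul _ hh]
    simpa using (tendsto_const_nhds (x := u.arg)).add (l3.comp hg0)
  · intro h hh
    refine ⟨norm_pos_iff.2 (hne h ⟨hh.1, hh.2.le⟩), ?_⟩
    exact hmono ⟨hh.1.le, hh.2.le⟩ ⟨h₀pos.le, le_rfl⟩ hh.2
  · intro h hh
    simp only [hg2 h ⟨hh.1.le, hh.2.le⟩]
    have e1 := Complex.norm_mul_exp_arg_mul_I u
    have e2 := Complex.norm_mul_exp_arg_mul_I (β h / u)
    have hu' : (‖u‖ : ℂ) ≠ 0 := by exact_mod_cast hu.ne'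
    push_cast
    rw [add_mul, Complex.exp_add]
    have e3 : (‖β h‖ : ℂ) = ‖u‖ * ‖β h / u‖ := by
      rw [norm_div]; push_cast; field_simp
    rw [e3]
    calc β h = u * (β h / u) := by field_simp [hb.ne]
      _ = _ := by nth_rewrite 1 [← e1, ← e2]; ring
  · intro r hr
    exact ⟨g r, hgpos r hr, (hg1 r ⟨hr.1.le, hr.2.le⟩).2⟩
  · exact fun h hh => (H h ⟨hh.1, hh.2.le⟩).1
  · intro h hh h0
    have := hre' h ⟨hh.1, hh.2.le⟩
    rw [h0] at this
    norm_num at this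
  · exact fun h hh => hrad h ⟨hh.1, hh.2.le⟩

/-! ### Moving along the curves; continuity and one-sided tangents -/

namespace LinkDiagram

variable (D : LinkDiagram)

/-- The parameter that is reached from `p` after moving by `s` along its circle. -/
def shift (p : D.Param) (s : ℝ) : D.Param := (p.1, p.2 + (s : UnitAddCircle))

@[simp] theorem shift_zero (p : D.Param) : D.shift p 0 = p := by simp [shift]

theorem shift_shift (p : D.Param) (s t : ℝ) : D.shift (D.shift p s) t = D.shift p (s + t) := by
  simp [shift, add_assoc]

theorem shift_add_one (p : D.Param) (s : ℝ) : D.shift p (s + 1) = D.shift p s := by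
  simp [shift]

theorem shift_injOn (p : D.Param) {s t : ℝ} (h : |s - t| < 1) (he : D.shift p s = D.shift p t) :
    s = t := by
  have h2 : ((s - t : ℝ) : UnitAddCircle) = 0 := by
    simp only [shift, Prod.mk.injEq, true_and, add_right_inj] at he
    rw [AddCircle.coe_sub, he, sub_self]
  obtain ⟨n, hn⟩ := AddCircle.coe_eq_zero_iff 1 |>.1 h2
  simp only [zsmul_eq_mul, mul_one] at hn
  rw [← hn] at h
  have : |n| < 1 := by exact_mod_cast h
  have : n = 0 := Int.abs_lt_one_iff.1 this
  rw [this] at hn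
  simp at hn
  linarith

theorem continuous_shift (p : D.Param) : Continuous (D.shift p) := by
  unfold shift
  exact continuous_const.prodMk (continuous_const.add (AddCircle.continuous_mk' 1))

/-- Moving along a circle is an open map onto the parameter space. Local statements at a parameter
thereby become statements about a real variable. -/
theorem map_shift_nhds (p : D.Param) (s : ℝ) : map (D.shift p) (𝓝 s) = 𝓝 (D.shift p s) := by
  have h1 : IsOpenMap (fun x : UnitAddCircle => p.2 + x) := isOpenMap_add_left p.2
  have h2 : IsOpenMap ((↑) : ℝ → UnitAddCircle) := QuotientAddGroup.isOpenMap_coe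
  have h3 : IsOpenMap (fun x : UnitAddCircle => ((p.1, x) : D.Param)) := by
    intro U hU
    have : (fun x : UnitAddCircle => ((p.1, x) : D.Param)) '' U = {p.1} ×ˢ U := by
      ext ⟨a, b⟩; simp [eq_comm, and_comm]
    rw [this]
    exact (isOpen_discrete _).prod hU
  have : IsOpenMap (D.shift p) := h3.comp (h1.comp h2)
  exact this.map_nhds_eq (D.continuous_shift p).continuousAt

theorem image_shift_mem_nhds (p : D.Param) {h : ℝ} (hh : 0 < h) : D.shift p '' Ioo (-h) h ∈ 𝓝 p := by
  have := D.map_shift_nhds p 0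
  rw [shift_zero] at this
  rw [← this]
  exact image_mem_map (Ioo_mem_nhds (by linarith) hh)

theorem deriv_point_shift (p : D.Param) (s : ℝ) :
    deriv (fun t => D.point (D.shift p t)) s = D.velocity (D.shift p s) := by
  have : D.velocity (D.shift p s) = deriv (fun t : ℝ => D.point (D.shift p (s + t))) 0 := by
    simp only [velocity, point, shift, AddCircle.coe_add, add_assoc]
  rw [this]
  have := deriv_comp_const_add (f := fun t => D.point (D.shift p t)) s 0
  rw [this, add_zero]

theorem piecewise_smooth_shift (p : D.Param) : ∃ ε > 0,
    ContDiffOn ℝ 1 (fun u : ℝ => D.point (D.shift p u)) (Icc 0 ε) ∧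
    derivWithin (fun u : ℝ => D.point (D.shift p u)) (Icc 0 ε) 0 ≠ 0 ∧
    ContDiffOn ℝ 1 (fun u : ℝ => D.point (D.shift p u)) (Icc (-ε) 0) ∧
    derivWithin (fun u : ℝ => D.point (D.shift p u)) (Icc (-ε) 0) 0 ≠ 0 := by
  obtain ⟨t, ht⟩ := QuotientAddGroup.mk_surjective p.2
  have ht' : ((t : ℝ) : UnitAddCircle) = p.2 := ht
  obtain ⟨ε, hε, h1, h2, h3, h4⟩ := D.piecewise_smooth p.1 t
  set g : ℝ → ℂ := fun u => D.γ p.1 u with hg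
  have e : (fun u : ℝ => D.point (D.shift p u)) = fun u => g (t + u) := by
    ext u; simp [point, shift, ← ht', hg]
  have i1 : t +ᵥ Icc (0 : ℝ) ε = Icc t (t + ε) := by
    rw [← image_vadd]; simp [add_comm]
  have i2 : t +ᵥ Icc (-ε) (0 : ℝ) = Icc (t - ε) t := by
    rw [← image_vadd]; simp [sub_eq_add_neg, add_comm]
  have c : ContDiff ℝ 1 (fun u : ℝ => t + u) := by fun_prop
  rw [e]
  refine ⟨ε, hε, ?_, ?_, ?_, ?_⟩
  · exact h1.comp c.contDiffOn fun u hu => ⟨by linarith [hu.1], by linarith [hu.2]⟩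
  · rw [derivWithin_comp_const_add g t, i1, add_zero]
    exact h2
  · exact h3.comp c.contDiffOn fun u hu => ⟨by linarith [hu.1], by linarith [hu.2]⟩
  · rw [derivWithin_comp_const_add g t, i2, add_zero]
    exact h4

/-- Continuity is not part of the definition of a diagram; it is recovered from the one-sided
smoothness on both sides of each parameter. -/
theorem continuous_point_shift (p : D.Param) : Continuous fun s => D.point (D.shift p s) := by
  rw [continuous_iff_continuousAt]
  intro s
  obtain ⟨ε, hε, h1, -, h3, -⟩ := D.piecewise_smooth_shift (D.shift p s)
  have hl : ContinuousAt (fun u : ℝ => D.point (D.shift (D.shift p s) u)) 0 := by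
    rw [continuousAt_iff_continuous_left_right]
    constructor
    · exact (h3.continuousOn 0 ⟨by linarith, le_rfl⟩).mono_of_mem_nhdsWithin
        (Icc_mem_nhdsLE (by linarith))
    · exact (h1.continuousOn 0 ⟨le_rfl, hε.le⟩).mono_of_mem_nhdsWithin
        (Icc_mem_nhdsGE (by linarith))
  simp only [shift_shift] at hl
  have : ContinuousAt (fun u : ℝ => u - s) s := by fun_prop
  have h0 : s - s = 0 := sub_self s
  rw [← h0] at hl
  have := ContinuousAt.comp (f := fun u : ℝ => u - s) hl this
  simpa [Function.comp_def] using this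

theorem continuous_point : Continuous D.point := by
  rw [continuous_iff_continuousAt]
  intro p
  have := D.map_shift_nhds p 0
  rw [shift_zero] at this
  rw [ContinuousAt, ← this, tendsto_map'_iff]
  have := (D.continuous_point_shift p).tendsto 0
  simpa [Function.comp_def] using this

theorem isCompact_support : IsCompact D.support := isCompact_range D.continuous_point

theorem isOpen_compl_support : IsOpen D.supportᶜ := D.isCompact_support.isClosed.isOpen_compl

/-- The curve near the parameter `p`, seen from `p` in the direction `σ`. -/
def branch (p : D.Param) (σ h : ℝ) : ℂ := D.point (D.shift p (σ * h)) - D.point p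

/-- The derivative of `D.branch p σ`. -/
noncomputable def branchDeriv (p : D.Param) (σ h : ℝ) : ℂ := σ * D.velocity (D.shift p (σ * h))

theorem point_shift (p : D.Param) (σ h : ℝ) :
    D.point (D.shift p (σ * h)) = D.point p + D.branch p σ h := by
  simp [branch]

/-- Both branches of the curve at any parameter are `C¹` up to this parameter. -/
theorem exists_isBranch (p : D.Param) {σ : ℝ} (hσ : σ = 1 ∨ σ = -1) :
    ∃ u, IsBranch (D.branch p σ) (D.branchDeriv p σ) u ∧
      (D.velocity p ≠ 0 → u = σ * D.velocity p) := by
  -- the case of a `C¹` function on an interval on one side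
  have aux : ∀ (f : ℝ → ℂ) (ε : ℝ), 0 < ε → f 0 = 0 → ContDiffOn ℝ 1 f (Icc 0 ε) →
      derivWithin f (Icc 0 ε) 0 ≠ 0 → IsBranch f (deriv f) (derivWithin f (Icc 0 ε) 0) := by
    intro f ε hε h0 hf hne
    have hmem : (0 : ℝ) ∈ Icc 0 ε := ⟨le_rfl, hε.le⟩
    have hev : ∀ᶠ h in 𝓝[>] (0 : ℝ), Icc 0 ε ∈ 𝓝 h := by
      filter_upwards [Ioo_mem_nhdsGT hε] with h hh using Icc_mem_nhds hh.1 hh.2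
    refine ⟨h0, hne, ?_, ?_, ?_⟩
    · filter_upwards [hev] with h hh
      exact ((hf.differentiableOn (by norm_num) h (mem_of_mem_nhds hh)).differentiableAt hh).hasDerivAt
    · exact (hf.differentiableOn (by norm_num) 0 hmem).hasDerivWithinAt.mono_of_mem_nhdsWithin
        (Icc_mem_nhdsGE hε)
    · have hc := (hf.continuousOn_derivWithin (uniqueDiffOn_Icc hε) le_rfl) 0 hmem
      have h1 : Tendsto (derivWithin f (Icc 0 ε)) (𝓝[>] 0) (𝓝 (derivWithin f (Icc 0 ε) 0)) := by
        refine hc.mono_left ?_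
        rw [← nhdsWithin_Ioo_eq_nhdsGT hε]
        exact nhdsWithin_mono _ Ioo_subset_Icc_self
      refine h1.congr' ?_
      filter_upwards [hev] with h hh
      exact derivWithin_of_mem_nhds hh
  obtain ⟨ε, hε, h1, h2, h3, h4⟩ := D.piecewise_smooth_shift p
  have hbr : D.branch p σ = fun h => D.point (D.shift p (σ * h)) - D.point p := rfl
  have hder : D.branchDeriv p σ = deriv (D.branch p σ) := by
    ext h
    rw [hbr, deriv_sub_const]
    have := deriv_comp_mul_left σ (fun t => D.point (D.shift p t)) h
    rw [this, deriv_point_shift, branchDeriv, Complex.real_smul]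
  have main : ∃ ε > 0, ContDiffOn ℝ 1 (D.branch p σ) (Icc 0 ε) ∧
      derivWithin (D.branch p σ) (Icc 0 ε) 0 ≠ 0 := by
    rcases hσ with rfl | rfl
    · refine ⟨ε, hε, ?_, ?_⟩
      · rw [hbr]; simp only [one_mul]; exact h1.sub contDiffOn_const
      · rw [hbr]; simp only [one_mul]; rw [derivWithin_sub_const]; exact h2
    · refine ⟨ε, hε, ?_, ?_⟩
      · rw [hbr]
        refine ContDiffOn.sub ?_ contDiffOn_const
        have c : ContDiff ℝ 1 (fun u : ℝ => -1 * u) := by fun_prop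
        exact h3.comp c.contDiffOn fun u hu => ⟨by linarith [hu.2], by linarith [hu.1]⟩
      · rw [hbr, derivWithin_sub_const]
        simp only [neg_mul, one_mul]
        have := derivWithin_comp_neg (f := fun t => D.point (D.shift p t)) (s := Icc 0 ε) (0 : ℝ)
        rw [this]
        simpa using h4
  obtain ⟨ε', hε', m1, m2⟩ := main
  refine ⟨derivWithin (D.branch p σ) (Icc 0 ε') 0, ?_, ?_⟩
  · rw [hder]
    exact aux _ ε' hε' (by simp [branch]) m1 m2
  · intro hv
    -- `deriv` is 0 where the derivative does not exist, so a nonzero velocity certifies a genuine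
    -- two-sided derivative, which the one-sided one must equal up to the sign `σ`.
    have hd : DifferentiableAt ℝ (fun t => D.point (D.shift p t)) 0 := by
      apply differentiableAt_of_deriv_ne_zero
      rw [deriv_point_shift, shift_zero]; exact hv
    have hd' : DifferentiableAt ℝ (D.branch p σ) 0 := by
      rw [hbr]
      refine DifferentiableAt.sub_const ?_ _
      have h0 : (0 : ℝ) = σ * 0 := by simp
      rw [h0] at hd
      exact hd.comp (0 : ℝ) (by fun_prop : DifferentiableAt ℝ (fun h : ℝ => σ * h) 0)
    rw [hd'.derivWithin (uniqueDiffOn_Icc hε' 0 ⟨le_rfl, hε'.le⟩), ← congrFun hder 0, branchDeriv]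
    simp

/-- A parameter of a crossing. -/
def IsDouble (p : D.Param) : Prop := ∃ q, q ≠ p ∧ D.point q = D.point p

theorem finite_isDouble : {p | D.IsDouble p}.Finite := by
  have h : {p | D.IsDouble p} ⊆ ⋃ x ∈ {x : ℂ | ∃ p q : Fin D.μ × UnitAddCircle,
      p ≠ q ∧ D.γ p.1 p.2 = x ∧ D.γ q.1 q.2 = x}, {p : D.Param | D.γ p.1 p.2 = x} := by
    rintro p ⟨q, hq, he⟩
    simp only [mem_iUnion]
    exact ⟨D.point p, ⟨p, q, hq.symm, rfl, he⟩, rfl⟩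
  refine (D.finite_double.biUnion fun x _ => ?_).subset h
  exact finite_of_encard_le_coe (k := 2) (by exact_mod_cast D.double x)

theorem eventually_not_isDouble (p : D.Param) : ∀ᶠ q in 𝓝[≠] p, ¬ D.IsDouble q := by
  have : ({q | D.IsDouble q} \ {p})ᶜ ∈ 𝓝 p := by
    apply IsOpen.mem_nhds
    · exact (D.finite_isDouble.subset sdiff_subset).isClosed.isOpen_compl
    · simp
  rw [eventually_nhdsWithin_iff]
  filter_upwards [this] with q hq hne hd
  exact hq ⟨hd, hne⟩

theorem tendsto_shift_nhdsNE (p : D.Param) : Tendsto (D.shift p) (𝓝[≠] 0) (𝓝[≠] p) := by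
  refine tendsto_nhdsWithin_iff.2 ⟨?_, ?_⟩
  · have := (D.continuous_shift p).tendsto 0
    rw [shift_zero] at this
    exact this.mono_left nhdsWithin_le_nhds
  · have : Ioo (-1 : ℝ) 1 ∈ 𝓝[≠] (0 : ℝ) := mem_nhdsWithin_of_mem_nhds (Ioo_mem_nhds (by norm_num) (by norm_num))
    filter_upwards [this, self_mem_nhdsWithin] with s hs hne he
    have h0 : D.shift p s = D.shift p 0 := by simpa using he
    exact hne (D.shift_injOn p (by rw [sub_zero, abs_lt]; exact hs) h0)

theorem tendsto_mul_nhdsGT {σ : ℝ} (hσ : σ = 1 ∨ σ = -1) :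
    Tendsto (fun h : ℝ => σ * h) (𝓝[>] 0) (𝓝[≠] 0) := by
  refine tendsto_nhdsWithin_iff.2 ⟨?_, ?_⟩
  · have : Continuous fun h : ℝ => σ * h := by fun_prop
    simpa using (this.tendsto 0).mono_left (nhdsWithin_le_nhds (s := Ioi 0))
  · filter_upwards [self_mem_nhdsWithin] with h hh
    rcases hσ with rfl | rfl <;> simp [(mem_Ioi.1 hh).ne']

theorem eventually_shift_not_isDouble (p : D.Param) {σ : ℝ} (hσ : σ = 1 ∨ σ = -1) :
    ∀ᶠ h in 𝓝[>] (0 : ℝ), ¬ D.IsDouble (D.shift p (σ * h)) :=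
  ((D.tendsto_shift_nhdsNE p).comp (tendsto_mul_nhdsGT hσ)).eventually (D.eventually_not_isDouble p)

/-- Near a point `x`, only those parts of the curves are seen whose parameters are close to the
parameters of `x`. -/
theorem exists_ball_subset_of_mem_nhds (x : ℂ) {V : Set D.Param}
    (hV : ∀ p, D.point p = x → V ∈ 𝓝 p) :
    ∃ ρ > 0, ∀ p, dist (D.point p) x < ρ → p ∈ V := by
  have hc : IsClosed (D.point '' (interior V)ᶜ) :=
    (isOpen_interior.isClosed_compl.isCompact.image D.continuous_point).isClosed
  have hx : x ∈ (D.point '' (interior V)ᶜ)ᶜ := by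
    rintro ⟨p, hp, hpx⟩
    exact hp (mem_interior_iff_mem_nhds.2 (hV p hpx))
  obtain ⟨ρ, hρ, hb⟩ := Metric.isOpen_iff.1 hc.isOpen_compl x hx
  refine ⟨ρ, hρ, fun p hp => ?_⟩
  by_contra hn
  exact hb (Metric.mem_ball.2 hp) ⟨p, fun h => hn (interior_subset h), rfl⟩

/-! ### Faces, sectors, and the two sides of a curve -/

variable {D}

theorem Face.isOpen (F : D.Face) : IsOpen F.1 := by
  obtain ⟨x, hx, h⟩ := F.2
  rw [h]
  exact D.isOpen_compl_support.pathComponentIn x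

theorem Face.isPathConnected (F : D.Face) : IsPathConnected F.1 := by
  obtain ⟨x, hx, h⟩ := F.2
  rw [h]
  exact isPathConnected_pathComponentIn hx

theorem Face.subset (F : D.Face) : F.1 ⊆ D.supportᶜ := by
  obtain ⟨x, hx, h⟩ := F.2
  rw [h]
  exact pathComponentIn_subset

theorem Face.eq_pathComponentIn (F : D.Face) {x : ℂ} (hx : x ∈ F.1) :
    F.1 = pathComponentIn D.supportᶜ x := by
  obtain ⟨y, hy, h⟩ := F.2
  rw [h] at hx ⊢
  exact (pathComponentIn_congr hx).symm

theorem Face.eq_of_mem {F F' : D.Face} {x : ℂ} (hx : x ∈ F.1) (hx' : x ∈ F'.1) : F = F' :=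
  Subtype.ext ((F.eq_pathComponentIn hx).trans (F'.eq_pathComponentIn hx').symm)

theorem exists_face_mem {x : ℂ} (hx : x ∈ D.supportᶜ) : ∃ F : D.Face, x ∈ F.1 :=
  ⟨⟨_, x, hx, rfl⟩, mem_pathComponentIn_self hx⟩

/-- A point off the curves lies in some open face; if it is also in the closure of `F`, that face
meets `F` and so is `F`. -/
theorem Face.frontier_eq (F : D.Face) : frontier F.1 = closure F.1 ∩ D.support := by
  rw [F.isOpen.frontier_eq]
  ext x
  refine ⟨fun ⟨h1, h2⟩ => ⟨h1, ?_⟩, fun ⟨h1, h2⟩ => ⟨h1, fun h => F.subset h h2⟩⟩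
  by_contra hn
  obtain ⟨F', hF'⟩ := exists_face_mem (D := D) hn
  obtain ⟨y, hy, hy'⟩ := mem_closure_iff.1 h1 F'.1 F'.isOpen hF'
  rw [Face.eq_of_mem hy hy'] at hF'
  exact h2 hF'

/-- A connected set that avoids the curves lies in one face. -/
theorem exists_face_of_isPreconnected {S : Set ℂ} (hS : IsPreconnected S) (hne : S.Nonempty)
    (hd : S ⊆ D.supportᶜ) : ∃ F : D.Face, S ⊆ F.1 := by
  obtain ⟨x, hx⟩ := hne
  obtain ⟨F, hF⟩ := exists_face_mem (D := D) (hd hx)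
  refine ⟨F, ?_⟩
  refine hS.subset_of_closure_inter_subset F.isOpen ⟨x, hx, hF⟩ ?_
  rintro y ⟨hy, hyS⟩
  by_contra hn
  have : y ∈ frontier F.1 := by rw [F.isOpen.frontier_eq]; exact ⟨hy, hn⟩
  rw [F.frontier_eq] at this
  exact hd hyS this.2

/-- The face `F` contains the points `x + r * exp (φ * I)` with `0 < r < ρ` and
`α r < φ < β r`. -/
def ContainsSector (F : D.Face) (x : ℂ) (ρ : ℝ) (α β : ℝ → ℝ) : Prop :=
  ∀ r ∈ Ioo 0 ρ, ∀ φ ∈ Ioo (α r) (β r), x + r * Complex.exp (φ * Complex.I) ∈ F.1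

/-- The sector is the continuous image of an open rectangle, with radius and relative angle as
coordinates, and therefore is connected. -/
theorem exists_containsSector {x : ℂ} {ρ : ℝ} (hρ : 0 < ρ) {α β : ℝ → ℝ}
    (hα : ContinuousOn α (Ioo 0 ρ)) (hβ : ContinuousOn β (Ioo 0 ρ))
    (hαβ : ∀ r ∈ Ioo 0 ρ, α r < β r)
    (hfree : ∀ r ∈ Ioo 0 ρ, ∀ φ ∈ Ioo (α r) (β r),
      x + r * Complex.exp (φ * Complex.I) ∉ D.support) :
    ∃ F : D.Face, ContainsSector F x ρ α β := by
  let f : ℝ × ℝ → ℂ := fun a =>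
    x + a.1 * Complex.exp (((1 - a.2) * α a.1 + a.2 * β a.1 : ℝ) * Complex.I)
  have hc : ContinuousOn f (Ioo 0 ρ ×ˢ Ioo 0 1) := by
    have h1 : ContinuousOn (fun a : ℝ × ℝ => α a.1) (Ioo 0 ρ ×ˢ Ioo 0 1) :=
      hα.comp continuousOn_fst fun a ha => ha.1
    have h2 : ContinuousOn (fun a : ℝ × ℝ => β a.1) (Ioo 0 ρ ×ˢ Ioo 0 1) :=
      hβ.comp continuousOn_fst fun a ha => ha.1
    have h3 : ContinuousOn (fun a : ℝ × ℝ => (1 - a.2) * α a.1 + a.2 * β a.1)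
      (Ioo 0 ρ ×ˢ Ioo 0 1) :=
      ((continuousOn_const.sub continuousOn_snd).mul h1).add (continuousOn_snd.mul h2)
    have h4 := Complex.continuous_ofReal.comp_continuousOn h3
    simp only [Function.comp_def] at h4
    fun_prop
  have hS : IsPreconnected (f '' (Ioo 0 ρ ×ˢ Ioo 0 1)) :=
    (isPreconnected_Ioo.prod isPreconnected_Ioo).image f hc
  obtain ⟨F, hF⟩ := exists_face_of_isPreconnected (D := D) hS
    (((nonempty_Ioo.2 hρ).prod (nonempty_Ioo.2 one_pos)).image f) (by
      rintro _ ⟨⟨r, s⟩, ⟨hr, hs⟩, rfl⟩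
      have := hαβ r hr
      exact hfree r hr _ ⟨by nlinarith [hs.1, hs.2], by nlinarith [hs.1, hs.2]⟩)
  refine ⟨F, fun r hr φ hφ => ?_⟩
  apply hF
  have := hαβ r hr
  refine ⟨(r, (φ - α r) / (β r - α r)), ⟨hr, ?_, ?_⟩, ?_⟩
  · exact div_pos (by linarith [hφ.1]) (by linarith)
  · rw [div_lt_one (by linarith)]; linarith [hφ.2]
  · have h0 : β r - α r ≠ 0 := by linarith
    have e : (1 - (φ - α r) / (β r - α r)) * α r + (φ - α r) / (β r - α r) * β r = φ := by
      field_simp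
      ring
    simp only [f]
    rw [e]

theorem ContainsSector.mem_closure {F : D.Face} {x : ℂ} {ρ : ℝ} (hρ : 0 < ρ) {α β : ℝ → ℝ}
    (h : ContainsSector F x ρ α β) (hαβ : ∀ r ∈ Ioo 0 ρ, α r < β r) : x ∈ closure F.1 := by
  rw [Metric.mem_closure_iff]
  intro ε hε
  set r := min (ρ / 2) (ε / 2)
  have hr0 : 0 < r := by positivity
  have hr : r ∈ Ioo 0 ρ := ⟨hr0, (min_le_left _ _).trans_lt (by linarith)⟩
  have := hαβ r hr
  refine ⟨_, h r hr ((α r + β r) / 2) ⟨by linarith, by linarith⟩, ?_⟩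
  rw [dist_eq_norm, sub_add_cancel_left, norm_neg, norm_mul, Complex.norm_exp_ofReal_mul_I,
    mul_one, Complex.norm_real, Real.norm_of_nonneg hr0.le]
  exact (min_le_right _ _).trans_lt (by linarith)

/-- The face `F` lies, at the parameter `p`, to the left (for `τ = 1`) or to the right
(for `τ = -1`) of the curve. -/
def IsSide (p : D.Param) (τ : ℝ) (F : D.Face) : Prop :=
  ∀ᶠ r in 𝓝[>] (0 : ℝ), D.point p + r • (Complex.I * (τ * D.velocity p)) ∈ F.1

theorem IsSide.unique {p : D.Param} {τ : ℝ} {F F' : D.Face} (h : IsSide p τ F)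
    (h' : IsSide p τ F') : F = F' := by
  obtain ⟨r, hr, hr'⟩ := (h.and h').exists
  exact Face.eq_of_mem hr hr'

/-- Close to a differentiable simple point of the curve, the curve does not meet the cones around
the normal directions. -/
theorem exists_ball_cone {p : D.Param} (hp : ¬ D.IsDouble p) {w : ℂ} (hw0 : w ≠ 0)
    (hw : D.velocity p = w ∨ D.velocity p = -w) {κ : ℝ} (hκ : 0 < κ) :
    ∃ ρ > 0, ∀ v : ℂ, ‖v‖ < ρ → κ * (‖w‖ * ‖v‖) < (starRingEnd ℂ w * v).im →
      D.point p + v ∉ D.support := by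
  have hw' : D.velocity p ≠ 0 := by rcases hw with h | h <;> simpa [h]
  have hd : HasDerivAt (fun s => D.point (D.shift p s)) (D.velocity p) 0 := by
    have h1 := D.deriv_point_shift p 0
    rw [shift_zero] at h1
    rw [← h1]
    exact (differentiableAt_of_deriv_ne_zero (by rw [h1]; exact hw')).hasDerivAt
  -- For the remainder e of the linear approximation, ‖e‖ ≤ c(‖v‖ + ‖e‖) will hold. The bound c ≤
  -- 1/2 absorbs ‖e‖ on the right and c ≤ κ/2 then gives ‖e‖ ≤ κ‖v‖, against the cone condition.
  set c := min κ 1 / 2 with hc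
  have hcpos : 0 < c := by positivity
  have hc1 : c ≤ κ / 2 := by have := min_le_left κ 1; linarith
  have hc2 : c ≤ 1 / 2 := by have := min_le_right κ 1; linarith
  have hwn : 0 < ‖w‖ := norm_pos_iff.2 hw0
  have hev := (hasDerivAt_iff_isLittleO.1 hd).def (c := c * ‖w‖) (by positivity)
  obtain ⟨h, hh, hb⟩ := Metric.eventually_nhds_iff.1 hev
  obtain ⟨ρ, hρ, hV⟩ := D.exists_ball_subset_of_mem_nhds (D.point p)
    (V := D.shift p '' Ioo (-h) h) (by
      intro q hq
      have : q = p := by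
        by_contra hne
        exact hp ⟨q, hne, hq⟩
      rw [this]
      exact D.image_shift_mem_nhds p hh)
  refine ⟨ρ, hρ, ?_⟩
  rintro v hv hcone ⟨q, hq⟩
  obtain ⟨s, hs, rfl⟩ := hV q (by rw [hq, dist_eq_norm]; simpa using hv)
  have hs2 := hb (y := s) (by rw [Real.dist_eq, sub_zero, abs_lt]; exact hs)
  simp only [hq, shift_zero, sub_zero, Real.norm_eq_abs] at hs2
  rw [add_sub_cancel_left] at hs2
  set e := v - s • D.velocity p with he
  have hve : v = s • D.velocity p + e := by rw [he]; ring
  -- The velocity is parallel to `w`, so only the remainder contributes to the normal component.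
  have him : (starRingEnd ℂ w * v).im = (starRingEnd ℂ w * e).im := by
    rw [hve, mul_add, Complex.add_im]
    have : (starRingEnd ℂ w * s • D.velocity p).im = 0 := by
      rcases hw with h | h
      · rw [h]; simp; ring
      · rw [h]; simp; ring
    rw [this, zero_add]
  have h1 : (starRingEnd ℂ w * e).im ≤ ‖w‖ * ‖e‖ := by
    refine (Complex.im_le_norm _).trans ?_
    rw [norm_mul, Complex.norm_conj]
  have hnv : ‖D.velocity p‖ = ‖w‖ := by rcases hw with h | h <;> simp [h]
  have h2 : |s| * ‖w‖ ≤ ‖v‖ + ‖e‖ := by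
    have : s • D.velocity p = v - e := by rw [he]; ring
    rw [← hnv, ← Real.norm_eq_abs, ← norm_smul, this]
    exact norm_sub_le _ _
  rw [him] at hcone
  have h3 : κ * ‖v‖ < ‖e‖ := by
    have : ‖w‖ * (κ * ‖v‖) < ‖w‖ * ‖e‖ := by linarith
    exact lt_of_mul_lt_mul_left this hwn.le
  have h4 : ‖e‖ ≤ c * (‖v‖ + ‖e‖) := by
    calc ‖e‖ ≤ c * ‖w‖ * |s| := hs2
      _ = c * (|s| * ‖w‖) := by ring
      _ ≤ _ := by gcongr
  have h5 : c * ‖e‖ ≤ 1 / 2 * ‖e‖ := by gcongr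
  have h6 : c * ‖v‖ ≤ κ / 2 * ‖v‖ := by gcongr
  linarith

/-- The points in the cone around a normal direction of the curve, close to a differentiable simple
point, belong to one face. -/
theorem exists_ball_cone_mem_face {p : D.Param} (hp : ¬ D.IsDouble p) {w : ℂ} (hw0 : w ≠ 0)
    (hw : D.velocity p = w ∨ D.velocity p = -w) {κ : ℝ} (hκ : 0 < κ) :
    ∃ ρ > 0, ∀ F : D.Face, ∀ v v' : ℂ, ‖v‖ < ρ → κ * (‖w‖ * ‖v‖) < (starRingEnd ℂ w * v).im →
      ‖v'‖ < ρ → κ * (‖w‖ * ‖v'‖) < (starRingEnd ℂ w * v').im →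
      D.point p + v ∈ F.1 → D.point p + v' ∈ F.1 := by
  obtain ⟨ρ, hρ, h⟩ := exists_ball_cone hp hw0 hw hκ
  refine ⟨ρ, hρ, fun F v v' hv hcv hv' hcv' hF => ?_⟩
  -- The truncated cone is convex, since it bounds the convex function ‖v‖ by a linear one; this is
  -- the connected set that lies in one face.
  let K : Set ℂ := {v | ‖v‖ < ρ ∧ κ * (‖w‖ * ‖v‖) < (starRingEnd ℂ w * v).im}
  have hK : Convex ℝ K := by
    rintro x ⟨hx1, hx2⟩ y ⟨hy1, hy2⟩ a b ha hb hab
    have hn : ‖a • x + b • y‖ ≤ a * ‖x‖ + b * ‖y‖ := by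
      refine (norm_add_le _ _).trans ?_
      rw [norm_smul, norm_smul, Real.norm_of_nonneg ha, Real.norm_of_nonneg hb]
    have him : (starRingEnd ℂ w * (a • x + b • y)).im =
        a * (starRingEnd ℂ w * x).im + b * (starRingEnd ℂ w * y).im := by
      simp; ring
    constructor
    · refine hn.trans_lt ?_
      rcases ha.eq_or_lt with rfl | ha'
      · have : b = 1 := by linarith
        subst this; simpa using hy1
      · nlinarith
    · rw [him]
      have : κ * (‖w‖ * ‖a • x + b • y‖) ≤ κ * (‖w‖ * (a * ‖x‖ + b * ‖y‖)) := by gcongr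
      refine this.trans_lt ?_
      rcases ha.eq_or_lt with rfl | ha'
      · have : b = 1 := by linarith
        subst this; simpa using hy2
      · nlinarith
  have hpre : IsPreconnected ((fun v => D.point p + v) '' K) :=
    hK.isPreconnected.image _ (by fun_prop)
  obtain ⟨F', hF'⟩ := exists_face_of_isPreconnected (D := D) hpre ⟨_, v, ⟨hv, hcv⟩, rfl⟩ (by
    rintro _ ⟨u, hu, rfl⟩
    exact h u hu.1 hu.2)
  have h1 := hF' ⟨v, ⟨hv, hcv⟩, rfl⟩
  rw [Face.eq_of_mem hF h1]
  exact hF' ⟨v', ⟨hv', hcv'⟩, rfl⟩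

/-- A face that contains the points next to a branch, on one side of it, lies on the corresponding
side of the curve at the parameters on this branch. -/
theorem eventually_isSide {p : D.Param} {σ τ : ℝ} (hσ : σ = 1 ∨ σ = -1) (hτ : τ = 1 ∨ τ = -1)
    {u : ℂ} {h₀ R : ℝ} {θ : ℝ → ℝ} (hP : IsPolar (D.branch p σ) (D.branchDeriv p σ) u h₀ R θ)
    {F : D.Face} {ρ : ℝ} (hρ : 0 < ρ)
    (hF : ∀ r ∈ Ioo 0 ρ, ∀ᶠ ε in 𝓝[>] (0 : ℝ),
      D.point p + r * Complex.exp ((θ r + τ * ε : ℝ) * Complex.I) ∈ F.1) :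
    ∀ᶠ h in 𝓝[>] (0 : ℝ), IsSide (D.shift p (σ * h)) (τ * σ) F := by
  have hβ0 : Tendsto (fun h => ‖D.branch p σ h‖) (𝓝[>] 0) (𝓝 0) := by
    have hc : Continuous fun h => ‖D.branch p σ h‖ := by
      have := D.continuous_point_shift p
      have h2 : Continuous fun h : ℝ => σ * h := by fun_prop
      exact ((this.comp h2).sub continuous_const).norm
    have := (hc.tendsto 0).mono_left (nhdsWithin_le_nhds (s := Ioi 0))
    simpa [branch] using this
  filter_upwards [Ioo_mem_nhdsGT hP.pos, hβ0.eventually (gt_mem_nhds hρ),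
    D.eventually_shift_not_isDouble p hσ] with h hh hhρ hnd
  set b := D.branch p σ h with hb
  -- The sign makes `I * w` the normal that points to the required side of the branch traversed
  -- outwards.
  set w := (τ : ℂ) * D.branchDeriv p σ h with hw
  have hτ2 : τ * τ = 1 := by rcases hτ with rfl | rfl <;> norm_num
  have hσ2 : σ * σ = 1 := by rcases hσ with rfl | rfl <;> norm_num
  have hτσ : τ * σ = 1 ∨ τ * σ = -1 := by
    rcases hτ with rfl | rfl <;> rcases hσ with rfl | rfl <;> norm_num
  have hτ0 : (τ : ℂ) ≠ 0 := by rcases hτ with rfl | rfl <;> norm_num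
  have hw0 : w ≠ 0 := mul_ne_zero hτ0 (hP.ne h hh)
  have hwv : w = ((τ * σ : ℝ) : ℂ) * D.velocity (D.shift p (σ * h)) := by
    rw [hw, branchDeriv]; push_cast; ring
  have hvel : D.velocity (D.shift p (σ * h)) = w ∨ D.velocity (D.shift p (σ * h)) = -w := by
    rcases hτσ with h1 | h1 <;> rw [h1] at hwv
    · left; rw [hwv]; simp
    · right; rw [hwv]; simp
  have hb0 : 0 < ‖b‖ := (hP.mem h hh).1
  have hwn : 0 < ‖w‖ := norm_pos_iff.2 hw0
  set m := (starRingEnd ℂ b * D.branchDeriv p σ h).re with hm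
  have hm0 : 0 < m := hP.radial h hh
  have hmw : (starRingEnd ℂ w * (τ * Complex.I * b)).im = m := by
    have e : starRingEnd ℂ w * (τ * Complex.I * b) =
        (τ * τ : ℝ) * (Complex.I * (starRingEnd ℂ (D.branchDeriv p σ h) * b)) := by
      rw [hw, map_mul, Complex.conj_ofReal]; push_cast; ring
    rw [e, hτ2, hm]
    simp
    ring
  -- The cone must contain two directions: the normal `I * w`, for which κ ≤ 1/2 is enough, and the
  -- direction τ·I·b of rotation around the base point, whose pairing with `w` is `m`, the positive
  -- radial quantity.
  set κ := min (1 / 2) (m / (2 * (‖w‖ * ‖b‖))) with hκ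
  have hκ0 : 0 < κ := by positivity
  have hκ1 : κ ≤ 1 / 2 := min_le_left _ _
  have hκ2 : κ * (‖w‖ * ‖b‖) ≤ m / 2 := by
    have : κ ≤ m / (2 * (‖w‖ * ‖b‖)) := min_le_right _ _
    rw [le_div_iff₀ (by positivity)] at this
    linarith
  obtain ⟨δ, hδ, hcone⟩ := exists_ball_cone_mem_face hnd hw0 hvel hκ0
  -- a point of `F` in the cone
  obtain ⟨v, hv1, hv2, hvF⟩ : ∃ v : ℂ, ‖v‖ < δ ∧ κ * (‖w‖ * ‖v‖) < (starRingEnd ℂ w * v).im ∧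
      D.point (D.shift p (σ * h)) + v ∈ F.1 := by
    -- `V ε` is the displacement of the point of the branch under rotation by τε about the base
    -- point. It starts in the direction τ·I·b, which lies inside the cone.
    let V : ℝ → ℂ := fun ε => b * (Complex.exp ((τ * ε : ℝ) * Complex.I) - 1)
    have hV0 : V 0 = 0 := by simp [V]
    have hdV : HasDerivAt V (τ * Complex.I * b) 0 := by
      have h1 : HasDerivAt (fun ε : ℝ => ((τ * ε : ℝ) : ℂ) * Complex.I) (τ * Complex.I) 0 := by
        have : HasDerivAt (fun ε : ℝ => τ * ε) τ 0 := by
          simpa using (hasDerivAt_id (0 : ℝ)).const_mul τ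
        exact this.ofReal_comp.mul_const _
      have h2 := (h1.cexp.sub_const 1).const_mul b
      refine h2.congr_deriv ?_
      rw [mul_zero, Complex.ofReal_zero, zero_mul, Complex.exp_zero, one_mul, mul_comm]
    have hlim : Tendsto (fun ε : ℝ => ε⁻¹ • V ε) (𝓝[>] 0) (𝓝 (τ * Complex.I * b)) := by
      have := (hasDerivAt_iff_tendsto_slope.1 hdV).mono_left
        (nhdsWithin_mono 0 (fun x hx => (mem_Ioi.1 hx).ne' : Ioi (0 : ℝ) ⊆ {0}ᶜ))
      refine this.congr fun ε => ?_
      simp [slope, hV0]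
    have hcont : Continuous fun v : ℂ => (starRingEnd ℂ w * v).im - κ * (‖w‖ * ‖v‖) := by
      have := Complex.continuous_conj
      fun_prop
    have hpos : 0 < (starRingEnd ℂ w * (τ * Complex.I * b)).im -
        κ * (‖w‖ * ‖(τ * Complex.I * b)‖) := by
      have : ‖(τ * Complex.I * b)‖ = ‖b‖ := by
        rcases hτ with rfl | rfl <;> simp
      rw [hmw, this]
      linarith
    have e1 := ((hcont.tendsto _).comp hlim).eventually (lt_mem_nhds hpos)
    have e2 : ∀ᶠ ε in 𝓝[>] (0 : ℝ), ‖V ε‖ < δ := by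
      have := (hdV.continuousAt.norm).tendsto.mono_left (nhdsWithin_le_nhds (s := Ioi 0))
      rw [hV0, norm_zero] at this
      exact this.eventually (gt_mem_nhds hδ)
    have e3 := hF ‖b‖ ⟨hb0, hhρ⟩
    obtain ⟨ε, ⟨⟨he1, he2⟩, he3⟩, hε⟩ :=
      (((e1.and e2).and e3).and self_mem_nhdsWithin).exists
    refine ⟨V ε, he2, ?_, ?_⟩
    · simp only [Function.comp_apply] at he1
      have hi : 0 < ε⁻¹ := inv_pos.2 hε
      rw [norm_smul, Real.norm_of_nonneg hi.le] at he1
      have : (starRingEnd ℂ w * ε⁻¹ • V ε).im = ε⁻¹ * (starRingEnd ℂ w * V ε).im := by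
        rw [mul_smul_comm, Complex.smul_im, smul_eq_mul]
      rw [this] at he1
      have : 0 < ε⁻¹ * ((starRingEnd ℂ w * V ε).im - κ * (‖w‖ * ‖V ε‖)) := by linarith
      have := (mul_pos_iff_of_pos_left hi).1 this
      linarith
    · convert he3 using 1
      rw [point_shift, ← hb]
      have hbe := hP.eq h hh
      rw [← hb] at hbe
      have : Complex.exp ((θ ‖b‖ + τ * ε : ℝ) * Complex.I) =
          Complex.exp (θ ‖b‖ * Complex.I) * Complex.exp ((τ * ε : ℝ) * Complex.I) := by
        rw [← Complex.exp_add]; push_cast; ring_nf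
      rw [this, ← mul_assoc, ← hbe]
      simp only [V]
      ring
  have hsmall : ∀ᶠ r in 𝓝[>] (0 : ℝ), r * ‖w‖ < δ := by
    have hc : Continuous fun r : ℝ => r * ‖w‖ := by fun_prop
    have := (hc.tendsto 0).mono_left (nhdsWithin_le_nhds (s := Ioi 0))
    rw [zero_mul] at this
    exact this.eventually (gt_mem_nhds hδ)
  rw [IsSide]
  filter_upwards [hsmall, self_mem_nhdsWithin] with r hr hr0
  rw [mem_Ioi] at hr0
  rw [← hwv]
  have hn : ‖r • (Complex.I * w)‖ = r * ‖w‖ := by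
    rw [norm_smul, norm_mul, Complex.norm_I, one_mul, Real.norm_of_nonneg hr0.le]
  refine hcone F v _ hv1 hv2 (by rw [hn]; exact hr) ?_ hvF
  have : (starRingEnd ℂ w * r • (Complex.I * w)).im = r * (‖w‖ * ‖w‖) := by
    have e : starRingEnd ℂ w * r • (Complex.I * w) =
        (r * Complex.normSq w : ℝ) * Complex.I := by
      rw [Complex.real_smul]; push_cast; rw [Complex.normSq_eq_conj_mul_self]; ring
    rw [e, Complex.im_ofReal_mul, Complex.I_im, Complex.normSq_eq_norm_sq]; ring
  rw [hn, this]
  have : 0 < r * (‖w‖ * ‖w‖) := by positivity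
  nlinarith

end LinkDiagram

/-! ### Angles modulo 2π and the corners at a simple point -/

theorem exists_eq_add_of_exp_eq {φ ψ : ℝ}
    (h : Complex.exp (φ * Complex.I) = Complex.exp (ψ * Complex.I)) :
    ∃ n : ℤ, φ = ψ + 2 * Real.pi * n := by
  obtain ⟨n, hn⟩ := Complex.exp_eq_exp_iff_exists_int.1 h
  refine ⟨n, ?_⟩
  have : (φ : ℂ) * Complex.I = ((ψ + 2 * Real.pi * n : ℝ) : ℂ) * Complex.I := by
    rw [hn]; push_cast; ring
  exact_mod_cast mul_right_cancel₀ Complex.I_ne_zero this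

theorem exp_add_two_pi_mul_int (φ : ℝ) (n : ℤ) :
    Complex.exp (((φ + 2 * Real.pi * n : ℝ) : ℂ) * Complex.I) = Complex.exp (φ * Complex.I) := by
  rw [Complex.exp_eq_exp_iff_exists_int]
  exact ⟨n, by push_cast; ring⟩

/-- Angle functions come normalized by the principal argument. To list branches in cyclic order,
each is shifted by a multiple of 2π to a prescribed limit. -/
theorem Tendsto.exists_add_two_pi {θ : ℝ → ℝ} {u : ℂ} (hu : u ≠ 0)
    (h : Tendsto θ (𝓝[>] 0) (𝓝 u.arg)) {φ : ℝ} (hφ : u = ‖u‖ * Complex.exp (φ * Complex.I)) :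
    ∃ n : ℤ, Tendsto (fun r => θ r + 2 * Real.pi * n) (𝓝[>] 0) (𝓝 φ) := by
  have hu' : (‖u‖ : ℂ) ≠ 0 := by exact_mod_cast (norm_pos_iff.2 hu).ne'
  have h1 := Complex.norm_mul_exp_arg_mul_I u
  nth_rewrite 3 [hφ] at h1
  obtain ⟨n, hn⟩ := exists_eq_add_of_exp_eq (mul_left_cancel₀ hu' h1)
  refine ⟨-n, ?_⟩
  have := h.add_const (2 * Real.pi * ((-n : ℤ) : ℝ))
  have e : u.arg + 2 * Real.pi * ((-n : ℤ) : ℝ) = φ := by rw [hn]; push_cast; ring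
  rwa [e] at this

/-- A continuous function on an interval that avoids the multiples of `2π` stays between two
consecutive multiples. -/
theorem exists_int_of_forall_ne {f : ℝ → ℝ} {ρ : ℝ} (hρ : 0 < ρ) (hf : ContinuousOn f (Ioo 0 ρ))
    (hne : ∀ r ∈ Ioo 0 ρ, ∀ n : ℤ, f r ≠ 2 * Real.pi * n) :
    ∃ k : ℤ, ∀ r ∈ Ioo 0 ρ, 2 * Real.pi * k < f r ∧ f r < 2 * Real.pi * k + 2 * Real.pi := by
  have hπ := Real.pi_pos
  have hmid : ρ / 2 ∈ Ioo 0 ρ := ⟨by linarith, by linarith⟩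
  set k := ⌊f (ρ / 2) / (2 * Real.pi)⌋ with hk
  have h1 : 2 * Real.pi * k ≤ f (ρ / 2) := by
    have := Int.floor_le (f (ρ / 2) / (2 * Real.pi))
    rw [← hk, le_div_iff₀ (by positivity)] at this
    linarith
  have h2 : f (ρ / 2) < 2 * Real.pi * k + 2 * Real.pi := by
    have := Int.lt_floor_add_one (f (ρ / 2) / (2 * Real.pi))
    rw [← hk, div_lt_iff₀ (by positivity)] at this
    linarith
  have hoc : OrdConnected (f '' Ioo 0 ρ) := (isPreconnected_Ioo.image f hf).ordConnected
  refine ⟨k, fun r hr => ⟨?_, ?_⟩⟩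
  · by_contra hn
    obtain ⟨r', hr', he⟩ := hoc.out (mem_image_of_mem f hr) (mem_image_of_mem f hmid)
      (⟨not_lt.1 hn, h1⟩ : 2 * Real.pi * (k : ℝ) ∈ Icc _ _)
    exact hne r' hr' k he
  · by_contra hn
    obtain ⟨r', hr', he⟩ := hoc.out (mem_image_of_mem f hmid) (mem_image_of_mem f hr)
      (⟨h2.le, not_lt.1 hn⟩ : 2 * Real.pi * (k : ℝ) + 2 * Real.pi ∈ Icc _ _)
    refine hne r' hr' (k + 1) ?_
    rw [he]; push_cast; ring

namespace LinkDiagram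

variable {D : LinkDiagram}

variable (D) in
theorem nonempty_face : Nonempty D.Face := by
  obtain ⟨r, hr⟩ := D.isCompact_support.isBounded.subset_closedBall 0
  obtain ⟨F, -⟩ := exists_face_mem (D := D) (x := (r + 1 : ℝ)) (by
    intro h
    have := hr h
    rw [mem_closedBall_zero_iff, Complex.norm_real, Real.norm_eq_abs] at this
    have := (le_abs_self _).trans this
    linarith)
  exact ⟨F⟩

/-- If, close to the point `x`, the curves form `m` branches that are the graphs of angle
functions, then there are exactly `m` corners at `x`. -/
theorem exists_faces_of_fan {x : ℂ} (hx : x ∈ D.support) {m : ℕ} {ρ : ℝ} (hρ : 0 < ρ)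
    {ψ : ℕ → ℝ → ℝ} (hc : ∀ j, ContinuousOn (ψ j) (Ioo 0 ρ))
    (hlt : ∀ j < m, ∀ r ∈ Ioo 0 ρ, ψ j r < ψ (j + 1) r)
    (htop : ∀ r ∈ Ioo 0 ρ, ψ m r = ψ 0 r + 2 * Real.pi)
    (hsupp : ∀ r ∈ Ioo 0 ρ, ∀ φ : ℝ, x + r * Complex.exp (φ * Complex.I) ∈ D.support →
      ∃ j < m, ∃ n : ℤ, φ = ψ j r + 2 * Real.pi * n)
    (hmem : ∀ j < m, ∀ r ∈ Ioo 0 ρ, x + r * Complex.exp (ψ j r * Complex.I) ∈ D.support) :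
    ∃ F : ℕ → D.Face, (∀ j < m, ContainsSector (F j) x ρ (ψ j) (ψ (j + 1))) ∧
      ∀ G : D.Face, x ∈ closure G.1 ↔ ∃ j < m, G = F j := by
  have hmono : ∀ r ∈ Ioo 0 ρ, ∀ j k, j ≤ k → k ≤ m → ψ j r ≤ ψ k r := by
    intro r hr j k hjk
    induction k, hjk using Nat.le_induction with
    | base => intro _; exact le_rfl
    | succ k hk ih => intro hm; exact (ih (by omega)).trans (hlt k (by omega) r hr).le
  have hsec : ∀ j < m, ∃ F : D.Face, ContainsSector F x ρ (ψ j) (ψ (j + 1)) := by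
    intro j hj
    refine exists_containsSector hρ (hc j) (hc (j + 1)) (hlt j hj) ?_
    intro r hr φ hφ hs
    obtain ⟨k, hk, n, hn⟩ := hsupp r hr φ hs
    have a1 := hmono r hr 0 j (by omega) hj.le
    have a2 := hmono r hr (j + 1) m (by omega) le_rfl
    have a3 := hmono r hr 0 k (by omega) hk.le
    have a4 := hmono r hr (k + 1) m (by omega) le_rfl
    have a5 := hlt k hk r hr
    rw [htop r hr] at a2 a4
    have hπ := Real.pi_pos
    -- The whole fan spans exactly 2π, so an angle inside it can be congruent to another one of the
    -- fan only without a full turn.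
    have n1 : n < 1 := by
      have : (n : ℝ) < 1 := by
        by_contra hcon
        have : 2 * Real.pi * 1 ≤ 2 * Real.pi * n := by
          apply mul_le_mul_of_nonneg_left (not_lt.1 hcon) (by positivity)
        linarith [hφ.1, hφ.2]
      exact_mod_cast this
    have n2 : -1 < n := by
      have : (-1 : ℝ) < n := by
        by_contra hcon
        have : 2 * Real.pi * n ≤ 2 * Real.pi * (-1) := by
          apply mul_le_mul_of_nonneg_left (not_lt.1 hcon) (by positivity)
        linarith [hφ.1, hφ.2]
      exact_mod_cast this
    have n0 : n = 0 := by omega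
    rw [n0, Int.cast_zero, mul_zero, add_zero] at hn
    rcases Nat.lt_or_ge j k with h | h
    · have := hmono r hr (j + 1) k h hk.le
      linarith [hφ.2]
    · have := hmono r hr k j h hj.le
      linarith [hφ.1]
  obtain ⟨F₀⟩ := nonempty_face D
  have hsec' : ∀ j, ∃ F : D.Face, j < m → ContainsSector F x ρ (ψ j) (ψ (j + 1)) := by
    intro j
    by_cases hj : j < m
    · obtain ⟨F, hF⟩ := hsec j hj
      exact ⟨F, fun _ => hF⟩
    · exact ⟨F₀, fun h => absurd h hj⟩
  choose F hF using hsec'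
  refine ⟨F, hF, fun G => ⟨fun hG => ?_, ?_⟩⟩
  · obtain ⟨z, hzG, hz⟩ := Metric.mem_closure_iff.1 hG ρ hρ
    have hzx : z ≠ x := by rintro rfl; exact G.subset hzG hx
    set r := ‖z - x‖ with hr
    have hrρ : r ∈ Ioo 0 ρ := ⟨norm_pos_iff.2 (sub_ne_zero.2 hzx), by
      rw [dist_comm, dist_eq_norm] at hz; exact hz⟩
    have hπ : 0 < 2 * Real.pi := by have := Real.pi_pos; positivity
    -- The argument is normalized to the turn that starts at the lowest branch; it then falls
    -- between two consecutive branches.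
    obtain ⟨φ, hφ⟩ : ∃ φ, φ = toIcoMod hπ (ψ 0 r) (z - x).arg := ⟨_, rfl⟩
    have hφm : φ ∈ Ico (ψ 0 r) (ψ 0 r + 2 * Real.pi) := hφ ▸ toIcoMod_mem_Ico hπ _ _
    have hzφ : z = x + r * Complex.exp (φ * Complex.I) := by
      have e : φ = (z - x).arg + 2 * Real.pi * ((-(toIcoDiv hπ (ψ 0 r) (z - x).arg) : ℤ) : ℝ) := by
        rw [hφ, toIcoMod, zsmul_eq_mul]; push_cast; ring
      rw [e, exp_add_two_pi_mul_int, hr, Complex.norm_mul_exp_arg_mul_I]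
      ring
    have hfind : ∀ k, φ < ψ k r → ∃ j < k, ψ j r ≤ φ ∧ φ < ψ (j + 1) r := by
      intro k
      induction k with
      | zero => intro h; exact absurd h (not_lt.2 hφm.1)
      | succ k ih =>
        intro h
        by_cases hk : φ < ψ k r
        · obtain ⟨j, hj, h'⟩ := ih hk
          exact ⟨j, by omega, h'⟩
        · exact ⟨k, by omega, not_lt.1 hk, h⟩
    obtain ⟨j, hj, h1, h2⟩ := hfind m (by rw [htop r hrρ]; exact hφm.2)
    refine ⟨j, hj, ?_⟩
    have hne : ψ j r ≠ φ := by
      intro h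
      apply G.subset hzG
      rw [hzφ, ← h]
      exact hmem j hj r hrρ
    refine Face.eq_of_mem hzG ?_
    rw [hzφ]
    exact hF j hj r hrρ φ ⟨lt_of_le_of_ne h1 hne, h2⟩
  · rintro ⟨j, hj, rfl⟩
    exact (hF j hj).mem_closure hρ (hlt j hj)

/-- The points next to the lower bound of a sector belong to the sector. -/
theorem ContainsSector.eventually_lower {F : D.Face} {x : ℂ} {ρ : ℝ} {α β θ : ℝ → ℝ}
    (h : ContainsSector F x ρ α β) (hαβ : ∀ r ∈ Ioo 0 ρ, α r < β r) (n : ℤ)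
    (hθ : ∀ r, α r = θ r + 2 * Real.pi * n) {r : ℝ} (hr : r ∈ Ioo 0 ρ) :
    ∀ᶠ ε in 𝓝[>] (0 : ℝ), x + r * Complex.exp ((θ r + 1 * ε : ℝ) * Complex.I) ∈ F.1 := by
  filter_upwards [Ioo_mem_nhdsGT (sub_pos.2 (hαβ r hr))] with ε hε
  rw [← exp_add_two_pi_mul_int _ n]
  have := hθ r
  exact h r hr _ ⟨by linarith [hε.1], by linarith [hε.2]⟩

/-- The points next to the upper bound of a sector belong to the sector. -/
theorem ContainsSector.eventually_upper {F : D.Face} {x : ℂ} {ρ : ℝ} {α β θ : ℝ → ℝ}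
    (h : ContainsSector F x ρ α β) (hαβ : ∀ r ∈ Ioo 0 ρ, α r < β r) (n : ℤ)
    (hθ : ∀ r, β r = θ r + 2 * Real.pi * n) {r : ℝ} (hr : r ∈ Ioo 0 ρ) :
    ∀ᶠ ε in 𝓝[>] (0 : ℝ), x + r * Complex.exp ((θ r + -1 * ε : ℝ) * Complex.I) ∈ F.1 := by
  filter_upwards [Ioo_mem_nhdsGT (sub_pos.2 (hαβ r hr))] with ε hε
  rw [← exp_add_two_pi_mul_int _ n]
  have := hθ r
  exact h r hr _ ⟨by linarith [hε.2], by linarith [hε.1]⟩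

variable (D) in
/-- The points of the curves near `x` lie on the branches at `x`. -/
theorem exists_ball_branch (x : ℂ) {h : D.Param → ℝ} (hh : ∀ p, D.point p = x → 0 < h p) :
    ∃ ρ > 0, ∀ z ∈ D.support, z ≠ x → ‖z - x‖ < ρ → ∃ p, D.point p = x ∧
      ∃ σ : ℝ, (σ = 1 ∨ σ = -1) ∧ ∃ s ∈ Ioo 0 (h p), z = x + D.branch p σ s := by
  obtain ⟨ρ, hρ, hV⟩ := D.exists_ball_subset_of_mem_nhds x
    (V := ⋃ p ∈ {p | D.point p = x}, D.shift p '' Ioo (-h p) (h p)) (fun p hp =>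
      mem_of_superset (D.image_shift_mem_nhds p (hh p hp)) (subset_biUnion_of_mem
        (u := fun p => D.shift p '' Ioo (-h p) (h p)) hp))
  refine ⟨ρ, hρ, ?_⟩
  rintro z ⟨q, rfl⟩ hne hz
  have := hV q (by rwa [dist_eq_norm])
  simp only [mem_iUnion] at this
  obtain ⟨p, hp, s, hs, rfl⟩ := this
  refine ⟨p, hp, ?_⟩
  have hp' : D.point p = x := hp
  rcases lt_trichotomy s 0 with h0 | h0 | h0
  · refine ⟨-1, Or.inr rfl, -s, ⟨by linarith, by linarith [hs.1]⟩, ?_⟩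
    simp [branch, hp']
  · exact absurd (by rw [h0, shift_zero, hp']) hne
  · refine ⟨1, Or.inl rfl, s, ⟨h0, hs.2⟩, ?_⟩
    simp [branch, hp']

/-- The radius of a point of a branch determines the point. -/
theorem _root_.IsPolar.eq_of_norm {β β' : ℝ → ℂ} {u : ℂ} {h₀ R : ℝ} {θ : ℝ → ℝ}
    (hP : IsPolar β β' u h₀ R θ) {r : ℝ} (hr : r ∈ Ioo 0 R) :
    ∃ h ∈ Ioo 0 h₀, β h = r * Complex.exp (θ r * Complex.I) := by
  obtain ⟨h, hh, rfl⟩ := hP.surj r hr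
  exact ⟨h, hh, hP.eq h hh⟩

theorem mem_support_of_isPolar {p : D.Param} {σ : ℝ} {u : ℂ} {h₀ R : ℝ} {θ : ℝ → ℝ}
    (hP : IsPolar (D.branch p σ) (D.branchDeriv p σ) u h₀ R θ) {r : ℝ} (hr : r ∈ Ioo 0 R) (n : ℤ) :
    D.point p + r * Complex.exp ((θ r + 2 * Real.pi * n : ℝ) * Complex.I) ∈ D.support := by
  obtain ⟨h, hh, he⟩ := hP.eq_of_norm hr
  rw [exp_add_two_pi_mul_int, ← he, ← point_shift]
  exact mem_range_self _

theorem exists_angle_eq_of_isPolar {p : D.Param} {σ : ℝ} {u : ℂ} {h₀ R : ℝ} {θ : ℝ → ℝ}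
    (hP : IsPolar (D.branch p σ) (D.branchDeriv p σ) u h₀ R θ) {x : ℂ} {r : ℝ} (hr : 0 < r) {φ h : ℝ}
    (hh : h ∈ Ioo 0 h₀) (he : x + r * Complex.exp (φ * Complex.I) = x + D.branch p σ h) (m : ℤ) :
    ∃ n : ℤ, φ = θ r + 2 * Real.pi * m + 2 * Real.pi * n := by
  have he' := add_left_cancel he
  have hn : ‖D.branch p σ h‖ = r := by
    rw [← he', norm_mul, Complex.norm_exp_ofReal_mul_I, mul_one, Complex.norm_real,
      Real.norm_of_nonneg hr.le]
  have h2 := hP.eq h hh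
  rw [← he', norm_mul, Complex.norm_exp_ofReal_mul_I, mul_one, Complex.norm_real,
      Real.norm_of_nonneg hr.le] at h2
  have hr' : (r : ℂ) ≠ 0 := by exact_mod_cast hr.ne'
  obtain ⟨n, hn⟩ := exists_eq_add_of_exp_eq (mul_left_cancel₀ hr' h2)
  exact ⟨n - m, by rw [hn]; push_cast; ring⟩

/-- At a simple point of the curves there are two corners, one on either side. -/
theorem exists_faces_of_not_isDouble {p : D.Param} (hp : ¬ D.IsDouble p) :
    ∃ L R : D.Face, (∀ σ : ℝ, σ = 1 ∨ σ = -1 → ∀ᶠ h in 𝓝[>] (0 : ℝ),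
      IsSide (D.shift p (σ * h)) 1 L ∧ IsSide (D.shift p (σ * h)) (-1) R) ∧
      ∀ G : D.Face, D.point p ∈ closure G.1 ↔ G = L ∨ G = R := by
  have s1 : (1 : ℝ) = 1 ∨ (1 : ℝ) = -1 := Or.inl rfl
  have s2 : (-1 : ℝ) = 1 ∨ (-1 : ℝ) = -1 := Or.inr rfl
  obtain ⟨δ, hδ, hδs⟩ := mem_nhdsGT_iff_exists_Ioo_subset.1
    ((D.eventually_shift_not_isDouble p s1).and (D.eventually_shift_not_isDouble p s2))
  rw [mem_Ioi] at hδ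
  -- With the bound 1/2, parameters on the two branches differ by less than a full turn of the
  -- circle and so are distinct; `δ` keeps them simple.
  have hδ' : 0 < min δ (1 / 2) := by positivity
  obtain ⟨u₁, hb₁, -⟩ := D.exists_isBranch p s1
  obtain ⟨u₂, hb₂, -⟩ := D.exists_isBranch p s2
  obtain ⟨h₁, hh₁, R₁, θ₁, P₁⟩ := hb₁.exists_isPolar hδ'
  obtain ⟨h₂, hh₂, R₂, θ₂, P₂⟩ := hb₂.exists_isPolar hδ'
  have huniq : ∀ q, D.point q = D.point p → q = p := by
    intro q hq
    by_contra hne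
    exact hp ⟨q, hne, hq⟩
  obtain ⟨ρ₀, hρ₀, hball⟩ := D.exists_ball_branch (D.point p) (h := fun _ => min h₁ h₂)
    (fun _ _ => lt_min P₁.pos P₂.pos)
  have hR₁ := P₁.R_pos
  have hR₂ := P₂.R_pos
  set ρ := min ρ₀ (min R₁ R₂) with hρdef
  have hρ : 0 < ρ := by positivity
  have sub1 : Ioo 0 ρ ⊆ Ioo 0 R₁ :=
    Ioo_subset_Ioo_right ((min_le_right _ _).trans (min_le_left _ _))
  have sub2 : Ioo 0 ρ ⊆ Ioo 0 R₂ :=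
    Ioo_subset_Ioo_right ((min_le_right _ _).trans (min_le_right _ _))
  have hne : ∀ r ∈ Ioo 0 ρ, ∀ n : ℤ, θ₂ r - θ₁ r ≠ 2 * Real.pi * n := by
    intro r hr n hn
    obtain ⟨a, ha, hae⟩ := P₁.eq_of_norm (sub1 hr)
    obtain ⟨b, hb, hbe⟩ := P₂.eq_of_norm (sub2 hr)
    have e : θ₂ r = θ₁ r + 2 * Real.pi * n := by linarith
    rw [e, exp_add_two_pi_mul_int, ← hae] at hbe
    have hpt : D.point (D.shift p (-1 * b)) = D.point (D.shift p (1 * a)) := by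
      rw [point_shift, point_shift, hbe]
    have ha' : a < min δ (1 / 2) := ha.2.trans hh₁
    have hb' : b < min δ (1 / 2) := hb.2.trans hh₂
    rw [lt_min_iff] at ha' hb'
    have := (hδs ⟨ha.1, ha'.1⟩).1
    refine this ⟨_, ?_, hpt⟩
    intro heq
    have := D.shift_injOn p (by rw [abs_lt]; constructor <;> linarith [ha.1, hb.1]) heq
    linarith [ha.1, hb.1]
  -- At a cusp both branches have the same tangent direction, so the limits of the angles do not
  -- order them. Their disjointness does.
  obtain ⟨k, hk⟩ := exists_int_of_forall_ne hρ
    ((P₂.continuousOn.mono sub2).sub (P₁.continuousOn.mono sub1)) hne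
  -- The fan goes from the outgoing branch to the incoming one and on to the outgoing one a full
  -- turn later. Its first sector is on the left of the curve, its second one on the right.
  let ψ : ℕ → ℝ → ℝ := fun j r => if j = 0 then θ₁ r + 2 * Real.pi * ((0 : ℤ) : ℝ) else
    if j = 1 then θ₂ r + 2 * Real.pi * ((-k : ℤ) : ℝ) else θ₁ r + 2 * Real.pi * ((1 : ℤ) : ℝ)
  have ψ0 : ∀ r, ψ 0 r = θ₁ r + 2 * Real.pi * ((0 : ℤ) : ℝ) := fun r => rfl
  have ψ1 : ∀ r, ψ 1 r = θ₂ r + 2 * Real.pi * ((-k : ℤ) : ℝ) := fun r => rfl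
  have ψ2 : ∀ r, ψ 2 r = θ₁ r + 2 * Real.pi * ((1 : ℤ) : ℝ) := fun r => rfl
  have hlt : ∀ j < 2, ∀ r ∈ Ioo 0 ρ, ψ j r < ψ (j + 1) r := by
    intro j hj r hr
    have := hk r hr
    simp only [Pi.sub_apply] at this
    interval_cases j
    · rw [ψ0, ψ1]; push_cast; linarith [this.1]
    · rw [ψ1, ψ2]; push_cast; linarith [this.2]
  obtain ⟨F, hF, hcl⟩ := exists_faces_of_fan (D := D) (x := D.point p) (mem_range_self p) (m := 2) hρ
    (ψ := ψ) (fun j => by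
      simp only [ψ]
      split_ifs
      · exact (P₁.continuousOn.mono sub1).add continuousOn_const
      · exact (P₂.continuousOn.mono sub2).add continuousOn_const
      · exact (P₁.continuousOn.mono sub1).add continuousOn_const) hlt
    (fun r hr => by rw [ψ0, ψ2]; push_cast; ring)
    (fun r hr φ hφ => by
      have hnorm : ‖D.point p + r * Complex.exp (φ * Complex.I) - D.point p‖ = r := by
        rw [add_sub_cancel_left, norm_mul, Complex.norm_exp_ofReal_mul_I, mul_one, Complex.norm_real,
          Real.norm_of_nonneg hr.1.le]
      obtain ⟨q, hq, σ, hσ, s, hs, he⟩ := hball _ hφ (by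
        intro h0
        rw [h0, sub_self, norm_zero] at hnorm
        exact hr.1.ne hnorm) (by rw [hnorm]; exact hr.2.trans_le (min_le_left _ _))
      obtain rfl := huniq q hq
      rcases hσ with rfl | rfl
      · obtain ⟨n, hn⟩ := exists_angle_eq_of_isPolar P₁ hr.1
          ⟨hs.1, hs.2.trans_le (min_le_left _ _)⟩ he 0
        exact ⟨0, by norm_num, n, by rw [ψ0]; exact hn⟩
      · obtain ⟨n, hn⟩ := exists_angle_eq_of_isPolar P₂ hr.1
          ⟨hs.1, hs.2.trans_le (min_le_right _ _)⟩ he (-k)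
        exact ⟨1, by norm_num, n, by rw [ψ1]; exact hn⟩)
    (fun j hj r hr => by
      interval_cases j
      · rw [ψ0]; exact mem_support_of_isPolar P₁ (sub1 hr) 0
      · rw [ψ1]; exact mem_support_of_isPolar P₂ (sub2 hr) (-k))
  have hF0 := hF 0 (by norm_num)
  have hF1 := hF 1 (by norm_num)
  have l0 := hlt 0 (by norm_num)
  have l1 := hlt 1 (by norm_num)
  refine ⟨F 0, F 1, ?_, ?_⟩
  · rintro σ (rfl | rfl)
    · have a := eventually_isSide s1 s1 P₁ hρ fun r hr => hF0.eventually_lower l0 0 ψ0 hr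
      have b := eventually_isSide s1 s2 P₁ hρ fun r hr => hF1.eventually_upper l1 1 ψ2 hr
      simp only [mul_one] at a b
      exact a.and b
    · have a := eventually_isSide s2 s2 P₂ hρ fun r hr => hF0.eventually_upper l0 (-k) ψ1 hr
      have b := eventually_isSide s2 s1 P₂ hρ fun r hr => hF1.eventually_lower l1 (-k) ψ1 hr
      simp only [mul_neg, mul_one, neg_neg] at a b
      exact a.and b
  · intro G
    rw [hcl]
    constructor
    · rintro ⟨j, hj, rfl⟩
      interval_cases j
      · exact Or.inl rfl
      · exact Or.inr rfl
    · rintro (rfl | rfl)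
      · exact ⟨0, by norm_num, rfl⟩
      · exact ⟨1, by norm_num, rfl⟩

end LinkDiagram

/-! ### The four corners at a crossing -/

/-- The quotient z/(z − 1) = 1 + 1/(z − 1) has negative imaginary part, so its argument is negative,
and adding it to that of z − 1 stays in the principal range. This locates the diagonal that defines
the Goeritz index. -/
theorem Complex.arg_lt_arg_sub_one {z : ℂ} (hz : 0 < z.im) : z.arg < (z - 1).arg := by
  have hz1 : 0 < (z - 1).im := by simpa using hz
  have h0 : z - 1 ≠ 0 := by intro h; rw [h] at hz1; simp at hz1
  have hz0 : z ≠ 0 := by rintro rfl; simp at hz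
  have him : (z / (z - 1)).im < 0 := by
    have e : z / (z - 1) = 1 + (z - 1)⁻¹ := by field_simp; ring
    rw [e, Complex.add_im, Complex.one_im, zero_add, Complex.inv_im]
    exact div_neg_of_neg_of_pos (neg_lt_zero.2 hz1) (Complex.normSq_pos.2 h0)
  have a1 : 0 ≤ (z - 1).arg := Complex.arg_nonneg_iff.2 hz1.le
  have a2 : (z / (z - 1)).arg < 0 := Complex.arg_neg_iff.2 him
  have a3 := Complex.neg_pi_lt_arg (z / (z - 1))
  have a4 := Complex.arg_le_pi (z - 1)
  have := Complex.arg_mul (x := z - 1) (y := z / (z - 1)) h0 (div_ne_zero hz0 h0)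
    ⟨by linarith, by linarith⟩
  rw [mul_div_cancel₀ _ h0] at this
  linarith

/-- If the cross product vanished, |a|²·b = Re(āb)·a would be a linear relation, forcing a = 0. -/
theorem im_conj_mul_ne_zero {a b : ℂ} (h : LinearIndependent ℝ ![a, b]) :
    (starRingEnd ℂ a * b).im ≠ 0 := by
  rw [LinearIndependent.pair_iff] at h
  intro h0
  have e : (-(starRingEnd ℂ a * b).re) • a + Complex.normSq a • b = 0 := by
    have : starRingEnd ℂ a * b = ((starRingEnd ℂ a * b).re : ℂ) := by
      apply Complex.ext <;> simp [h0]
    rw [Complex.real_smul, Complex.real_smul, Complex.ofReal_neg, ← this,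
      Complex.normSq_eq_conj_mul_self]
    ring
  have := (h _ _ e).2
  rw [Complex.normSq_eq_zero] at this
  have := (h 1 0 (by simp [this])).1
  norm_num at this

namespace LinkDiagram

variable {D : LinkDiagram}

/-- A sector contains the points in any direction strictly between the limiting directions of its
bounds. -/
theorem ContainsSector.eventually_mem {F : D.Face} {x : ℂ} {ρ : ℝ} (hρ : 0 < ρ) {α β : ℝ → ℝ}
    (h : ContainsSector F x ρ α β) {A B φ : ℝ} (hα : Tendsto α (𝓝[>] 0) (𝓝 A))
    (hβ : Tendsto β (𝓝[>] 0) (𝓝 B)) (hA : A < φ) (hB : φ < B) {w : ℂ} (hw : w ≠ 0)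
    (he : w = ‖w‖ * Complex.exp (φ * Complex.I)) :
    ∀ᶠ r in 𝓝[>] (0 : ℝ), x + r • w ∈ F.1 := by
  have hwn : 0 < ‖w‖ := norm_pos_iff.2 hw
  have h1 : ∀ᶠ r : ℝ in 𝓝[>] (0 : ℝ), x + r * Complex.exp (φ * Complex.I) ∈ F.1 := by
    filter_upwards [hα.eventually (gt_mem_nhds hA), hβ.eventually (lt_mem_nhds hB),
      Ioo_mem_nhdsGT hρ] with r h1 h2 h3
    exact h r h3 φ ⟨h1, h2⟩
  have ht : Tendsto (fun r : ℝ => r * ‖w‖) (𝓝[>] 0) (𝓝[>] 0) := by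
    refine tendsto_nhdsWithin_iff.2 ⟨?_, ?_⟩
    · have hc : Continuous fun r : ℝ => r * ‖w‖ := by fun_prop
      simpa using (hc.tendsto 0).mono_left (nhdsWithin_le_nhds (s := Ioi 0))
    · filter_upwards [self_mem_nhdsWithin] with r hr using mul_pos hr hwn
  filter_upwards [ht.eventually h1] with r hr
  rw [he, Complex.real_smul, ← mul_assoc]
  rw [Complex.ofReal_mul] at hr
  exact hr

/-- At a double point there are four corners, separated by the four branches. -/
theorem exists_faces_of_crossing {p q : D.Param} (hpq : p ≠ q) (hpt : D.point q = D.point p) :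
    ∃ (C : Fin 4 → D.Face) (e : ℂ) (s : ℝ), e ≠ 0 ∧ (s = 1 ∨ s = -1) ∧
      (∀ G : D.Face, D.point p ∈ closure G.1 ↔ ∃ k, C k = G) ∧
      (∀ k : Fin 4, ∀ᶠ r in 𝓝[>] (0 : ℝ), D.point p + r • (Complex.I ^ (k : ℕ) * e) ∈ (C k).1) ∧
      (∀ᶠ h in 𝓝[>] (0 : ℝ), IsSide (D.shift p (1 * h)) 1 (C 0) ∧
        IsSide (D.shift p (1 * h)) (-1) (C 3)) ∧
      (∀ᶠ h in 𝓝[>] (0 : ℝ), IsSide (D.shift p (-1 * h)) 1 (C 1) ∧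
        IsSide (D.shift p (-1 * h)) (-1) (C 2)) ∧
      (∀ᶠ h in 𝓝[>] (0 : ℝ), IsSide (D.shift q (s * h)) s (C 1) ∧
        IsSide (D.shift q (s * h)) (-s) (C 0)) ∧
      (∀ᶠ h in 𝓝[>] (0 : ℝ), IsSide (D.shift q (-s * h)) (-s) (C 3) ∧
        IsSide (D.shift q (-s * h)) s (C 2)) ∧
      ∀ᶠ r in 𝓝[>] (0 : ℝ), D.point p + r • (D.velocity p -
        Real.sign ((starRingEnd ℂ (D.velocity p) * D.velocity q).im) • D.velocity q) ∈ (C 3).1 := by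
  have hli : LinearIndependent ℝ ![D.velocity p, D.velocity q] := D.transverse p q hpq hpt.symm
  set a := D.velocity p with ha
  set b := D.velocity q with hb
  -- This sign makes s·b point to the left of a, so that the branches appear in the cyclic order a,
  -- s·b, −a, −s·b for either direction of the second strand.
  set s := Real.sign ((starRingEnd ℂ a * b).im) with hsdef
  have him := im_conj_mul_ne_zero hli
  have ha0 : a ≠ 0 := by rintro h; rw [h] at him; simp at him
  have hb0 : b ≠ 0 := by rintro h; rw [h] at him; simp at him
  have hs : s = 1 ∨ s = -1 := (Real.sign_apply_eq_of_ne_zero _ him).symm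
  have hs0 : s ≠ 0 := by rcases hs with h | h <;> rw [h] <;> norm_num
  have hs' : -s = 1 ∨ -s = -1 := by rcases hs with h | h <;> rw [h] <;> norm_num
  have s1 : (1 : ℝ) = 1 ∨ (1 : ℝ) = -1 := Or.inl rfl
  have s2 : (-1 : ℝ) = 1 ∨ (-1 : ℝ) = -1 := Or.inr rfl
  have hss : s * s = 1 := by rcases hs with h | h <;> rw [h] <;> norm_num
  have hsC : (s : ℂ) ≠ 0 := by exact_mod_cast hs0
  -- the angle between the strands
  set z := s * b / a with hz
  have hzim : 0 < z.im := by
    have e : z = ((s / Complex.normSq a : ℝ) : ℂ) * (starRingEnd ℂ a * b) := by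
      rw [hz]; push_cast; rw [Complex.normSq_eq_conj_mul_self]
      have : starRingEnd ℂ a ≠ 0 := by simpa using ha0
      field_simp
    rw [e, Complex.im_ofReal_mul, div_mul_eq_mul_div]
    refine div_pos ?_ (Complex.normSq_pos.2 ha0)
    rw [hsdef]
    rcases lt_or_gt_of_ne him with h | h
    · rw [Real.sign_of_neg h]; linarith
    · rw [Real.sign_of_pos h]; linarith
  have hz0 : z ≠ 0 := by intro h; rw [h] at hzim; simp at hzim
  set α := a.arg with hα
  set δ := z.arg with hδ
  have hπ := Real.pi_pos
  have hδ0 : 0 < δ := by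
    refine lt_of_le_of_ne (Complex.arg_nonneg_iff.2 hzim.le) fun h => ?_
    have := (Complex.arg_eq_zero_iff.1 h.symm).2
    linarith
  have hδπ : δ < Real.pi := by
    refine lt_of_le_of_ne (Complex.arg_le_pi _) fun h => ?_
    have := (Complex.arg_eq_pi_iff.1 h).2
    linarith
  have ea : a = ‖a‖ * Complex.exp (α * Complex.I) := (Complex.norm_mul_exp_arg_mul_I a).symm
  have ez : z = ‖z‖ * Complex.exp (δ * Complex.I) := (Complex.norm_mul_exp_arg_mul_I z).symm
  have polar_mul : ∀ (w : ℂ) (φ : ℝ), w = ‖w‖ * Complex.exp (φ * Complex.I) →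
      a * w = ‖a * w‖ * Complex.exp ((α + φ : ℝ) * Complex.I) := by
    intro w φ hw
    rw [norm_mul]; push_cast; rw [add_mul, Complex.exp_add]
    calc a * w = (‖a‖ * Complex.exp (α * Complex.I)) * (‖w‖ * Complex.exp (φ * Complex.I)) := by
          rw [← ea, ← hw]
      _ = _ := by ring
  have polar_neg : ∀ (w : ℂ) (φ : ℝ), w = ‖w‖ * Complex.exp (φ * Complex.I) →
      -w = ‖-w‖ * Complex.exp ((φ + Real.pi : ℝ) * Complex.I) := by
    intro w φ hw
    rw [norm_neg]; push_cast; rw [add_mul, Complex.exp_add, Complex.exp_pi_mul_I]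
    nth_rewrite 1 [hw]; ring
  have esb : s * b = ‖s * b‖ * Complex.exp ((α + δ : ℝ) * Complex.I) := by
    have : s * b = a * z := by rw [hz]; field_simp
    rw [this]
    exact polar_mul z δ ez
  have ena := polar_neg a α ea
  have ensb := polar_neg _ _ esb
  -- the four branches
  obtain ⟨u₀, hb₀, hu₀⟩ := D.exists_isBranch p s1
  obtain ⟨u₁, hb₁, hu₁⟩ := D.exists_isBranch q hs
  obtain ⟨u₂, hb₂, hu₂⟩ := D.exists_isBranch p s2
  obtain ⟨u₃, hb₃, hu₃⟩ := D.exists_isBranch q hs'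
  have hu₀' : u₀ = a := by rw [hu₀ ha0]; simp [ha]
  have hu₁' : u₁ = s * b := hu₁ hb0
  have hu₂' : u₂ = -a := by rw [hu₂ ha0]; simp [ha]
  have hu₃' : u₃ = -(s * b) := by rw [hu₃ hb0]; push_cast; ring
  obtain ⟨h₀, -, R₀, θ₀, P₀⟩ := hb₀.exists_isPolar one_pos
  obtain ⟨h₁, -, R₁, θ₁, P₁⟩ := hb₁.exists_isPolar one_pos
  obtain ⟨h₂, -, R₂, θ₂, P₂⟩ := hb₂.exists_isPolar one_pos
  obtain ⟨h₃, -, R₃, θ₃, P₃⟩ := hb₃.exists_isPolar one_pos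
  obtain ⟨n₁, hn₁⟩ := Tendsto.exists_add_two_pi hb₁.ne P₁.tendsto (by rw [hu₁']; exact esb)
  obtain ⟨n₂, hn₂⟩ := Tendsto.exists_add_two_pi hb₂.ne P₂.tendsto (by rw [hu₂']; exact ena)
  obtain ⟨n₃, hn₃⟩ := Tendsto.exists_add_two_pi hb₃.ne P₃.tendsto (by rw [hu₃']; exact ensb)
  have hn₀ : Tendsto (fun r => θ₀ r + 2 * Real.pi * ((0 : ℤ) : ℝ)) (𝓝[>] 0) (𝓝 α) := by
    have := P₀.tendsto
    rw [hu₀'] at this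
    simpa using this
  have hn₄ : Tendsto (fun r => θ₀ r + 2 * Real.pi * ((1 : ℤ) : ℝ)) (𝓝[>] 0)
      (𝓝 (α + 2 * Real.pi)) := by
    have := P₀.tendsto.add_const (2 * Real.pi)
    rw [hu₀'] at this
    simpa using this
  let ψ : ℕ → ℝ → ℝ := fun j r => if j = 0 then θ₀ r + 2 * Real.pi * ((0 : ℤ) : ℝ) else
    if j = 1 then θ₁ r + 2 * Real.pi * n₁ else if j = 2 then θ₂ r + 2 * Real.pi * n₂ else
    if j = 3 then θ₃ r + 2 * Real.pi * n₃ else θ₀ r + 2 * Real.pi * ((1 : ℤ) : ℝ)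
  have ψ0 : ∀ r, ψ 0 r = θ₀ r + 2 * Real.pi * ((0 : ℤ) : ℝ) := fun r => rfl
  have ψ1 : ∀ r, ψ 1 r = θ₁ r + 2 * Real.pi * n₁ := fun r => rfl
  have ψ2 : ∀ r, ψ 2 r = θ₂ r + 2 * Real.pi * n₂ := fun r => rfl
  have ψ3 : ∀ r, ψ 3 r = θ₃ r + 2 * Real.pi * n₃ := fun r => rfl
  have ψ4 : ∀ r, ψ 4 r = θ₀ r + 2 * Real.pi * ((1 : ℤ) : ℝ) := fun r => rfl
  have t0 : Tendsto (ψ 0) (𝓝[>] 0) (𝓝 α) := hn₀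
  have t1 : Tendsto (ψ 1) (𝓝[>] 0) (𝓝 (α + δ)) := hn₁
  have t2 : Tendsto (ψ 2) (𝓝[>] 0) (𝓝 (α + Real.pi)) := hn₂
  have t3 : Tendsto (ψ 3) (𝓝[>] 0) (𝓝 (α + δ + Real.pi)) := hn₃
  have t4 : Tendsto (ψ 4) (𝓝[>] 0) (𝓝 (α + 2 * Real.pi)) := hn₄
  -- The limiting directions are strictly increasing because 0 < δ < π. Transversality thus orders
  -- the branches at small radii.
  have hev : ∀ᶠ r in 𝓝[>] (0 : ℝ), (ψ 0 r < ψ 1 r ∧ ψ 1 r < ψ 2 r) ∧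
      (ψ 2 r < ψ 3 r ∧ ψ 3 r < ψ 4 r) :=
    ((t0.eventually_lt t1 (by linarith)).and (t1.eventually_lt t2 (by linarith))).and
      ((t2.eventually_lt t3 (by linarith)).and (t3.eventually_lt t4 (by linarith)))
  obtain ⟨ρ₁, hρ₁, hord⟩ := mem_nhdsGT_iff_exists_Ioo_subset.1 hev
  rw [mem_Ioi] at hρ₁
  have hpre : ∀ r, D.point r = D.point p → r = p ∨ r = q := by
    intro r hr
    by_contra hcon
    push Not at hcon
    have h3 : ({p, q, r} : Set D.Param) ⊆ {t : Fin D.μ × UnitAddCircle | D.γ t.1 t.2 = D.point p} := by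
      rintro t (rfl | rfl | rfl)
      · rfl
      · exact hpt
      · exact hr
    have h4 := (encard_le_encard h3).trans (D.double (D.point p))
    have h5 : ({p, q, r} : Set D.Param).encard = 3 :=
      encard_eq_three.2 ⟨p, q, r, hpq, hcon.1.symm, hcon.2.symm, rfl⟩
    rw [h5] at h4
    exact absurd h4 (by norm_num)
  obtain ⟨ρ₀, hρ₀, hball⟩ := D.exists_ball_branch (D.point p)
    (h := fun _ => min (min h₀ h₂) (min h₁ h₃))
    (fun _ _ => lt_min (lt_min P₀.pos P₂.pos) (lt_min P₁.pos P₃.pos))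
  have hR₀ := P₀.R_pos
  have hR₁ := P₁.R_pos
  have hR₂ := P₂.R_pos
  have hR₃ := P₃.R_pos
  set ρ := min (min ρ₀ ρ₁) (min (min R₀ R₁) (min R₂ R₃)) with hρdef
  have hρ : 0 < ρ := by positivity
  have sub0 : Ioo 0 ρ ⊆ Ioo 0 R₀ := Ioo_subset_Ioo_right
    ((min_le_right _ _).trans ((min_le_left _ _).trans (min_le_left _ _)))
  have sub1 : Ioo 0 ρ ⊆ Ioo 0 R₁ := Ioo_subset_Ioo_right
    ((min_le_right _ _).trans ((min_le_left _ _).trans (min_le_right _ _)))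
  have sub2 : Ioo 0 ρ ⊆ Ioo 0 R₂ := Ioo_subset_Ioo_right
    ((min_le_right _ _).trans ((min_le_right _ _).trans (min_le_left _ _)))
  have sub3 : Ioo 0 ρ ⊆ Ioo 0 R₃ := Ioo_subset_Ioo_right
    ((min_le_right _ _).trans ((min_le_right _ _).trans (min_le_right _ _)))
  have subo : Ioo 0 ρ ⊆ Ioo 0 ρ₁ := Ioo_subset_Ioo_right
    ((min_le_left _ _).trans (min_le_right _ _))
  have hlt : ∀ j < 4, ∀ r ∈ Ioo 0 ρ, ψ j r < ψ (j + 1) r := by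
    intro j hj r hr
    obtain ⟨⟨o1, o2⟩, o3, o4⟩ := hord (subo hr)
    interval_cases j
    exacts [o1, o2, o3, o4]
  obtain ⟨F, hF, hcl⟩ := exists_faces_of_fan (D := D) (x := D.point p) (mem_range_self p) (m := 4) hρ
    (ψ := ψ) (fun j => by
      simp only [ψ]
      split_ifs
      · exact (P₀.continuousOn.mono sub0).add continuousOn_const
      · exact (P₁.continuousOn.mono sub1).add continuousOn_const
      · exact (P₂.continuousOn.mono sub2).add continuousOn_const
      · exact (P₃.continuousOn.mono sub3).add continuousOn_const
      · exact (P₀.continuousOn.mono sub0).add continuousOn_const) hlt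
    (fun r hr => by rw [ψ0, ψ4]; push_cast; ring)
    (fun r hr φ hφ => by
      have hnorm : ‖D.point p + r * Complex.exp (φ * Complex.I) - D.point p‖ = r := by
        rw [add_sub_cancel_left, norm_mul, Complex.norm_exp_ofReal_mul_I, mul_one, Complex.norm_real,
          Real.norm_of_nonneg hr.1.le]
      obtain ⟨t, ht, σ, hσ, x, hx, he⟩ := hball _ hφ (by
        intro h0
        rw [h0, sub_self, norm_zero] at hnorm
        exact hr.1.ne hnorm)
        (by rw [hnorm]; exact hr.2.trans_le ((min_le_left _ _).trans (min_le_left _ _)))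
      have b0 : x < h₀ := hx.2.trans_le ((min_le_left _ _).trans (min_le_left _ _))
      have b2 : x < h₂ := hx.2.trans_le ((min_le_left _ _).trans (min_le_right _ _))
      have b1 : x < h₁ := hx.2.trans_le ((min_le_right _ _).trans (min_le_left _ _))
      have b3 : x < h₃ := hx.2.trans_le ((min_le_right _ _).trans (min_le_right _ _))
      rcases hpre t ht with rfl | rfl
      · rcases hσ with rfl | rfl
        · obtain ⟨n, hn⟩ := exists_angle_eq_of_isPolar P₀ hr.1 ⟨hx.1, b0⟩ he 0
          exact ⟨0, by norm_num, n, by rw [ψ0]; exact hn⟩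
        · obtain ⟨n, hn⟩ := exists_angle_eq_of_isPolar P₂ hr.1 ⟨hx.1, b2⟩ he n₂
          exact ⟨2, by norm_num, n, by rw [ψ2]; exact hn⟩
      · have hσs : σ = s ∨ σ = -s := by
          rcases hσ with rfl | rfl <;> rcases hs with h | h <;> rw [h] <;> norm_num
        rcases hσs with rfl | rfl
        · obtain ⟨n, hn⟩ := exists_angle_eq_of_isPolar P₁ hr.1 ⟨hx.1, b1⟩ he n₁
          exact ⟨1, by norm_num, n, by rw [ψ1]; exact hn⟩
        · obtain ⟨n, hn⟩ := exists_angle_eq_of_isPolar P₃ hr.1 ⟨hx.1, b3⟩ he n₃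
          exact ⟨3, by norm_num, n, by rw [ψ3]; exact hn⟩)
    (fun j hj r hr => by
      interval_cases j
      · rw [ψ0]; exact mem_support_of_isPolar P₀ (sub0 hr) 0
      · rw [ψ1, ← hpt]; exact mem_support_of_isPolar P₁ (sub1 hr) n₁
      · rw [ψ2]; exact mem_support_of_isPolar P₂ (sub2 hr) n₂
      · rw [ψ3, ← hpt]; exact mem_support_of_isPolar P₃ (sub3 hr) n₃)
  have hF0 := hF 0 (by norm_num)
  have hF1 := hF 1 (by norm_num)
  have hF2 := hF 2 (by norm_num)
  have hF3 := hF 3 (by norm_num)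
  have l0 := hlt 0 (by norm_num)
  have l1 := hlt 1 (by norm_num)
  have l2 := hlt 2 (by norm_num)
  have l3 := hlt 3 (by norm_num)
  -- The direction `e` bisects the first corner. Its quarter turns stay in the successive corners: α
  -- + δ/2 + kπ/2 lies strictly between the limiting angles, again by 0 < δ < π.
  refine ⟨fun k => F k, Complex.exp ((α + δ / 2 : ℝ) * Complex.I), s, Complex.exp_ne_zero _, hs,
    ?_, ?_, ?_, ?_, ?_, ?_, ?_⟩
  · intro G
    rw [hcl]
    constructor
    · rintro ⟨j, hj, rfl⟩
      exact ⟨⟨j, hj⟩, rfl⟩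
    · rintro ⟨k, rfl⟩
      exact ⟨k, k.2, rfl⟩
  · have hdir : ∀ k : ℕ, Complex.I ^ k * Complex.exp ((α + δ / 2 : ℝ) * Complex.I) =
        ‖Complex.I ^ k * Complex.exp ((α + δ / 2 : ℝ) * Complex.I)‖ *
        Complex.exp ((α + δ / 2 + k * (Real.pi / 2) : ℝ) * Complex.I) := by
      intro k
      rw [norm_mul, norm_pow, Complex.norm_I, one_pow, Complex.norm_exp_ofReal_mul_I]
      have : Complex.I ^ k = Complex.exp ((k * (Real.pi / 2) : ℝ) * Complex.I) := by
        rw [show ((k * (Real.pi / 2) : ℝ) * Complex.I : ℂ) = k * (Real.pi / 2 * Complex.I) by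
          push_cast; ring, Complex.exp_nat_mul, Complex.exp_pi_div_two_mul_I]
      rw [this, ← Complex.exp_add]; push_cast; ring_nf
    have hne : ∀ k : ℕ, Complex.I ^ k * Complex.exp ((α + δ / 2 : ℝ) * Complex.I) ≠ 0 := fun k =>
      mul_ne_zero (pow_ne_zero _ Complex.I_ne_zero) (Complex.exp_ne_zero _)
    intro k
    fin_cases k
    · exact hF0.eventually_mem hρ t0 t1 (by push_cast; linarith) (by push_cast; linarith) (hne 0) (hdir 0)
    · exact hF1.eventually_mem hρ t1 t2 (by push_cast; linarith) (by push_cast; linarith) (hne 1) (hdir 1)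
    · exact hF2.eventually_mem hρ t2 t3 (by push_cast; linarith) (by push_cast; linarith) (hne 2) (hdir 2)
    · exact hF3.eventually_mem hρ t3 t4 (by push_cast; linarith) (by push_cast; linarith) (hne 3) (hdir 3)
  · have x := eventually_isSide s1 s1 P₀ hρ fun r hr => hF0.eventually_lower l0 0 ψ0 hr
    have y := eventually_isSide s1 s2 P₀ hρ fun r hr => hF3.eventually_upper l3 1 ψ4 hr
    simp only [mul_one] at x y
    exact x.and y
  · have x := eventually_isSide s2 s2 P₂ hρ fun r hr => hF1.eventually_upper l1 n₂ ψ2 hr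
    have y := eventually_isSide s2 s1 P₂ hρ fun r hr => hF2.eventually_lower l2 n₂ ψ2 hr
    simp only [mul_neg, mul_one, neg_neg] at x y
    exact x.and y
  · have x := eventually_isSide hs s1 P₁ hρ fun r hr => by
      rw [hpt]; exact hF1.eventually_lower l1 n₁ ψ1 hr
    have y := eventually_isSide hs s2 P₁ hρ fun r hr => by
      rw [hpt]; exact hF0.eventually_upper l0 n₁ ψ1 hr
    simp only [one_mul, neg_mul] at x y
    exact x.and y
  · have x := eventually_isSide hs' s1 P₃ hρ fun r hr => by
      rw [hpt]; exact hF3.eventually_lower l3 n₃ ψ3 hr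
    have y := eventually_isSide hs' s2 P₃ hρ fun r hr => by
      rw [hpt]; exact hF2.eventually_upper l2 n₃ ψ3 hr
    simp only [one_mul, neg_mul, neg_neg] at x y ⊢
    exact x.and y
  -- The diagonal is a − s·b = −a(z − 1), of angle α + arg(z − 1) + π; since δ < arg(z − 1) < π, it
  -- points into the last corner.
  · have hz1 : 0 < (z - 1).im := by simpa using hzim
    have hz10 : z - 1 ≠ 0 := by intro h; rw [h] at hz1; simp at hz1
    have hlt1 := Complex.arg_lt_arg_sub_one hzim
    have hlt2 : (z - 1).arg < Real.pi := by
      refine lt_of_le_of_ne (Complex.arg_le_pi _) fun h => ?_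
      have := (Complex.arg_eq_pi_iff.1 h).2
      linarith
    have ew := polar_neg _ _ (polar_mul (z - 1) _ (Complex.norm_mul_exp_arg_mul_I _).symm)
    have e2 : -(a * (z - 1)) = a - s • b := by
      rw [hz, Complex.real_smul]; field_simp; ring
    rw [e2] at ew
    have hne : a - s • b ≠ 0 := by
      rw [← e2]; exact neg_ne_zero.2 (mul_ne_zero ha0 hz10)
    exact hF3.eventually_mem hρ t3 t4 (by linarith) (by linarith) hne ew

end LinkDiagram

/-! ### The faces to the left and right along the curves -/

/-- The sides at a parameter are defined by what follows it. This passes from a property of a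
one-sided germ to the germs that follow its points, also when the germ is traversed backwards. -/
theorem eventually_eventually_add {P : ℝ → Prop} {σ : ℝ} (hσ : σ = 1 ∨ σ = -1)
    (h : ∀ᶠ s in 𝓝[>] (0 : ℝ), P (σ * s)) :
    ∀ᶠ s in 𝓝[>] (0 : ℝ), ∀ᶠ t in 𝓝[>] (0 : ℝ), P (σ * s + t) := by
  obtain ⟨δ, hδ, hP⟩ := mem_nhdsGT_iff_exists_Ioo_subset.1 h
  rw [mem_Ioi] at hδ
  filter_upwards [Ioo_mem_nhdsGT hδ] with s hs
  rcases hσ with rfl | rfl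
  · filter_upwards [Ioo_mem_nhdsGT (sub_pos.2 hs.2)] with t ht
    have := hP (show s + t ∈ Ioo 0 δ from ⟨by linarith [hs.1, ht.1], by linarith [ht.2]⟩)
    simpa using this
  · filter_upwards [Ioo_mem_nhdsGT hs.1] with t ht
    have := hP (show s - t ∈ Ioo 0 δ from ⟨by linarith [ht.2], by linarith [hs.2, ht.1]⟩)
    have e : -1 * s + t = -1 * (s - t) := by ring
    rw [e]; exact this

namespace LinkDiagram

variable (D : LinkDiagram)

/-- `L` and `R` are the faces to the left and to the right of the curve at the parameter `p`. -/
def HasSides (p : D.Param) (F : D.Face × D.Face) : Prop := IsSide p 1 F.1 ∧ IsSide p (-1) F.2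

variable {D}

theorem HasSides.unique {p : D.Param} {F F' : D.Face × D.Face} (h : D.HasSides p F)
    (h' : D.HasSides p F') : F = F' :=
  Prod.ext (h.1.unique h'.1) (h.2.unique h'.2)

variable (D)

theorem exists_hasSides (p : D.Param) :
    ∃ F : D.Face × D.Face, ∀ᶠ h in 𝓝[>] (0 : ℝ), D.HasSides (D.shift p h) F := by
  by_cases hp : D.IsDouble p
  · obtain ⟨q, hq, he⟩ := hp
    obtain ⟨C, e, s, -, -, -, -, h, -⟩ := exists_faces_of_crossing hq.symm he
    exact ⟨(C 0, C 3), by simpa [HasSides] using h⟩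
  · obtain ⟨L, R, h, -⟩ := exists_faces_of_not_isDouble hp
    exact ⟨(L, R), by simpa [HasSides] using h 1 (Or.inl rfl)⟩

/-- The faces to the left and to the right of the curve, immediately after the parameter `p`. -/
noncomputable def sides (p : D.Param) : D.Face × D.Face := (D.exists_hasSides p).choose

theorem hasSides_sides (p : D.Param) :
    ∀ᶠ h in 𝓝[>] (0 : ℝ), D.HasSides (D.shift p h) (D.sides p) := (D.exists_hasSides p).choose_spec

variable {D}

theorem sides_eq {p : D.Param} {F : D.Face × D.Face}
    (h : ∀ᶠ h in 𝓝[>] (0 : ℝ), D.HasSides (D.shift p h) F) : D.sides p = F := by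
  obtain ⟨r, h1, h2⟩ := ((D.hasSides_sides p).and h).exists
  exact h1.unique h2

theorem eventually_sides_eq {p : D.Param} {σ : ℝ} (hσ : σ = 1 ∨ σ = -1) {F : D.Face × D.Face}
    (h : ∀ᶠ h in 𝓝[>] (0 : ℝ), D.HasSides (D.shift p (σ * h)) F) :
    ∀ᶠ h in 𝓝[>] (0 : ℝ), D.sides (D.shift p (σ * h)) = F := by
  filter_upwards [eventually_eventually_add hσ (P := fun s => D.HasSides (D.shift p s) F) h] with s hs
  apply sides_eq
  simpa only [shift_shift] using hs

theorem eventually_sides_eq_right (p : D.Param) :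
    ∀ᶠ h in 𝓝[>] (0 : ℝ), D.sides (D.shift p h) = D.sides p := by
  have := eventually_sides_eq (p := p) (σ := 1) (Or.inl rfl) (F := D.sides p)
    (by simpa using D.hasSides_sides p)
  simpa using this

/-- A property holds at all parameters close to `p` if it does so at `p` and on either side. -/
theorem eventually_nhds_of_shift {p : D.Param} {P : D.Param → Prop} (h0 : P p)
    (h1 : ∀ᶠ h in 𝓝[>] (0 : ℝ), P (D.shift p h))
    (h2 : ∀ᶠ h in 𝓝[>] (0 : ℝ), P (D.shift p (-h))) : ∀ᶠ q in 𝓝 p, P q := by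
  have := D.map_shift_nhds p 0
  rw [shift_zero] at this
  rw [← this, eventually_map]
  obtain ⟨a, ha, hA⟩ := mem_nhdsGT_iff_exists_Ioo_subset.1 h1
  obtain ⟨b, hb, hB⟩ := mem_nhdsGT_iff_exists_Ioo_subset.1 h2
  rw [mem_Ioi] at ha hb
  filter_upwards [Ioo_mem_nhds (show -b < 0 by linarith) ha] with s hs
  rcases lt_trichotomy s 0 with h | h | h
  · have := hB (show -s ∈ Ioo 0 b from ⟨by linarith, by linarith [hs.1]⟩)
    simpa using this
  · rw [h, shift_zero]; exact h0
  · exact hA ⟨h, hs.2⟩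

theorem sides_of_not_isDouble {p : D.Param} (hp : ¬ D.IsDouble p) :
    (∀ᶠ q in 𝓝 p, D.sides q = D.sides p) ∧
      (∀ᶠ h in 𝓝[>] (0 : ℝ), D.sides (D.shift p (-h)) = D.sides p) ∧
      ∀ G : D.Face, D.point p ∈ closure G.1 ↔ G = (D.sides p).1 ∨ G = (D.sides p).2 := by
  obtain ⟨L, R, h, hcl⟩ := exists_faces_of_not_isDouble hp
  have hs : D.sides p = (L, R) := sides_eq (by simpa [HasSides] using h 1 (Or.inl rfl))
  have h2 : ∀ᶠ h in 𝓝[>] (0 : ℝ), D.sides (D.shift p (-h)) = D.sides p := by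
    have := eventually_sides_eq (p := p) (Or.inr rfl) (F := (L, R)) (h (-1) (Or.inr rfl))
    rw [hs]
    simpa using this
  refine ⟨eventually_nhds_of_shift rfl (eventually_sides_eq_right p) h2, h2, ?_⟩
  rw [hs]
  exact hcl

/-- The two faces on the two sides of the curve are different. -/
theorem sides_fst_ne_snd (p : D.Param) : (D.sides p).1 ≠ (D.sides p).2 := by
  intro hLR
  set F := (D.sides p).1 with hFdef
  obtain ⟨u, hb, -⟩ := D.exists_isBranch p (σ := 1) (Or.inl rfl)
  obtain ⟨h₀, -, R, θ, P⟩ := hb.exists_isPolar one_pos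
  -- The argument takes place at a nearby later parameter that is simple and has nonzero velocity.
  obtain ⟨h, ⟨hside, hnd⟩, hh⟩ := (((D.hasSides_sides p).and
    (D.eventually_shift_not_isDouble p (σ := 1) (Or.inl rfl))).and (Ioo_mem_nhdsGT P.pos)).exists
  have hv : D.velocity (D.shift p h) ≠ 0 := by
    have := P.ne h hh
    rw [branchDeriv] at this
    simpa using this
  rw [one_mul] at hnd
  set q := D.shift p h with hq
  set v := D.velocity q with hvdef
  set f : ℝ → ℂ := fun s => D.point (D.shift q s) with hf
  have hfc : Continuous f := D.continuous_point_shift q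
  have hf0 : f 0 = D.point q := by simp [hf]
  have hd : HasDerivAt f v 0 := by
    have h1 := D.deriv_point_shift q 0
    rw [shift_zero] at h1
    rw [hvdef, ← h1]
    exact (differentiableAt_of_deriv_ne_zero (by rw [h1]; exact hv)).hasDerivAt
  have hvn : 0 < ‖v‖ := norm_pos_iff.2 hv
  obtain ⟨ε', hε', hlin⟩ := Metric.eventually_nhds_iff.1
    ((hasDerivAt_iff_isLittleO.1 hd).def (c := ‖v‖ / 2) (by positivity))
  set ε := min (ε' / 2) (1 / 4) with hε
  have hε0 : 0 < ε := by positivity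
  have hεε' : ε < ε' := (min_le_left _ _).trans_lt (by linarith)
  have hε1 : ε ≤ 1 / 4 := min_le_right _ _
  -- This is 2πi times the winding number about `z` of the closed curve through `q`, split into a
  -- short arc around `q`, which carries the jump, and the rest. It is constant on `F`.
  let W : ℂ → ℂ := fun z => logVar f (0 - ε) (0 + ε) z + logVar f (0 + ε) (1 - ε) z
  have a1 : 0 - ε ≤ 0 + ε := by linarith
  have a2 : 0 + ε ≤ 1 - ε := by linarith
  have hWF : ∀ z ∈ F.1, ∀ t, f t ≠ z := by
    rintro z hz t rfl
    exact F.subset hz (mem_range_self _)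
  have hWc : ContinuousOn W F.1 := fun z hz =>
    ((continuousAt_logVar a1 hfc.continuousOn fun t _ => hWF z hz t).add
      (continuousAt_logVar a2 hfc.continuousOn fun t _ => hWF z hz t)).continuousWithinAt
  have hW1 : ∀ z ∈ F.1, Complex.exp (W z) = 1 := by
    intro z hz
    have n : ∀ t, f t - z ≠ 0 := fun t => sub_ne_zero.2 (hWF z hz t)
    rw [Complex.exp_add, exp_logVar a1 hfc.continuousOn fun t _ => hWF z hz t,
      exp_logVar a2 hfc.continuousOn fun t _ => hWF z hz t]
    have e : f (1 - ε) = f (0 - ε) := by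
      simp only [hf]
      rw [show (1 - ε) = (0 - ε) + 1 by ring, shift_add_one]
    rw [e]
    have := n (0 + ε); have := n (0 - ε)
    field_simp
  have hjump : Tendsto (fun r : ℝ => W (f 0 + r • (Complex.I * v)) - W (f 0 - r • (Complex.I * v)))
      (𝓝[>] 0) (𝓝 (2 * Real.pi * Complex.I)) := by
    have t1 := tendsto_logVar_sub_logVar (f := f) (t₀ := 0) hε0 hv hfc.continuousOn (by
      intro t ht
      have := hlin (y := t) (by
        rw [Real.dist_eq, sub_zero, abs_lt]; constructor <;> linarith [ht.1, ht.2])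
      simpa using this)
    -- Since `q` is a simple parameter, the rest of the curve avoids its point and contributes no
    -- jump.
    have hc := continuousAt_logVar (z := f 0) a2 hfc.continuousOn (by
      intro t ht h0
      have e : D.shift q t = q := by
        by_contra hne
        exact hnd ⟨_, hne, by rw [← hf0]; exact h0⟩
      have := D.shift_injOn q (s := t) (t := 0) (by
        rw [sub_zero, abs_lt]; constructor <;> linarith [ht.1, ht.2]) (by rw [e, shift_zero])
      linarith [ht.1])
    have l1 : Tendsto (fun r : ℝ => f 0 + r • (Complex.I * v)) (𝓝[>] 0) (𝓝 (f 0)) := by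
      have : Continuous fun r : ℝ => f 0 + r • (Complex.I * v) := by fun_prop
      simpa using (this.tendsto 0).mono_left (nhdsWithin_le_nhds (s := Ioi 0))
    have l2 : Tendsto (fun r : ℝ => f 0 - r • (Complex.I * v)) (𝓝[>] 0) (𝓝 (f 0)) := by
      have : Continuous fun r : ℝ => f 0 - r • (Complex.I * v) := by fun_prop
      simpa using (this.tendsto 0).mono_left (nhdsWithin_le_nhds (s := Ioi 0))
    have := t1.add ((hc.tendsto.comp l1).sub (hc.tendsto.comp l2))
    rw [sub_self, add_zero] at this
    refine this.congr fun r => ?_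
    simp only [W, Function.comp_apply]
    ring
  have hzero : ∀ᶠ r in 𝓝[>] (0 : ℝ),
      W (f 0 + r • (Complex.I * v)) - W (f 0 - r • (Complex.I * v)) = 0 := by
    obtain ⟨hl, hr⟩ := hside
    rw [← hLR] at hr
    filter_upwards [hl, hr] with r h1 h2
    have e1 : f 0 + r • (Complex.I * v) = D.point q + r • (Complex.I * ((1 : ℝ) * D.velocity q)) := by
      rw [hf0]; simp [hvdef]
    have e2 : f 0 - r • (Complex.I * v) =
        D.point q + r • (Complex.I * ((-1 : ℝ) * D.velocity q)) := by
      rw [hf0]; simp [hvdef, sub_eq_add_neg]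
    rw [e1, e2, sub_eq_zero]
    exact F.isPathConnected.isConnected.isPreconnected.eq_of_exp_eq_one hWc hW1 h1 h2
  have h0 : Tendsto (fun _ : ℝ => (0 : ℂ)) (𝓝[>] (0 : ℝ)) (𝓝 (2 * Real.pi * Complex.I)) :=
    hjump.congr' hzero
  have := tendsto_nhds_unique h0 tendsto_const_nhds
  have hπ : (Real.pi : ℂ) ≠ 0 := by exact_mod_cast Real.pi_ne_zero
  simp [hπ] at this

/-! ### A combinatorial model of a crossing -/

/-- The four corners `C 0`, …, `C 3` at the crossing `c`, in counterclockwise order, starting with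
the corner on the left of the overpassing strand behind the crossing. The parameters of the two
strands are `p` and `q`. -/
structure IsLocalModel (c : D.Crossing) (p q : D.Param) (C : Fin 4 → D.Face) (e : ℂ) : Prop where
  ne : p ≠ q
  point_over : D.point p = c.1
  point_under : D.point q = c.1
  notMem_under : p ∉ D.under
  mem_under : q ∈ D.under
  e_ne : e ≠ 0
  incident_iff : ∀ G, c.Incident G ↔ ∃ k, C k = G
  mem : ∀ k : Fin 4, ∀ᶠ r in 𝓝[>] (0 : ℝ), c.1 + r • (Complex.I ^ (k : ℕ) * e) ∈ (C k).1
  sides_over : D.sides p = (C 0, C 3)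
  sides_over_left : ∀ᶠ h in 𝓝[>] (0 : ℝ), D.sides (D.shift p (-h)) = (C 1, C 2)
  sides_under : (D.sides q = (C 1, C 0) ∧
      ∀ᶠ h in 𝓝[>] (0 : ℝ), D.sides (D.shift q (-h)) = (C 2, C 3)) ∨
    (D.sides q = (C 3, C 2) ∧
      ∀ᶠ h in 𝓝[>] (0 : ℝ), D.sides (D.shift q (-h)) = (C 0, C 1))
  eq_or_eq : ∀ r, D.point r = c.1 → r = p ∨ r = q
  overOnRight_iff : ∀ s : D.Shading, s.OverOnRight c ↔ C 3 ∉ s.shaded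

theorem exists_isLocalModel (c : D.Crossing) : ∃ p q C e, IsLocalModel c p q C e := by
  obtain ⟨p, q, hpq, hp, hq, hpo, hqu⟩ : ∃ p q : D.Param, p ≠ q ∧ D.point p = c.1 ∧
      D.point q = c.1 ∧ p ∉ D.under ∧ q ∈ D.under := by
    obtain ⟨p, q, hpq, hp, hq⟩ := c.2
    have h := D.under_iff p q hpq (hp.trans hq.symm)
    by_cases hpu : p ∈ D.under
    · exact ⟨q, p, hpq.symm, hq, hp, h.1 hpu, hpu⟩
    · exact ⟨p, q, hpq, hp, hq, hpu, by by_contra hn; exact hpu (h.2 hn)⟩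
  have hpre : ∀ r, D.point r = c.1 → r = p ∨ r = q := by
    intro r hr
    by_contra hcon
    push Not at hcon
    have h3 : ({p, q, r} : Set D.Param) ⊆ {t : Fin D.μ × UnitAddCircle | D.γ t.1 t.2 = c.1} := by
      rintro t (rfl | rfl | rfl)
      exacts [hp, hq, hr]
    have h4 := (encard_le_encard h3).trans (D.double c.1)
    have h5 : ({p, q, r} : Set D.Param).encard = 3 :=
      encard_eq_three.2 ⟨p, q, r, hpq, hcon.1.symm, hcon.2.symm, rfl⟩
    rw [h5] at h4
    exact absurd h4 (by norm_num)
  obtain ⟨C, e, s, he, hs, hcl, hmem, h1, h2, h3, h4, h5⟩ :=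
    exists_faces_of_crossing hpq (hq.trans hp.symm)
  rw [hp] at hcl hmem h5
  refine ⟨p, q, C, e, hpq, hp, hq, hpo, hqu, he, ?_, hmem, ?_, ?_, ?_, hpre, ?_⟩
  · intro G
    rw [Crossing.Incident, G.frontier_eq, ← hcl]
    exact ⟨fun h => h.1, fun h => ⟨h, ⟨p, hp⟩⟩⟩
  · exact sides_eq (by simpa [HasSides] using h1)
  · have := eventually_sides_eq (Or.inr rfl) (F := (C 1, C 2)) h2
    simpa using this
  -- For `s = 1` the underpassing strand runs from the right to the left of the overpassing one, for
  -- `s = -1` from the left to the right.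
  · rcases hs with rfl | rfl
    · refine Or.inl ⟨sides_eq (by simpa [HasSides] using h3), ?_⟩
      have := eventually_sides_eq (Or.inr rfl) (F := (C 2, C 3))
        (h4.mono fun h hh => And.symm hh)
      simpa using this
    · rw [neg_neg] at h4 h3
      refine Or.inr ⟨sides_eq (by simpa [HasSides] using h4), ?_⟩
      have := eventually_sides_eq (Or.inr rfl) (F := (C 0, C 1))
        (h3.mono fun h hh => And.symm hh)
      simpa using this
  · intro s
    constructor
    · rintro ⟨p', q', hp', hq', hpo', hqu', F, hF⟩
      -- Only two parameters lie over the crossing, so the choice of strands in the definition is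
      -- forced.
      have e1 : p' = p := (hpre p' hp').resolve_right (by rintro rfl; exact hpo' hqu)
      have e2 : q' = q := (hpre q' hq').resolve_left (by rintro rfl; exact hpo hqu')
      rw [e1, e2] at hF
      obtain ⟨r, hr1, hr2⟩ := (hF.and h5).exists
      rw [← Face.eq_of_mem hr1 hr2]
      exact F.2
    · intro h
      exact ⟨p, q, hp, hq, hpo, hqu, ⟨C 3, h⟩, h5⟩

namespace Crossing

variable (c : D.Crossing)

/-- The parameter of the overpassing strand. -/
noncomputable def overParam : D.Param := (exists_isLocalModel c).choose

/-- The parameter of the underpassing strand. -/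
noncomputable def underParam : D.Param := (exists_isLocalModel c).choose_spec.choose

/-- The four corners at a crossing, in counterclockwise order. -/
noncomputable def corner : Fin 4 → D.Face := (exists_isLocalModel c).choose_spec.choose_spec.choose

/-- A direction that points into the corner `c.corner 0`. -/
noncomputable def dir : ℂ := (exists_isLocalModel c).choose_spec.choose_spec.choose_spec.choose

theorem isLocalModel : IsLocalModel c c.overParam c.underParam c.corner c.dir :=
  (exists_isLocalModel c).choose_spec.choose_spec.choose_spec.choose_spec

theorem overParam_injective : Function.Injective (overParam (D := D)) := fun c c' h =>
  Subtype.ext (by rw [← c.isLocalModel.point_over, h, c'.isLocalModel.point_over])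

theorem underParam_injective : Function.Injective (underParam (D := D)) := fun c c' h =>
  Subtype.ext (by rw [← c.isLocalModel.point_under, h, c'.isLocalModel.point_under])

theorem overParam_ne_underParam (c c' : D.Crossing) : c.overParam ≠ c'.underParam := fun h =>
  c.isLocalModel.notMem_under (h ▸ c'.isLocalModel.mem_under)

theorem isDouble_overParam : D.IsDouble c.overParam :=
  ⟨c.underParam, c.isLocalModel.ne.symm, c.isLocalModel.point_under.trans c.isLocalModel.point_over.symm⟩

theorem isDouble_underParam : D.IsDouble c.underParam :=
  ⟨c.overParam, c.isLocalModel.ne, c.isLocalModel.point_over.trans c.isLocalModel.point_under.symm⟩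

end Crossing

instance : Finite D.Crossing := D.finite_double

theorem IsDouble.exists_crossing {p : D.Param} (hp : D.IsDouble p) :
    ∃ c : D.Crossing, p = c.overParam ∨ p = c.underParam := by
  obtain ⟨q, hq, he⟩ := hp
  exact ⟨⟨D.point p, p, q, hq.symm, rfl, he⟩, Crossing.isLocalModel _ |>.eq_or_eq p rfl⟩

variable (D) in
theorem exists_sides_left (p : D.Param) :
    ∃ F, ∀ᶠ h in 𝓝[>] (0 : ℝ), D.sides (D.shift p (-h)) = F := by
  by_cases hp : D.IsDouble p
  · obtain ⟨c, rfl | rfl⟩ := hp.exists_crossing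
    · exact ⟨_, c.isLocalModel.sides_over_left⟩
    · rcases c.isLocalModel.sides_under with h | h
      · exact ⟨_, h.2⟩
      · exact ⟨_, h.2⟩
  · exact ⟨_, (sides_of_not_isDouble hp).2.1⟩

/-- The faces to the left and to the right of the curve, immediately before the parameter `p`. -/
noncomputable def sidesLeft (p : D.Param) : D.Face × D.Face := (D.exists_sides_left p).choose

theorem eventually_sides_eq_left (p : D.Param) :
    ∀ᶠ h in 𝓝[>] (0 : ℝ), D.sides (D.shift p (-h)) = sidesLeft p := (D.exists_sides_left p).choose_spec

theorem sidesLeft_eq {p : D.Param} {F : D.Face × D.Face}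
    (h : ∀ᶠ h in 𝓝[>] (0 : ℝ), D.sides (D.shift p (-h)) = F) : sidesLeft p = F := by
  obtain ⟨r, h1, h2⟩ := ((eventually_sides_eq_left p).and h).exists
  exact h1.symm.trans h2

theorem finite_setOf_mem_closure (p : D.Param) : {G : D.Face | D.point p ∈ closure G.1}.Finite := by
  by_cases hp : D.IsDouble p
  · obtain ⟨c, hc⟩ := hp.exists_crossing
    have e : D.point p = c.1 := by
      rcases hc with rfl | rfl
      exacts [c.isLocalModel.point_over, c.isLocalModel.point_under]
    refine (finite_range c.corner).subset fun G hG => (c.isLocalModel.incident_iff G).1 ?_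
    rw [Crossing.Incident, G.frontier_eq, ← e]
    exact ⟨hG, mem_range_self p⟩
  · have : {G : D.Face | D.point p ∈ closure G.1} = {(D.sides p).1, (D.sides p).2} := by
      ext G
      exact (sides_of_not_isDouble hp).2.2 G
    rw [this]
    exact toFinite _

/-! ### Finiteness of the faces; shadings and colorings at the crossings -/

/-- There are only finitely many faces. -/
instance : Finite D.Face := by
  -- only finitely many faces touch the curves close to a given parameter
  have hloc : ∀ p : D.Param, ∃ S : Set D.Face, S.Finite ∧
      ∀ᶠ q in 𝓝 p, ∀ G : D.Face, D.point q ∈ closure G.1 → G ∈ S := by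
    intro p
    refine ⟨{G : D.Face | D.point p ∈ closure G.1} ∪
      {(D.sides p).1, (D.sides p).2, (sidesLeft p).1, (sidesLeft p).2},
      (finite_setOf_mem_closure p).union (toFinite _), ?_⟩
    refine eventually_nhds_of_shift (fun G hG => Or.inl hG) ?_ ?_
    · have h1 := D.eventually_shift_not_isDouble p (σ := 1) (Or.inl rfl)
      simp only [one_mul] at h1
      filter_upwards [h1, eventually_sides_eq_right p] with h hnd hs G hG
      have := ((sides_of_not_isDouble hnd).2.2 G).1 hG
      rw [hs] at this
      right
      simp only [mem_insert_iff, mem_singleton_iff]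
      tauto
    · have h1 := D.eventually_shift_not_isDouble p (σ := -1) (Or.inr rfl)
      simp only [neg_mul, one_mul] at h1
      filter_upwards [h1, eventually_sides_eq_left p] with h hnd hs G hG
      have := ((sides_of_not_isDouble hnd).2.2 G).1 hG
      rw [hs] at this
      right
      simp only [mem_insert_iff, mem_singleton_iff]
      tauto
  choose S hS hSe using hloc
  obtain ⟨t, -, ht⟩ := (isCompact_univ (X := D.Param)).elim_nhds_subcover
    (fun p => {q | ∀ G : D.Face, D.point q ∈ closure G.1 → G ∈ S p}) fun p _ => hSe p
  -- A face without frontier is clopen, hence the whole plane; this is the case of a diagram without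
  -- curves. All other faces touch a curve and are caught by the finite subcover.
  have hfin : ((⋃ p ∈ t, S p) ∪ {G : D.Face | G.1 = univ}).Finite := by
    refine (t.finite_toSet.biUnion fun p _ => hS p).union ?_
    refine Set.Subsingleton.finite fun G hG G' hG' => Subtype.ext ?_
    exact (show G.1 = univ from hG).trans (show G'.1 = univ from hG').symm
  refine finite_univ_iff.1 (hfin.subset fun G _ => ?_)
  by_cases hG : G.1 = univ
  · exact Or.inr hG
  left
  have hfr : (frontier G.1).Nonempty := by
    rw [nonempty_iff_ne_empty]
    intro h0
    have := isClopen_iff_frontier_eq_empty.2 h0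
    rcases isClopen_iff.1 this with h | h
    · exact G.isPathConnected.nonempty.ne_empty h
    · exact hG h
  obtain ⟨x, hx⟩ := hfr
  rw [G.frontier_eq] at hx
  obtain ⟨hx, q, rfl⟩ := hx
  have := ht (mem_univ q)
  simp only [mem_iUnion] at this ⊢
  obtain ⟨p, hp, hq⟩ := this
  exact ⟨p, hp, hq G hx⟩

/-- The two faces along the curve at a simple point share a segment, within the arc of the
point. -/
theorem exists_shareSegment {p : D.Param} (hp : ¬ D.IsDouble p) :
    ∃ (i : Fin D.μ) (s t : ℝ), ShareSegment (D.sides p).1 (D.sides p).2 i s t ∧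
      ∀ u ∈ Icc s t, ((i, (u : UnitAddCircle)) : D.Param) ∈ pathComponentIn D.underᶜ p := by
  have hev : ∀ᶠ h in 𝓝[>] (0 : ℝ), ¬ D.IsDouble (D.shift p h) ∧ D.sides (D.shift p h) = D.sides p := by
    have h1 := D.eventually_shift_not_isDouble p (σ := 1) (Or.inl rfl)
    simp only [one_mul] at h1
    exact h1.and (eventually_sides_eq_right p)
  obtain ⟨δ, hδ, hall⟩ := mem_nhdsGT_iff_exists_Ioo_subset.1 hev
  rw [mem_Ioi] at hδ
  have hall' : ∀ h ∈ Icc 0 (δ / 2), ¬ D.IsDouble (D.shift p h) ∧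
      D.sides (D.shift p h) = D.sides p := by
    intro h hh
    rcases hh.1.eq_or_lt with rfl | h0
    · rw [shift_zero]; exact ⟨hp, rfl⟩
    · exact hall ⟨h0, by linarith [hh.2]⟩
  obtain ⟨x, hx⟩ := QuotientAddGroup.mk_surjective p.2
  have hx' : ((x : ℝ) : UnitAddCircle) = p.2 := hx
  have hshift : ∀ u : ℝ, ((p.1, (u : UnitAddCircle)) : D.Param) = D.shift p (u - x) := by
    intro u; simp [shift, ← hx']
  refine ⟨p.1, x, x + δ / 2, ⟨sides_fst_ne_snd p, by linarith, ?_⟩, ?_⟩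
  · rintro _ ⟨u, hu, rfl⟩
    have e : D.γ p.1 u = D.point (D.shift p (u - x)) := by rw [← hshift]; rfl
    obtain ⟨h1, h2⟩ := hall' (u - x) ⟨by linarith [hu.1], by linarith [hu.2]⟩
    have h3 := (sides_of_not_isDouble h1).2.2
    rw [h2] at h3
    simp only
    rw [e, Face.frontier_eq, Face.frontier_eq]
    exact ⟨⟨(h3 _).2 (Or.inl rfl), mem_range_self _⟩, (h3 _).2 (Or.inr rfl), mem_range_self _⟩
  · intro u hu
    rw [hshift]
    have hpc : IsPathConnected (D.shift p '' Icc 0 (δ / 2)) :=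
      ((convex_Icc 0 (δ / 2)).isPathConnected (nonempty_Icc.2 (by linarith))).image
        (D.continuous_shift p)
    refine hpc.subset_pathComponentIn (F := D.underᶜ) ⟨0, ⟨le_rfl, by linarith⟩, D.shift_zero p⟩ ?_
      ⟨_, ⟨by linarith [hu.1], by linarith [hu.2]⟩, rfl⟩
    rintro _ ⟨h, hh, rfl⟩ hmem
    exact (hall' h hh).1 (D.under_double _ hmem)

/-- Two faces that share a segment are the faces on the two sides of the curve. -/
theorem ShareSegment.exists_sides {F F' : D.Face} {i : Fin D.μ} {s t : ℝ}
    (h : ShareSegment F F' i s t) : ∃ u ∈ Icc s t, ¬ D.IsDouble (i, (u : UnitAddCircle)) ∧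
      (D.sides (i, (u : UnitAddCircle)) = (F, F') ∨ D.sides (i, (u : UnitAddCircle)) = (F', F)) := by
  obtain ⟨hne, hst, hfr⟩ := h
  have h1 := D.eventually_shift_not_isDouble (i, (s : UnitAddCircle)) (σ := 1) (Or.inl rfl)
  obtain ⟨r, hr, hrs⟩ := (h1.and (Ioo_mem_nhdsGT (sub_pos.2 hst))).exists
  have e : D.shift (i, (s : UnitAddCircle)) (1 * r) = (i, ((s + r : ℝ) : UnitAddCircle)) := by
    simp [shift]
  rw [e] at hr
  have hu : s + r ∈ Icc s t := ⟨by linarith [hrs.1], by linarith [hrs.2]⟩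
  refine ⟨s + r, hu, hr, ?_⟩
  have hmem := hfr (mem_image_of_mem _ hu)
  have h3 := (sides_of_not_isDouble hr).2.2
  have hF := (h3 F).1 (frontier_subset_closure hmem.1)
  have hF' := (h3 F').1 (frontier_subset_closure hmem.2)
  rcases hF with hF | hF <;> rcases hF' with hF' | hF'
  · exact absurd (hF.trans hF'.symm) hne
  · exact Or.inl (Prod.ext hF.symm hF'.symm)
  · exact Or.inr (Prod.ext hF'.symm hF.symm)
  · exact absurd (hF.trans hF'.symm) hne

/-- The shading alternates across the curve. -/
theorem Shading.sides_iff (s : D.Shading) (p : D.Param) :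
    (D.sides p).1 ∈ s.shaded ↔ (D.sides p).2 ∉ s.shaded := by
  have h1 := D.eventually_shift_not_isDouble p (σ := 1) (Or.inl rfl)
  simp only [one_mul] at h1
  obtain ⟨h, hnd, hs⟩ := (h1.and (eventually_sides_eq_right p)).exists
  rw [← hs]
  obtain ⟨i, a, b, hab, -⟩ := exists_shareSegment hnd
  exact s.checkerboard _ _ i a b hab

/-- Consecutive corners are the two sides of one of the four branches at the crossing. -/
theorem Shading.corner_add_one (s : D.Shading) (c : D.Crossing) (k : Fin 4) :
    c.corner (k + 1) ∈ s.shaded ↔ c.corner k ∉ s.shaded := by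
  have hm := c.isLocalModel
  have h0 := s.sides_iff c.overParam
  rw [hm.sides_over] at h0
  obtain ⟨r, hr⟩ := hm.sides_over_left.exists
  have h1 := s.sides_iff (D.shift c.overParam (-r))
  rw [hr] at h1
  have h2 : (c.corner 0 ∈ s.shaded ↔ c.corner 1 ∉ s.shaded) ∧
      (c.corner 2 ∈ s.shaded ↔ c.corner 3 ∉ s.shaded) := by
    rcases hm.sides_under with ⟨a, b⟩ | ⟨a, b⟩
    · have h3 := s.sides_iff c.underParam
      rw [a] at h3
      obtain ⟨r, hr⟩ := b.exists
      have h4 := s.sides_iff (D.shift c.underParam (-r))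
      rw [hr] at h4
      simp only at h3 h4
      tauto
    · have h3 := s.sides_iff c.underParam
      rw [a] at h3
      obtain ⟨r, hr⟩ := b.exists
      have h4 := s.sides_iff (D.shift c.underParam (-r))
      rw [hr] at h4
      simp only at h3 h4
      tauto
  simp only at h0 h1
  have e : (3 : Fin 4) + 1 = 0 := rfl
  have e' : (2 : Fin 4) + 1 = 3 := rfl
  have e'' : (1 : Fin 4) + 1 = 2 := rfl
  fin_cases k <;> simp only [Fin.zero_eta, Fin.mk_one, Fin.reduceFinMk, zero_add, e, e', e''] <;> tauto

/-- Dehn colorings are characterized by one condition at every crossing. -/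
theorem mem_dehnColorings_iff {A : Type*} [AddCommGroup A] {d : D.Face → A} :
    d ∈ D.dehnColorings A ↔ ∀ c : D.Crossing,
      d (c.corner 0) + d (c.corner 3) = d (c.corner 1) + d (c.corner 2) := by
  constructor
  · intro hd c
    have hm := c.isLocalModel
    let p := c.overParam
    let a : D.Arc := ⟨pathComponentIn D.underᶜ p, p, hm.notMem_under, rfl⟩
    have hseg : ∀ q : D.Param, ¬ D.IsDouble q → q ∈ a.1 →
        ShareSegmentOn (D.sides q).1 (D.sides q).2 a := by
      intro q hq hqa
      obtain ⟨i, s, t, h1, h2⟩ := exists_shareSegment hq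
      refine ⟨i, s, t, h1, ?_⟩
      have : pathComponentIn D.underᶜ q = a.1 := pathComponentIn_congr hqa
      rwa [this] at h2
    -- The overpassing parameter is not removed, so the pieces just before and just after it belong
    -- to the same arc; comparing them gives the crossing condition.
    have hnd : ∀ σ : ℝ, σ = 1 ∨ σ = -1 → ∀ᶠ h in 𝓝[>] (0 : ℝ),
        ¬ D.IsDouble (D.shift p (σ * h)) ∧ D.shift p (σ * h) ∈ a.1 := by
      intro σ hσ
      obtain ⟨δ, hδ, hall⟩ := mem_nhdsGT_iff_exists_Ioo_subset.1 (D.eventually_shift_not_isDouble p hσ)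
      rw [mem_Ioi] at hδ
      filter_upwards [Ioo_mem_nhdsGT hδ] with h hh
      refine ⟨hall hh, ?_⟩
      have hpc : IsPathConnected ((fun x => D.shift p (σ * x)) '' Icc 0 h) :=
        ((convex_Icc 0 h).isPathConnected (nonempty_Icc.2 hh.1.le)).image
          ((D.continuous_shift p).comp (by fun_prop))
      refine hpc.subset_pathComponentIn (F := D.underᶜ) ⟨0, ⟨le_rfl, hh.1.le⟩, by simp⟩ ?_
        ⟨h, ⟨hh.1.le, le_rfl⟩, rfl⟩
      rintro _ ⟨x, hx, rfl⟩ hmem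
      rcases hx.1.eq_or_lt with rfl | h0
      · simp only [mul_zero, shift_zero] at hmem
        exact hm.notMem_under hmem
      · exact hall ⟨h0, hx.2.trans_lt hh.2⟩ (D.under_double _ hmem)
    obtain ⟨r, hr, hr'⟩ := ((hnd 1 (Or.inl rfl)).and (eventually_sides_eq_right p)).exists
    obtain ⟨t, ht, ht'⟩ := ((hnd (-1) (Or.inr rfl)).and hm.sides_over_left).exists
    rw [one_mul] at hr
    rw [neg_one_mul] at ht
    have h1 := hseg _ hr.1 hr.2
    have h2 := hseg _ ht.1 ht.2
    rw [hr', hm.sides_over] at h1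
    rw [ht'] at h2
    exact hd a _ _ _ _ h1 h2
  · intro hd a F F' E E' hF hE
    -- The sum of the values on both sides is locally constant away from underpasses: at simple
    -- points the sides do not change, at overpasses this is the crossing condition. An arc is
    -- connected.
    let S : D.Param → A := fun q => d (D.sides q).1 + d (D.sides q).2
    have hloc : ∀ p ∉ D.under, ∀ᶠ q in 𝓝 p, S q = S p := by
      intro p hp
      by_cases hpd : D.IsDouble p
      · obtain ⟨c, hc⟩ := hpd.exists_crossing
        have hm := c.isLocalModel
        have hpo : p = c.overParam := hc.resolve_right (by rintro rfl; exact hp hm.mem_under)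
        subst hpo
        refine eventually_nhds_of_shift rfl ?_ ?_
        · filter_upwards [eventually_sides_eq_right c.overParam] with h hh
          simp only [S, hh]
        · filter_upwards [hm.sides_over_left] with h hh
          simp only [S, hh, hm.sides_over]
          exact (hd c).symm
      · filter_upwards [(sides_of_not_isDouble hpd).1] with q hq
        simp only [S, hq]
    obtain ⟨p₀, hp₀, ha⟩ := a.2
    have hsub : a.1 ⊆ D.underᶜ := by rw [ha]; exact pathComponentIn_subset
    have hpre : IsPreconnected a.1 := by
      rw [ha]; exact (isPathConnected_pathComponentIn hp₀).isConnected.isPreconnected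
    have hconst : ∀ x ∈ a.1, ∀ y ∈ a.1, S x = S y := by
      intro x hx y hy
      exact hpre.induction₂ (fun x y => S x = S y)
        (fun x hx => ((hloc x (hsub hx)).filter_mono nhdsWithin_le_nhds).mono fun y hy => hy.symm)
        (fun x y z _ _ _ h1 h2 => h1.trans h2) (fun x y _ _ h => h.symm) hx hy
    have hval : ∀ F F' : D.Face, ShareSegmentOn F F' a → ∃ x ∈ a.1, d F + d F' = S x := by
      rintro F F' ⟨i, s, t, h1, h2⟩
      obtain ⟨u, hu, -, h⟩ := h1.exists_sides
      refine ⟨_, h2 u hu, ?_⟩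
      rcases h with h | h
      · simp only [S, h]
      · simp only [S, h, add_comm]
    obtain ⟨x, hx, ex⟩ := hval F F' hF
    obtain ⟨y, hy, ey⟩ := hval E E' hE
    rw [ex, ey]
    exact hconst x hx y hy

end LinkDiagram

/-! ### Summing jumps along closed curves -/

/-- A function on an interval that is locally constant up to finitely many jumps changes by the
sum of its jumps. -/
theorem sub_eq_sum_jumps {A : Type*} [AddCommGroup A] {G J : ℝ → A} {a b : ℝ} (hab : a ≤ b)
    {T : Finset ℝ} (hT : ∀ t ∈ T, t ∈ Ioc a b)
    (hr : ∀ t ∈ Icc a b, ∀ᶠ h in 𝓝[>] (0 : ℝ), G (t + h) = G t)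
    (hl : ∀ t ∈ Ioc a b, ∀ᶠ h in 𝓝[>] (0 : ℝ), G (t - h) = G t - J t)
    (hJ : ∀ t ∈ Ioc a b, t ∉ T → J t = 0) : G b - G a = ∑ t ∈ T, J t := by
  classical
  -- `S` accumulates the jumps up to and including `t`, matching the right continuity of `G`; the
  -- difference `K` has no jumps left and is constant.
  let S : ℝ → A := fun t => ∑ x ∈ T.filter (· ≤ t), J x
  let K : ℝ → A := fun t => G t - S t
  have hT' : ∀ t, ∀ᶠ h in 𝓝[>] (0 : ℝ), ∀ x ∈ T, x ≠ t → h < |x - t| := by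
    intro t
    rw [Filter.eventually_all_finset]
    intro x _
    by_cases hx : x = t
    · exact Eventually.of_forall fun h hne => absurd hx hne
    · have : 0 < |x - t| := abs_pos.2 (sub_ne_zero.2 hx)
      filter_upwards [Ioo_mem_nhdsGT this] with h hh _ using hh.2
  have hSr : ∀ t, ∀ᶠ h in 𝓝[>] (0 : ℝ), S (t + h) = S t := by
    intro t
    filter_upwards [hT' t, self_mem_nhdsWithin] with h hh hpos
    have hpos : 0 < h := hpos
    simp only [S]
    congr 1
    ext x
    simp only [Finset.mem_filter, and_congr_right_iff]
    intro hx
    constructor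
    · intro hle
      by_contra hcon
      have := hh x hx (by rintro rfl; exact hcon le_rfl)
      rw [abs_of_pos (by linarith)] at this
      linarith
    · intro hle; linarith
  have hSl : ∀ t ∈ Ioc a b, ∀ᶠ h in 𝓝[>] (0 : ℝ), S (t - h) = S t - J t := by
    intro t ht
    filter_upwards [hT' t, self_mem_nhdsWithin] with h hh hpos
    have hpos : 0 < h := hpos
    have e : T.filter (· ≤ t - h) = (T.filter (· ≤ t)).erase t := by
      ext x
      simp only [Finset.mem_filter, Finset.mem_erase]
      constructor
      · rintro ⟨hx, hle⟩
        exact ⟨by intro h0; linarith, hx, by linarith⟩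
      · rintro ⟨hne, hx, hle⟩
        refine ⟨hx, ?_⟩
        have := hh x hx hne
        rw [abs_of_nonpos (by linarith)] at this
        linarith
    simp only [S]
    rw [e]
    by_cases htT : t ∈ T
    · rw [← Finset.add_sum_erase (T.filter (· ≤ t)) J (a := t) (by simp [htT])]
      abel
    · rw [Finset.erase_eq_of_notMem (by simp [htT]), hJ t ht htT, sub_zero]
  have hK : K a = K b := by
    refine (isPreconnected_Icc (a := a) (b := b)).induction₂ (fun x y => K x = K y) ?_
      (fun x y z _ _ _ h1 h2 => h1.trans h2) (fun x y _ _ h => h.symm) (left_mem_Icc.2 hab)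
      (right_mem_Icc.2 hab)
    intro t ht
    obtain ⟨δ, hδ, hd⟩ := mem_nhdsGT_iff_exists_Ioo_subset.1 ((hr t ht).and (hSr t))
    rw [mem_Ioi] at hδ
    have hright : ∀ x ∈ Ioo t (t + δ), K t = K x := by
      intro x hx
      obtain ⟨h1, h2⟩ := hd (show x - t ∈ Ioo 0 δ from ⟨by linarith [hx.1], by linarith [hx.2]⟩)
      rw [add_sub_cancel] at h1 h2
      simp only [K, h1, h2]
    rcases ht.1.eq_or_lt with rfl | hat
    · filter_upwards [self_mem_nhdsWithin, mem_nhdsWithin_of_mem_nhds (Iio_mem_nhds (show a < a + δ by linarith))] with x hx hx2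
      rcases hx.1.eq_or_lt with rfl | h0
      · rfl
      · exact hright x ⟨h0, hx2⟩
    · obtain ⟨η, hη, he⟩ := mem_nhdsGT_iff_exists_Ioo_subset.1 ((hl t ⟨hat, ht.2⟩).and (hSl t ⟨hat, ht.2⟩))
      rw [mem_Ioi] at hη
      have hleft : ∀ x ∈ Ioo (t - η) t, K t = K x := by
        intro x hx
        obtain ⟨h1, h2⟩ := he (show t - x ∈ Ioo 0 η from ⟨by linarith [hx.2], by linarith [hx.1]⟩)
        rw [sub_sub_cancel] at h1 h2
        simp only [K, h1, h2]
        abel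
      filter_upwards [mem_nhdsWithin_of_mem_nhds (Ioo_mem_nhds (show t - η < t by linarith)
        (show t < t + δ by linarith))] with x hx
      rcases lt_trichotomy x t with h0 | rfl | h0
      · exact hleft x ⟨hx.1, h0⟩
      · rfl
      · exact hright x ⟨h0, hx.2⟩
  have e1 : T.filter (· ≤ a) = ∅ := by
    ext x
    simp only [Finset.mem_filter, Finset.notMem_empty, iff_false, not_and, not_le]
    exact fun hx => (hT x hx).1
  have e2 : T.filter (· ≤ b) = T := by
    ext x
    simp only [Finset.mem_filter, and_iff_left_iff_imp]
    exact fun hx => (hT x hx).2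
  simp only [K, S, e1, e2, Finset.sum_empty, sub_zero] at hK
  rw [hK]; abel

namespace LinkDiagram

variable {D : LinkDiagram}

/-- The jumps of any function of the two faces along the curves add up to zero. -/
theorem sum_jumps_eq_zero {A : Type*} [AddCommGroup A] (Ψ : D.Face × D.Face → A)
    (T : Finset D.Param) (hT : ∀ p, p ∈ T ↔ D.IsDouble p) :
    ∑ p ∈ T, (Ψ (D.sides p) - Ψ (sidesLeft p)) = 0 := by
  classical
  rw [← Finset.sum_fiberwise T (fun p => p.1)]
  refine Finset.sum_eq_zero fun i _ => ?_
  let p₀ : D.Param := (i, 0)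
  let G : ℝ → A := fun t => Ψ (D.sides (D.shift p₀ t))
  let J : ℝ → A := fun t => Ψ (D.sides (D.shift p₀ t)) - Ψ (sidesLeft (D.shift p₀ t))
  -- Representatives in the half-open interval (0, 1] count every double parameter once, including
  -- one at the base point of the circle.
  let g : D.Param → ℝ := fun p => AddCircle.equivIoc 1 0 p.2
  have hg : ∀ p : D.Param, p.1 = i → D.shift p₀ (g p) = p := by
    rintro ⟨j, x⟩ rfl
    simp only [shift, p₀, g, zero_add]
    congr 1
    exact AddCircle.coe_equivIoc
  have hg' : ∀ p, g p ∈ Ioc (0 : ℝ) 1 := by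
    intro p
    have := (AddCircle.equivIoc (1 : ℝ) 0 p.2).2
    exact ⟨this.1, this.2.trans_eq (zero_add 1)⟩
  have hginj : Set.InjOn g (T.filter fun p => p.1 = i) := by
    intro p hp q hq h
    rw [Finset.mem_coe, Finset.mem_filter] at hp hq
    rw [← hg p hp.2, ← hg q hq.2, h]
  have key := sub_eq_sum_jumps (G := G) (J := J) (a := 0) (b := 1) zero_le_one
    (T := (T.filter fun p => p.1 = i).image g) (by
      intro t ht
      obtain ⟨p, -, rfl⟩ := Finset.mem_image.1 ht
      exact hg' p)
    (by
      intro t _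
      filter_upwards [eventually_sides_eq_right (D.shift p₀ t)] with h hh
      simp only [G, ← shift_shift, hh])
    (by
      intro t _
      filter_upwards [eventually_sides_eq_left (D.shift p₀ t)] with h hh
      simp only [G, J, sub_eq_add_neg, ← shift_shift, hh]
      abel)
    (by
      intro t ht htT
      have hnd : ¬ D.IsDouble (D.shift p₀ t) := by
        intro hd
        apply htT
        rw [Finset.mem_image]
        refine ⟨D.shift p₀ t, Finset.mem_filter.2 ⟨(hT _).2 hd, rfl⟩, ?_⟩
        have h1 := hg (D.shift p₀ t) rfl
        have h2 := hg' (D.shift p₀ t)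
        exact D.shift_injOn p₀ (by rw [abs_lt]; constructor <;> linarith [ht.1, ht.2, h2.1, h2.2]) h1
      have : sidesLeft (D.shift p₀ t) = D.sides (D.shift p₀ t) :=
        sidesLeft_eq (sides_of_not_isDouble hnd).2.1
      simp only [J, this, sub_self])
  have hper : G 1 = G 0 := by
    simp only [G]
    rw [show (1 : ℝ) = 0 + 1 by ring, shift_add_one]
  rw [hper, sub_self, Finset.sum_image hginj] at key
  rw [key]
  refine Finset.sum_congr rfl fun p hp => ?_
  simp only [Finset.mem_filter] at hp
  simp only [J, hg p hp.2]

open Classical in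
/-- For any function `d` on the faces, the differences of its values at the two neighbours of the
corners that belong to a given face add up to zero. -/
theorem sum_corners_eq_zero [Fintype D.Crossing] {A : Type*} [AddCommGroup A] (F : D.Face)
    (d : D.Face → A) :
    ∑ c : D.Crossing, ∑ k : Fin 4,
      (if c.corner k = F then d (c.corner (k + 1)) - d (c.corner (k + 3)) else 0) = 0 := by
  -- `Ψ` is antisymmetric, so the direction of the underpassing strand does not matter. At a
  -- crossing, the jumps along the two strands add up to the corner differences.
  let Ψ : D.Face × D.Face → A := fun x =>
    (if x.2 = F then d x.1 else 0) - (if x.1 = F then d x.2 else 0)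
  have h := sum_jumps_eq_zero Ψ
    (Finset.univ.image Crossing.overParam ∪ Finset.univ.image Crossing.underParam) (by
      intro p
      simp only [Finset.mem_union, Finset.mem_image, Finset.mem_univ, true_and]
      constructor
      · rintro (⟨c, rfl⟩ | ⟨c, rfl⟩)
        exacts [c.isDouble_overParam, c.isDouble_underParam]
      · intro hp
        obtain ⟨c, rfl | rfl⟩ := hp.exists_crossing
        exacts [Or.inl ⟨c, rfl⟩, Or.inr ⟨c, rfl⟩])
  rw [Finset.sum_union (by
    rw [Finset.disjoint_left]
    intro p hp hp'
    obtain ⟨c, -, rfl⟩ := Finset.mem_image.1 hp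
    obtain ⟨c', -, h⟩ := Finset.mem_image.1 hp'
    exact c.overParam_ne_underParam c' h.symm),
    Finset.sum_image Crossing.overParam_injective.injOn,
    Finset.sum_image Crossing.underParam_injective.injOn, ← Finset.sum_add_distrib] at h
  refine Eq.trans (Finset.sum_congr rfl fun c _ => ?_) h
  have hm := c.isLocalModel
  rw [hm.sides_over, sidesLeft_eq hm.sides_over_left, Fin.sum_univ_four]
  have e1 : (1 : Fin 4) + 1 = 2 := rfl
  have e2 : (2 : Fin 4) + 1 = 3 := rfl
  have e3 : (3 : Fin 4) + 1 = 0 := rfl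
  have e4 : (1 : Fin 4) + 3 = 0 := rfl
  have e5 : (2 : Fin 4) + 3 = 1 := rfl
  have e6 : (3 : Fin 4) + 3 = 2 := rfl
  have ite_sub' : ∀ (P : Prop) [Decidable P] (x y : A),
      (if P then x - y else 0) = (if P then x else 0) - (if P then y else 0) := by
    intro P _ x y; split_ifs <;> simp
  rcases hm.sides_under with ⟨a, b⟩ | ⟨a, b⟩ <;>
  · rw [a, sidesLeft_eq b]
    simp only [Ψ, zero_add, e1, e2, e3, e4, e5, e6, ite_sub']
    abel

end LinkDiagram

/-! ### Planar duality through winding numbers -/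

theorem tendsto_sub_of_continuousAt {h : ℂ → ℂ} {z : ℂ} (hh : ContinuousAt h z) (a : ℂ) :
    Tendsto (fun r : ℝ => h (z + r • a) - h (z - r • a)) (𝓝[>] 0) (𝓝 0) := by
  have h1 : Tendsto (fun r : ℝ => z + r • a) (𝓝[>] 0) (𝓝 z) := by
    have : Continuous fun r : ℝ => z + r • a := by fun_prop
    simpa using (this.tendsto 0).mono_left nhdsWithin_le_nhds
  have h2 : Tendsto (fun r : ℝ => z - r • a) (𝓝[>] 0) (𝓝 z) := by
    have : Continuous fun r : ℝ => z - r • a := by fun_prop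
    simpa using (this.tendsto 0).mono_left nhdsWithin_le_nhds
  simpa using (hh.tendsto.comp h1).sub (hh.tendsto.comp h2)

namespace LinkDiagram

variable {D : LinkDiagram}

theorem Face.exists_path (F : D.Face) {x y : ℂ} (hx : x ∈ F.1) (hy : y ∈ F.1) :
    ∃ f : ℝ → ℂ, Continuous f ∧ f 0 = x ∧ f 1 = y ∧ ∀ t, f t ∈ F.1 := by
  have hj := F.isPathConnected.joinedIn x hx y hy
  refine ⟨hj.somePath.extend, hj.somePath.continuous_extend, hj.somePath.extend_zero,
    hj.somePath.extend_one, fun t => ?_⟩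
  have h : hj.somePath.extend t ∈ range hj.somePath.extend := mem_range_self t
  rw [Path.extend_range] at h
  obtain ⟨u, hu⟩ := h
  rw [← hu]
  exact hj.somePath_mem u

theorem Crossing.mem_support (c : D.Crossing) : c.1 ∈ D.support := by
  obtain ⟨p, -, -, hp, -⟩ := c.2
  exact ⟨p, hp⟩

theorem Face.ne_crossing {F : D.Face} {z : ℂ} (hz : z ∈ F.1) (c : D.Crossing) : z ≠ c.1 := by
  rintro rfl
  exact F.subset hz c.mem_support

/-- The logarithm of `(x - z) / (y - z)` along a path from `y` to `x` that crosses the diagram only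
at `c`, from one corner to the opposite one. -/
theorem Crossing.exists_log (c : D.Crossing) (k : Fin 4) (b : D.Face → ℂ) (hb : ∀ F, b F ∈ F.1) :
    ∃ δ : ℂ → ℂ,
      (∀ F : D.Face, F ≠ c.corner k → F ≠ c.corner (k + 2) → ∀ z ∈ F.1, ContinuousAt δ z ∧
        Complex.exp (δ z) = (b (c.corner k) - z) / (b (c.corner (k + 2)) - z)) ∧
      (∀ c' : D.Crossing, c' ≠ c → ContinuousAt δ c'.1) ∧
      Tendsto (fun r : ℝ => δ (c.1 + r • (Complex.I * (Complex.I ^ (k : ℕ) * c.dir))) -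
        δ (c.1 - r • (Complex.I * (Complex.I ^ (k : ℕ) * c.dir)))) (𝓝[>] 0)
        (𝓝 (2 * Real.pi * Complex.I)) := by
  have hm := c.isLocalModel
  set a : ℂ := Complex.I ^ (k : ℕ) * c.dir with ha
  have ha0 : a ≠ 0 := mul_ne_zero (pow_ne_zero _ Complex.I_ne_zero) hm.e_ne
  have h2 : Complex.I ^ ((k + 2 : Fin 4) : ℕ) * c.dir = -a := by
    rw [ha]
    fin_cases k <;> simp [pow_succ]
  have hpos := hm.mem k
  have hneg := hm.mem (k + 2)
  rw [h2] at hneg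
  obtain ⟨ρ, hρ, hsub⟩ := mem_nhdsGT_iff_exists_Ioo_subset.1 (hpos.and hneg)
  rw [mem_Ioi] at hρ
  obtain ⟨r₀, hr₀, hr₀ρ⟩ := exists_between hρ
  let l : ℝ → ℂ := fun t => c.1 + t • a
  have hl : Continuous l := by fun_prop
  have hl0 : l 0 = c.1 := by simp [l]
  have hlpos : ∀ t ∈ Ioc 0 r₀, l t ∈ (c.corner k).1 := fun t ht =>
    (hsub ⟨ht.1, ht.2.trans_lt hr₀ρ⟩).1
  have hlneg : ∀ t ∈ Ico (-r₀) 0, l t ∈ (c.corner (k + 2)).1 := by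
    intro t ht
    have := (hsub (show -t ∈ Ioo 0 ρ from ⟨by linarith [ht.2], by linarith [ht.1]⟩)).2
    simpa [l] using this
  -- The path goes from one base point to the crossing region inside its shaded corner, straight
  -- through `c` along `l`, and on inside the opposite corner to the other base point.
  obtain ⟨f, hf, hf0, hf1, hfm⟩ := (c.corner (k + 2)).exists_path (hb _)
    (hlneg (-r₀) ⟨le_rfl, by linarith⟩)
  obtain ⟨g, hg, hg0, hg1, hgm⟩ := (c.corner k).exists_path
    (hlpos r₀ ⟨hr₀, le_rfl⟩) (hb _)
  have hlz : ∀ z : ℂ, z ≠ c.1 → z ∉ (c.corner k).1 → z ∉ (c.corner (k + 2)).1 →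
      ∀ t ∈ Icc (0 - r₀) (0 + r₀), l t ≠ z := by
    intro z hzc hz1 hz2 t ht h
    rw [zero_sub, zero_add] at ht
    rcases lt_trichotomy t 0 with h0 | rfl | h0
    · exact hz2 (h ▸ hlneg t ⟨ht.1, h0⟩)
    · exact hzc (by rw [← h, hl0])
    · exact hz1 (h ▸ hlpos t ⟨h0, ht.2⟩)
  have hnot : ∀ (c' : D.Crossing) (F : D.Face), c'.1 ∉ F.1 := fun c' F h =>
    Face.ne_crossing h c' rfl
  have h01 : (0 : ℝ) ≤ 1 := zero_le_one
  have hrr : 0 - r₀ ≤ 0 + r₀ := by linarith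
  -- Only the straight middle piece passes through `c`; it alone produces the jump there.
  refine ⟨fun z => logVar f 0 1 z + logVar l (0 - r₀) (0 + r₀) z + logVar g 0 1 z, ?_, ?_, ?_⟩
  · intro F hF1 hF2 z hz
    have hz1 : z ∉ (c.corner k).1 := fun h => hF1 (F.eq_of_mem hz h)
    have hz2 : z ∉ (c.corner (k + 2)).1 := fun h => hF2 (F.eq_of_mem hz h)
    have nf : ∀ t, f t ≠ z := fun t h => hz2 (h ▸ hfm t)
    have ng : ∀ t, g t ≠ z := fun t h => hz1 (h ▸ hgm t)
    have nl := hlz z (Face.ne_crossing hz c) hz1 hz2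
    refine ⟨((continuousAt_logVar h01 hf.continuousOn fun t _ => nf t).add
      (continuousAt_logVar hrr hl.continuousOn nl)).add
      (continuousAt_logVar h01 hg.continuousOn fun t _ => ng t), ?_⟩
    rw [Complex.exp_add, Complex.exp_add, exp_logVar h01 hf.continuousOn fun t _ => nf t,
      exp_logVar hrr hl.continuousOn nl, exp_logVar h01 hg.continuousOn fun t _ => ng t,
      hf0, hf1, hg0, hg1, zero_sub, zero_add]
    have n1 : l (-r₀) - z ≠ 0 := sub_ne_zero.2 (hf1 ▸ nf 1)
    have n2 : l r₀ - z ≠ 0 := sub_ne_zero.2 (hg0 ▸ ng 0)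
    have n3 : b (c.corner (k + 2)) - z ≠ 0 := sub_ne_zero.2 (hf0 ▸ nf 0)
    field_simp
  · intro c' hc'
    have hne : c'.1 ≠ c.1 := fun h => hc' (Subtype.ext h)
    exact ((continuousAt_logVar h01 hf.continuousOn fun t _ h => hnot c' _ (h ▸ hfm t)).add
      (continuousAt_logVar hrr hl.continuousOn (hlz _ hne (hnot c' _) (hnot c' _)))).add
      (continuousAt_logVar h01 hg.continuousOn fun t _ h => hnot c' _ (h ▸ hgm t))
  · have hjump := tendsto_logVar_sub_logVar hr₀ ha0 hl.continuousOn (t₀ := 0) (fun t _ => by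
      have : l t - l 0 - ((t : ℂ) - (0 : ℝ)) * a = 0 := by simp [l]
      rw [this, norm_zero]
      positivity)
    rw [hl0] at hjump
    have hc0 : ∀ h : ℂ → ℂ, ContinuousAt h c.1 → Tendsto (fun r : ℝ =>
        h (c.1 + r • (Complex.I * a)) - h (c.1 - r • (Complex.I * a))) (𝓝[>] 0) (𝓝 0) :=
      fun h hh => tendsto_sub_of_continuousAt hh _
    have := ((hc0 _ (continuousAt_logVar h01 hf.continuousOn fun t _ h => hnot c _ (h ▸ hfm t))).add
      hjump).add
      (hc0 _ (continuousAt_logVar h01 hg.continuousOn fun t _ h => hnot c _ (h ▸ hgm t)))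
    rw [add_zero, zero_add (2 * (Real.pi : ℂ) * Complex.I)] at this
    refine this.congr fun r => ?_
    ring

theorem Shading.corner_add_two (s : D.Shading) (c : D.Crossing) (k : Fin 4) :
    c.corner (k + 2) ∈ s.shaded ↔ c.corner k ∈ s.shaded := by
  rw [show k + 2 = k + 1 + 1 by rw [add_assoc]; rfl, s.corner_add_one, s.corner_add_one, not_not]

theorem Shading.corner_add_three (s : D.Shading) (c : D.Crossing) (k : Fin 4) :
    c.corner (k + 3) ∈ s.shaded ↔ c.corner k ∉ s.shaded := by
  rw [show k + 3 = k + 2 + 1 by rw [add_assoc]; rfl, s.corner_add_one, s.corner_add_two]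

open Classical in
/-- The shaded graph is the planar dual of the graph on the unshaded faces: a cycle `n` is the
coboundary of an integer function `N`. -/
theorem Shading.exists_potential [Fintype D.Crossing] [Fintype D.Face] (s : D.Shading)
    (κ : D.Crossing → Fin 4) (hκ : ∀ c : D.Crossing, c.corner (κ c) ∈ s.shaded) (n : D.Crossing → ℤ)
    (hn : ∀ S ∈ s.shaded, ∑ c, n c * ((if c.corner (κ c) = S then 1 else 0) -
      (if c.corner (κ c + 2) = S then 1 else 0)) = 0) :
    ∃ N : D.Face → ℤ, ∀ c : D.Crossing, N (c.corner (κ c + 1)) - N (c.corner (κ c + 3)) = n c := by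
  have hκ1 : ∀ c : D.Crossing, c.corner (κ c + 1) ∉ s.shaded := fun c h =>
    (s.corner_add_one c _).1 h (hκ c)
  have hκ2 : ∀ c : D.Crossing, c.corner (κ c + 2) ∈ s.shaded := fun c =>
    (s.corner_add_two c _).2 (hκ c)
  have hκ3 : ∀ c : D.Crossing, c.corner (κ c + 3) ∉ s.shaded := fun c h =>
    (s.corner_add_three c _).1 h (hκ c)
  have hbase : ∀ F : D.Face, ∃ x, x ∈ F.1 := fun F => F.isPathConnected.nonempty
  choose b hb using hbase
  choose δ hδ hδc hδj using fun c : D.Crossing => c.exists_log (κ c) b hb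
  -- This is 2πi times the winding number of the cycle `n` about `z`, each edge being realized by
  -- its path through the crossing.
  let W : ℂ → ℂ := fun z => ∑ c, n c * δ c z
  have hcont : ∀ F ∉ s.shaded, ∀ z ∈ F.1, ContinuousAt W z := by
    intro F hF z hz
    refine tendsto_finsetSum _ fun c _ => ?_
    exact (hδ c F (fun h => hF (h ▸ hκ c)) (fun h => hF (h ▸ hκ2 c)) z hz).1.const_mul _
  have hexp : ∀ F ∉ s.shaded, ∀ z ∈ F.1, Complex.exp (W z) = 1 := by
    intro F hF z hz
    have hlog : ∀ S : D.Face, ∃ x : ℂ, S ∈ s.shaded → Complex.exp x = b S - z := by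
      intro S
      by_cases hS : S ∈ s.shaded
      · have : b S - z ≠ 0 := by
          intro h
          rw [sub_eq_zero] at h
          exact hF (by rwa [Face.eq_of_mem hz (show z ∈ S.1 from h ▸ hb S)])
        exact ⟨Complex.log (b S - z), fun _ => Complex.exp_log this⟩
      · exact ⟨0, fun h => absurd h hS⟩
    choose X hX using hlog
    have h1 : Complex.exp (W z) =
        Complex.exp (∑ c, n c * (X (c.corner (κ c)) - X (c.corner (κ c + 2)))) := by
      simp only [W, Complex.exp_sum]
      refine Finset.prod_congr rfl fun c _ => ?_
      rw [Complex.exp_int_mul, Complex.exp_int_mul, Complex.exp_sub, hX _ (hκ c), hX _ (hκ2 c),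
        (hδ c F (fun h => hF (h ▸ hκ c)) (fun h => hF (h ▸ hκ2 c)) z hz).2]
    -- Regrouped by faces, the coefficient at each shaded face is the boundary of `n` there, which
    -- vanishes; so the end points of the paths cancel.
    have h2 : ∑ c, (n c : ℂ) * (X (c.corner (κ c)) - X (c.corner (κ c + 2))) =
        ∑ S, ((∑ c, n c * ((if c.corner (κ c) = S then 1 else 0) -
          (if c.corner (κ c + 2) = S then 1 else 0)) : ℤ) : ℂ) * X S := by
      push_cast
      simp_rw [Finset.sum_mul]
      rw [Finset.sum_comm]
      refine Finset.sum_congr rfl fun c _ => ?_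
      simp_rw [mul_assoc, ← Finset.mul_sum, sub_mul, Finset.sum_sub_distrib, ite_mul, one_mul,
        zero_mul, Finset.sum_ite_eq, Finset.mem_univ, if_true]
    rw [h1, h2, Finset.sum_eq_zero, Complex.exp_zero]
    intro S _
    by_cases hS : S ∈ s.shaded
    · rw [hn S hS, Int.cast_zero, zero_mul]
    · rw [Finset.sum_eq_zero, Int.cast_zero, zero_mul]
      intro c _
      have n1 : c.corner (κ c) ≠ S := fun h => hS (h ▸ hκ c)
      have n2 : c.corner (κ c + 2) ≠ S := fun h => hS (h ▸ hκ2 c)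
      rw [if_neg n1, if_neg n2, sub_zero, mul_zero]
  have hint : ∀ F : D.Face, ∃ N : ℤ, F ∉ s.shaded → ∀ z ∈ F.1, W z = N * (2 * Real.pi * Complex.I) := by
    intro F
    by_cases hF : F ∈ s.shaded
    · exact ⟨0, fun h => absurd hF h⟩
    · obtain ⟨N, hN⟩ := Complex.exp_eq_one_iff.1 (hexp F hF _ (hb F))
      refine ⟨N, fun _ z hz => ?_⟩
      rw [← hN]
      exact F.isPathConnected.isConnected.isPreconnected.eq_of_exp_eq_one
        (fun y hy => (hcont F hF y hy).continuousWithinAt) (hexp F hF) hz (hb F)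
  choose N hN using hint
  refine ⟨N, fun c => ?_⟩
  set a : ℂ := Complex.I * (Complex.I ^ (κ c : ℕ) * c.dir) with ha
  have e1 : Complex.I ^ ((κ c + 1 : Fin 4) : ℕ) * c.dir = a := by
    rw [ha]
    generalize κ c = k
    fin_cases k <;> simp [pow_succ, ← mul_assoc]
  have e3 : Complex.I ^ ((κ c + 3 : Fin 4) : ℕ) * c.dir = -a := by
    rw [ha]
    generalize κ c = k
    fin_cases k <;> simp [pow_succ, ← mul_assoc]
  have m1 := c.isLocalModel.mem (κ c + 1)
  have m3 := c.isLocalModel.mem (κ c + 3)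
  rw [e1] at m1
  rw [e3] at m3
  -- Of all the paths, only the one through `c` jumps at `c`. The direction `a` points to its left,
  -- into the corner `κ c + 1`, and `-a` into the opposite one.
  have hlim : Tendsto (fun r : ℝ => W (c.1 + r • a) - W (c.1 - r • a)) (𝓝[>] 0)
      (𝓝 (n c * (2 * Real.pi * Complex.I))) := by
    have : ∀ c', Tendsto (fun r : ℝ => n c' * (δ c' (c.1 + r • a) - δ c' (c.1 - r • a))) (𝓝[>] 0)
        (𝓝 (if c' = c then n c * (2 * Real.pi * Complex.I) else 0)) := by
      intro c'
      split_ifs with h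
      · rw [h]
        exact (hδj c).const_mul _
      · simpa using (tendsto_sub_of_continuousAt (hδc c' c (Ne.symm h)) a).const_mul (n c' : ℂ)
    have hsum := tendsto_finsetSum Finset.univ fun c' _ => this c'
    rw [Finset.sum_ite_eq' Finset.univ c, if_pos (Finset.mem_univ _)] at hsum
    refine hsum.congr fun r => ?_
    simp only [W, mul_sub, Finset.sum_sub_distrib]
  have hconst : Tendsto (fun r : ℝ => W (c.1 + r • a) - W (c.1 - r • a)) (𝓝[>] 0)
      (𝓝 (N (c.corner (κ c + 1)) * (2 * Real.pi * Complex.I) -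
        N (c.corner (κ c + 3)) * (2 * Real.pi * Complex.I))) := by
    refine tendsto_const_nhds.congr' ?_
    filter_upwards [m1, m3] with r h1 h3
    rw [smul_neg, ← sub_eq_add_neg] at h3
    rw [hN _ (hκ1 c) _ h1, hN _ (hκ3 c) _ h3]
  have huniq := tendsto_nhds_unique hconst hlim
  rw [← sub_mul] at huniq
  exact_mod_cast mul_right_cancel₀ Complex.two_pi_I_ne_zero huniq

/-! ### The Goeritz matrix and the crossing equations -/

namespace Shading

variable (s : D.Shading)

open Classical in
/-- The number of a shaded corner at a crossing. -/
noncomputable def shadedIndex (c : D.Crossing) : Fin 4 := if c.corner 0 ∈ s.shaded then 0 else 1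

theorem corner_shadedIndex_mem (c : D.Crossing) : c.corner (s.shadedIndex c) ∈ s.shaded := by
  unfold shadedIndex
  split_ifs with h
  · exact h
  · exact (s.corner_add_one c 0).2 h

/-- The first shaded corner at a crossing. In counterclockwise order, the corners are
`shadedFst`, `unshadedFst`, `shadedSnd`, `unshadedSnd`. -/
noncomputable def shadedFst (c : D.Crossing) : s.Shaded :=
  ⟨c.corner (s.shadedIndex c), s.corner_shadedIndex_mem c⟩

/-- The first unshaded corner at a crossing. -/
noncomputable def unshadedFst (c : D.Crossing) : s.Unshaded :=
  ⟨c.corner (s.shadedIndex c + 1), fun h => (s.corner_add_one c _).1 h (s.corner_shadedIndex_mem c)⟩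

/-- The second shaded corner at a crossing. -/
noncomputable def shadedSnd (c : D.Crossing) : s.Shaded :=
  ⟨c.corner (s.shadedIndex c + 2), (s.corner_add_two c _).2 (s.corner_shadedIndex_mem c)⟩

/-- The second unshaded corner at a crossing. -/
noncomputable def unshadedSnd (c : D.Crossing) : s.Unshaded :=
  ⟨c.corner (s.shadedIndex c + 3),
    fun h => (s.corner_add_three c _).1 h (s.corner_shadedIndex_mem c)⟩

theorem incident_iff (c : D.Crossing) (F : D.Face) : c.Incident F ↔
    ((s.shadedFst c).1 = F ∨ (s.shadedSnd c).1 = F) ∨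
      (s.unshadedFst c).1 = F ∨ (s.unshadedSnd c).1 = F := by
  rw [c.isLocalModel.incident_iff, Fin.exists_fin_succ, Fin.exists_fin_succ, Fin.exists_fin_two]
  change c.corner 0 = F ∨ c.corner 1 = F ∨ c.corner 2 = F ∨ c.corner 3 = F ↔ _
  simp only [shadedFst, shadedSnd, unshadedFst, unshadedSnd]
  unfold shadedIndex
  have e1 : (1 : Fin 4) + 1 = 2 := rfl
  have e2 : (1 : Fin 4) + 2 = 3 := rfl
  have e3 : (1 : Fin 4) + 3 = 0 := rfl
  split_ifs <;> simp only [zero_add, e1, e2, e3] <;> tauto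

theorem incident_unshaded_iff (c : D.Crossing) (F : s.Unshaded) : c.Incident F.1 ↔
    s.unshadedFst c = F ∨ s.unshadedSnd c = F := by
  rw [s.incident_iff, Subtype.ext_iff, Subtype.ext_iff, or_iff_right]
  rintro (h | h)
  · exact F.2 (h ▸ (s.shadedFst c).2)
  · exact F.2 (h ▸ (s.shadedSnd c).2)

theorem incident_shaded_iff (c : D.Crossing) (F : s.Shaded) : c.Incident F.1 ↔
    s.shadedFst c = F ∨ s.shadedSnd c = F := by
  rw [s.incident_iff, Subtype.ext_iff, Subtype.ext_iff, or_iff_left]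
  rintro (h | h)
  · exact (s.unshadedFst c).2 (h ▸ F.2)
  · exact (s.unshadedSnd c).2 (h ▸ F.2)

/-- The diagonal in the definition of the index points into corner 3, which is unshaded exactly when
corner 0 is shaded. -/
theorem goeritzIndex_eq (c : D.Crossing) :
    s.goeritzIndex c = if s.shadedIndex c = 0 then 1 else -1 := by
  have h : s.OverOnRight c ↔ s.shadedIndex c = 0 := by
    rw [c.isLocalModel.overOnRight_iff, show (3 : Fin 4) = 0 + 3 from rfl, s.corner_add_three,
      not_not, shadedIndex]
    split_ifs with h <;> simp [h]
  unfold goeritzIndex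
  simp only [h]

variable {A : Type*} [AddCommGroup A]

/-- Sorting the crossing condition by shading, with the shaded corners either 0 and 2 or 1 and 3,
changes only a sign, and this sign is the Goeritz index. The unshaded values thus prescribe a
1-cochain on the shaded graph. -/
theorem mem_dehnColorings_iff {d : D.Face → A} : d ∈ D.dehnColorings A ↔ ∀ c,
    d (s.shadedFst c).1 - d (s.shadedSnd c).1 =
      s.goeritzIndex c • (d (s.unshadedFst c).1 - d (s.unshadedSnd c).1) := by
  rw [LinkDiagram.mem_dehnColorings_iff]
  refine forall_congr' fun c => ?_
  rw [goeritzIndex_eq]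
  simp only [shadedFst, shadedSnd, unshadedFst, unshadedSnd]
  unfold shadedIndex
  have e1 : (1 : Fin 4) + 1 = 2 := rfl
  have e2 : (1 : Fin 4) + 2 = 3 := rfl
  have e3 : (1 : Fin 4) + 3 = 0 := rfl
  split_ifs with h1 h2 h2
  · simp only [zero_add, one_smul, sub_eq_sub_iff_add_eq_add]
  · exact absurd rfl h2
  · exact absurd h2 (by decide)
  · simp only [e1, e2, e3, neg_smul, one_smul, neg_sub, sub_eq_sub_iff_add_eq_add]
    rw [eq_comm]

open Classical in
/-- Around an unshaded face, the differences of the values of a function at the shaded corners of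
the crossings add up to zero. -/
theorem sum_shaded_eq_zero [Fintype D.Crossing] (F : s.Unshaded) (d : D.Face → A) :
    ∑ c, ((if s.unshadedFst c = F then 1 else 0 : ℤ) - (if s.unshadedSnd c = F then 1 else 0)) •
      (d (s.shadedFst c).1 - d (s.shadedSnd c).1) = 0 := by
  rw [← neg_eq_zero, ← Finset.sum_neg_distrib]
  refine Eq.trans (Finset.sum_congr rfl fun c _ => ?_) (sum_corners_eq_zero F.1 d)
  -- Of the four corner terms, the two shaded corners cannot be `F`; the other two have as
  -- neighbours the two shaded corners, in opposite orders.
  have n1 : c.corner (s.shadedIndex c) ≠ F.1 := fun h => F.2 (h ▸ s.corner_shadedIndex_mem c)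
  have n2 : c.corner (s.shadedIndex c + 2) ≠ F.1 := fun h => F.2 (h ▸ (s.shadedSnd c).2)
  have hsum : ∀ (k : Fin 4) (f : Fin 4 → A), ∑ j, f j = f k + f (k + 1) + f (k + 2) + f (k + 3) := by
    intro k f
    rw [← Equiv.sum_comp (Equiv.addLeft k), Fin.sum_univ_four]
    simp only [Equiv.coe_addLeft, add_zero]
  rw [hsum (s.shadedIndex c), if_neg n1, if_neg n2]
  simp only [Subtype.ext_iff, shadedFst, shadedSnd, unshadedFst, unshadedSnd, add_assoc]
  have e1 : (1 : Fin 4) + 1 = 2 := rfl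
  have e2 : (1 : Fin 4) + 3 = 0 := rfl
  have e3 : (3 : Fin 4) + 1 = 0 := rfl
  have e4 : (3 : Fin 4) + 3 = 2 := rfl
  rw [e1, e2, e3, e4, add_zero, sub_smul, ite_smul, ite_smul, one_smul, zero_smul]
  split_ifs <;> abel

open Classical in
/-- The entries of the Goeritz matrix off the diagonal. -/
theorem goeritzOffDiag_eq [Fintype D.Crossing] {F F' : s.Unshaded} (h : F ≠ F') :
    s.goeritzOffDiag F F' = -∑ c, s.goeritzIndex c *
      ((if s.unshadedFst c = F then 1 else 0) * (if s.unshadedSnd c = F' then 1 else 0) +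
        (if s.unshadedSnd c = F then 1 else 0) * (if s.unshadedFst c = F' then 1 else 0)) := by
  unfold goeritzOffDiag
  rw [finsum_eq_sum_of_fintype]
  congr 1
  refine Finset.sum_congr rfl fun c _ => ?_
  rw [finsum_eq_if, incident_unshaded_iff, incident_unshaded_iff]
  -- As `F ≠ F'`, at most one of the two products is nonzero, and a crossing with the same face at
  -- both unshaded corners contributes nothing.
  by_cases h1 : s.unshadedFst c = F
  · have h2 : s.unshadedFst c ≠ F' := fun h' => h (h1.symm.trans h')
    simp [h1, h]
  · by_cases h2 : s.unshadedSnd c = F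
    · simp [h1, h2, h]
    · simp [h1, h2]

-- The rows of the matrix add up to zero, so it is a weighted Laplacian: its value at `F` is the sum
-- of the off-diagonal entries times x(E) − x(F). Regrouping by crossings gives the sum of the
-- prescribed cochain around `F`; a crossing that meets `F` twice cancels.
open Classical in
theorem mem_kerGoeritz_iff [Fintype D.Crossing] [Finite D.Face] {x : s.Unshaded → A} :
    x ∈ s.kerGoeritz A ↔ ∀ F, ∑ c, ((if s.unshadedFst c = F then 1 else 0 : ℤ) -
      (if s.unshadedSnd c = F then 1 else 0)) •
        s.goeritzIndex c • (x (s.unshadedFst c) - x (s.unshadedSnd c)) = 0 := by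
  cases nonempty_fintype D.Face
  refine forall_congr' fun F => ?_
  suffices h : ∑ᶠ F' : s.Unshaded, s.goeritz F F' • x F' =
      ∑ c, ((if s.unshadedFst c = F then 1 else 0 : ℤ) -
      (if s.unshadedSnd c = F then 1 else 0)) •
        s.goeritzIndex c • (x (s.unshadedFst c) - x (s.unshadedSnd c)) by rw [h]
  have hdiag : s.goeritz F F = -∑ E ∈ Finset.univ.erase F, s.goeritzOffDiag F E := by
    unfold goeritz
    rw [if_pos rfl, finsum_eq_sum_of_fintype]
    simp_rw [finsum_eq_if]
    rw [← Finset.sum_filter]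
    congr 2
    ext E
    simp
  rw [finsum_eq_sum_of_fintype, ← Finset.add_sum_erase _ _ (Finset.mem_univ F), hdiag, neg_smul,
    Finset.sum_smul, neg_add_eq_sub, ← Finset.sum_sub_distrib]
  let t : D.Crossing → s.Unshaded → ℤ := fun c F' => s.goeritzIndex c *
      ((if s.unshadedFst c = F then 1 else 0) * (if s.unshadedSnd c = F' then 1 else 0) +
        (if s.unshadedSnd c = F then 1 else 0) * (if s.unshadedFst c = F' then 1 else 0))
  have h1 : ∀ E ∈ Finset.univ.erase F, s.goeritz F E • x E - s.goeritzOffDiag F E • x F =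
      ∑ c, t c E • (x F - x E) := by
    intro E hE
    have hne : F ≠ E := (Finset.ne_of_mem_erase hE).symm
    unfold goeritz
    rw [if_neg hne, ← smul_sub, s.goeritzOffDiag_eq hne, neg_smul, ← smul_neg, neg_sub,
      Finset.sum_smul]
  rw [Finset.sum_congr rfl h1, Finset.sum_erase _ (by simp), Finset.sum_comm]
  refine Finset.sum_congr rfl fun c _ => ?_
  simp only [t, mul_smul, add_smul, ← Finset.smul_sum, Finset.sum_add_distrib, ite_smul, one_smul,
    zero_smul, sub_smul]
  rw [← smul_ite_zero, ← smul_ite_zero, ← smul_sub]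
  congr 1
  by_cases h1 : s.unshadedFst c = F <;> by_cases h2 : s.unshadedSnd c = F <;> simp [h1, h2]

open Classical in
/-- In the shaded graph, two faces in the same component are the end points of a 1-chain. -/
theorem exists_chain [Fintype D.Crossing] {S T : s.Shaded} (h : s.shadedGraph.Reachable S T) :
    ∃ n : D.Crossing → ℤ, ∀ R : s.Shaded,
      ∑ c, n c * ((if s.shadedFst c = R then 1 else 0) - (if s.shadedSnd c = R then 1 else 0)) =
        (if T = R then 1 else 0) - (if S = R then 1 else 0) := by
  obtain ⟨w⟩ := h
  induction w with
  | nil => exact ⟨0, fun R => by simp⟩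
  | cons hadj _ ih =>
    obtain ⟨n, hn⟩ := ih
    obtain ⟨hne, c, hc1, hc2⟩ := hadj
    rw [incident_shaded_iff] at hc1 hc2
    have key : ∀ (k : ℤ) (R : s.Shaded), ∑ c', (n c' + if c' = c then k else 0) *
        ((if s.shadedFst c' = R then 1 else 0) - (if s.shadedSnd c' = R then 1 else 0)) =
        (∑ c', n c' * ((if s.shadedFst c' = R then 1 else 0) -
          (if s.shadedSnd c' = R then 1 else 0))) +
        k * ((if s.shadedFst c = R then 1 else 0) - (if s.shadedSnd c = R then 1 else 0)) := by
      intro k R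
      simp only [add_mul, Finset.sum_add_distrib, ite_mul, zero_mul, Finset.sum_ite_eq',
        Finset.mem_univ, if_true]
    -- The first edge of the walk is added with the sign that makes its boundary run from the old
    -- starting face to the next one.
    rcases hc1 with h1 | h1 <;> rcases hc2 with h2 | h2
    · exact absurd (h1.symm.trans h2) hne
    · refine ⟨_, fun R => (key (-1) R).trans ?_⟩
      rw [hn, h1, h2]; ring
    · refine ⟨_, fun R => (key 1 R).trans ?_⟩
      rw [hn, h1, h2]; ring
    · exact absurd (h1.symm.trans h2) hne

theorem connectedComponentMk_shadedFst (c : D.Crossing) :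
    s.shadedGraph.connectedComponentMk (s.shadedFst c) =
      s.shadedGraph.connectedComponentMk (s.shadedSnd c) := by
  by_cases h : s.shadedFst c = s.shadedSnd c
  · rw [h]
  · refine SimpleGraph.ConnectedComponent.sound (SimpleGraph.Adj.reachable ⟨h, c, ?_, ?_⟩)
    · exact (s.incident_shaded_iff c _).2 (Or.inl rfl)
    · exact (s.incident_shaded_iff c _).2 (Or.inr rfl)

/-! ### Extending kernel elements to colorings, and the kernel of the restriction -/

open Classical in
/-- The unshaded faces pair trivially with the cycles of the shaded graph. -/
theorem sum_smul_eq_zero_of_cycle [Fintype D.Crossing] {w : D.Crossing → A}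
    (hw : ∀ F : s.Unshaded, ∑ c, ((if s.unshadedFst c = F then 1 else 0 : ℤ) -
      (if s.unshadedSnd c = F then 1 else 0)) • w c = 0) {n : D.Crossing → ℤ}
    (hn : ∀ R : s.Shaded, ∑ c, n c * ((if s.shadedFst c = R then 1 else 0) -
      (if s.shadedSnd c = R then 1 else 0)) = 0) : ∑ c, n c • w c = 0 := by
  cases nonempty_fintype D.Face
  -- By duality the cycle is the coboundary of `N`, so its pairing with `w` is the combination, with
  -- weights `N`, of the sums around unshaded faces, all of which vanish.
  obtain ⟨N, hN⟩ := s.exists_potential s.shadedIndex s.corner_shadedIndex_mem n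
    (fun S hS => by simpa only [Subtype.ext_iff, shadedFst, shadedSnd] using hn ⟨S, hS⟩)
  have h : ∀ c, n c • w c = ∑ F : s.Unshaded, N F.1 •
      ((if s.unshadedFst c = F then 1 else 0 : ℤ) -
        (if s.unshadedSnd c = F then 1 else 0)) • w c := by
    intro c
    have e : n c = N (s.unshadedFst c).1 - N (s.unshadedSnd c).1 := (hN c).symm
    rw [e]
    simp only [sub_smul, smul_sub, ite_smul, one_smul, zero_smul, smul_ite, smul_zero,
      Finset.sum_sub_distrib, Finset.sum_ite_eq, Finset.mem_univ, if_true]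
  rw [Finset.sum_congr rfl fun c _ => h c, Finset.sum_comm]
  refine Finset.sum_eq_zero fun F _ => ?_
  rw [← Finset.smul_sum, hw F, smul_zero]

open Classical in
/-- Every element of the kernel of the Goeritz matrix extends to a Dehn coloring, in an additive
way. -/
theorem exists_extension [Finite D.Face] : ∃ u : s.kerGoeritz A →+ D.dehnColorings A,
    ∀ (x : s.kerGoeritz A) (F : s.Unshaded),
      (u x : D.Face → A) F.1 = (x : s.Unshaded → A) F := by
  cases nonempty_fintype D.Crossing
  -- The base face depends only on the component, and the chains are fixed before `x`; this makes
  -- the extension additive in `x`.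
  let base : s.Shaded → s.Shaded := fun S => (s.shadedGraph.connectedComponentMk S).out
  have hbase : ∀ S, s.shadedGraph.Reachable (base S) S := fun S =>
    SimpleGraph.ConnectedComponent.exact (Quot.out_eq _)
  choose n hn using fun S => s.exists_chain (hbase S)
  let w : (s.Unshaded → A) →+ (D.Crossing → A) :=
    { toFun := fun x c => s.goeritzIndex c • (x (s.unshadedFst c) - x (s.unshadedSnd c))
      map_zero' := by ext c; simp
      map_add' := fun x y => by ext c; simp only [Pi.add_apply, add_sub_add_comm, smul_add] }
  let d : (s.Unshaded → A) →+ (D.Face → A) :=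
    { toFun := fun x F => if h : F ∈ s.shaded then ∑ c, n ⟨F, h⟩ c • w x c else x ⟨F, h⟩
      map_zero' := by ext F; simp
      map_add' := fun x y => by
        ext F
        by_cases h : F ∈ s.shaded
        · simp only [h, dif_pos, map_add, Pi.add_apply, smul_add, Finset.sum_add_distrib]
        · simp only [h, dif_neg, not_false_eq_true, Pi.add_apply] }
  have hd1 : ∀ x (S : s.Shaded), d x S.1 = ∑ c, n S c • w x c := fun x S => dif_pos S.2
  have hd2 : ∀ x (F : s.Unshaded), d x F.1 = x F := fun x F => dif_neg F.2
  have hmem : ∀ x ∈ s.kerGoeritz A, d x ∈ D.dehnColorings A := by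
    intro x hx
    rw [s.mem_dehnColorings_iff]
    intro c
    rw [hd1, hd1, hd2, hd2]
    -- The chains from the common base face to the two shaded corners at `c` differ from the edge
    -- `c` by a cycle, on which `w` vanishes.
    have hcyc : ∑ c', (n (s.shadedFst c) c' - n (s.shadedSnd c) c' - if c' = c then 1 else 0) •
        w x c' = 0 := by
      refine s.sum_smul_eq_zero_of_cycle (s.mem_kerGoeritz_iff.1 hx) fun R => ?_
      simp only [sub_mul, Finset.sum_sub_distrib, ite_mul, zero_mul, one_mul, Finset.sum_ite_eq',
        Finset.mem_univ, if_true, hn]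
      have : base (s.shadedFst c) = base (s.shadedSnd c) := by
        simp only [base, s.connectedComponentMk_shadedFst]
      rw [this]
      ring
    simp only [sub_smul, Finset.sum_sub_distrib, ite_smul, zero_smul, one_smul, Finset.sum_ite_eq',
      Finset.mem_univ, if_true] at hcyc
    exact sub_eq_zero.1 hcyc
  exact ⟨(d.comp (s.kerGoeritz A).subtype).codRestrict _ fun x => hmem x x.2,
    fun x F => hd2 _ F⟩

variable (A) in
/-- The restriction of the Dehn colorings to the unshaded faces. -/
theorem exists_restriction [Finite D.Face] : ∃ v : D.dehnColorings A →+ s.kerGoeritz A,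
    ∀ (d : D.dehnColorings A) (F : s.Unshaded),
      (v d : s.Unshaded → A) F = (d : D.Face → A) F.1 := by
  classical
  cases nonempty_fintype D.Crossing
  let r : (D.Face → A) →+ (s.Unshaded → A) :=
    { toFun := fun d F => d F.1
      map_zero' := rfl
      map_add' := fun _ _ => rfl }
  refine ⟨(r.comp (D.dehnColorings A).subtype).codRestrict _ fun d => ?_, fun d F => rfl⟩
  rw [mem_kerGoeritz_iff]
  intro F
  -- The crossing equations turn the entry of G·x at `F` into the sum of shaded differences around
  -- `F`, which is zero for every function on the faces.
  rw [← s.sum_shaded_eq_zero F (d : D.Face → A)]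
  exact Finset.sum_congr rfl fun c _ => by
    rw [s.mem_dehnColorings_iff.1 d.2 c]
    rfl

/-- The Dehn colorings that vanish on the unshaded faces are the functions that are constant on
the components of the shaded graph. -/
theorem nonempty_ker_equiv [Finite D.Face] {v : D.dehnColorings A →+ s.kerGoeritz A}
    (hv : ∀ (d : D.dehnColorings A) (F : s.Unshaded),
      (v d : s.Unshaded → A) F = (d : D.Face → A) F.1) :
    Nonempty (v.ker ≃+ (Fin s.beta → A)) := by
  classical
  have hker : ∀ d : D.dehnColorings A, d ∈ v.ker ↔ ∀ F : s.Unshaded, (d : D.Face → A) F.1 = 0 := by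
    intro d
    rw [AddMonoidHom.mem_ker, Subtype.ext_iff, funext_iff]
    exact forall_congr' fun F => by rw [hv]; rfl
  have hadj : ∀ d : v.ker, ∀ S T : s.Shaded, s.shadedGraph.Adj S T →
      (d.1 : D.Face → A) S.1 = (d.1 : D.Face → A) T.1 := by
    rintro ⟨d, hd⟩ S T ⟨hne, c, h1, h2⟩
    have hc := s.mem_dehnColorings_iff.1 d.2 c
    -- With vanishing unshaded values, the crossing equation equates the two shaded values.
    rw [(hker d).1 hd, (hker d).1 hd, sub_zero, smul_zero, sub_eq_zero] at hc
    rw [incident_shaded_iff] at h1 h2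
    rcases h1 with rfl | rfl <;> rcases h2 with rfl | rfl
    exacts [rfl, hc, hc.symm, rfl]
  have hreach : ∀ d : v.ker, ∀ S T : s.Shaded, s.shadedGraph.Reachable S T →
      (d.1 : D.Face → A) S.1 = (d.1 : D.Face → A) T.1 := by
    rintro d S T ⟨p⟩
    induction p with
    | nil => rfl
    | cons h _ ih => exact (hadj d _ _ h).trans ih
  let mk := s.shadedGraph.connectedComponentMk
  obtain ⟨rep, hrep⟩ : ∃ rep : s.shadedGraph.ConnectedComponent → s.Shaded,
      ∀ K, mk (rep K) = K := ⟨_, Function.rightInverse_surjInv Quot.mk_surjective⟩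
  let ext : (s.shadedGraph.ConnectedComponent → A) → D.Face → A := fun f F =>
    if h : F ∈ s.shaded then f (mk ⟨F, h⟩) else 0
  have hext1 : ∀ f (S : s.Shaded), ext f S.1 = f (mk S) := fun f S => dif_pos S.2
  have hext2 : ∀ f (F : s.Unshaded), ext f F.1 = 0 := fun f F => dif_neg F.2
  have hmem : ∀ f, ext f ∈ D.dehnColorings A := by
    intro f
    rw [s.mem_dehnColorings_iff]
    intro c
    rw [hext1, hext1, hext2, hext2, sub_zero, smul_zero, sub_eq_zero]
    exact congrArg f (s.connectedComponentMk_shadedFst c)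
  have hleft : ∀ (d : v.ker) (F : D.Face),
      ext (fun K => (d.1 : D.Face → A) (rep K).1) F = (d.1 : D.Face → A) F := by
    intro d F
    by_cases h : F ∈ s.shaded
    · have h1 := hreach d (rep (mk ⟨F, h⟩)) ⟨F, h⟩ (SimpleGraph.ConnectedComponent.exact (hrep _))
      exact (dif_pos h).trans h1
    · exact (dif_neg h).trans ((hker d.1).1 d.2 ⟨F, h⟩).symm
  let e : v.ker ≃+ (s.shadedGraph.ConnectedComponent → A) :=
    { toFun := fun d K => (d.1 : D.Face → A) (rep K).1
      invFun := fun f => ⟨⟨ext f, hmem f⟩, (hker _).2 (hext2 f)⟩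
      left_inv := fun d => Subtype.ext (Subtype.ext (funext (hleft d)))
      right_inv := by
        intro f
        funext K
        exact (hext1 f _).trans (congrArg f (hrep K))
      map_add' := fun _ _ => rfl }
  have : Finite s.shadedGraph.ConnectedComponent := Quot.finite _
  let g : s.shadedGraph.ConnectedComponent ≃ Fin s.beta := Finite.equivFin _
  exact ⟨e.trans
    { toFun := fun f i => f (g.symm i)
      invFun := fun f K => f (g K)
      left_inv := fun f => funext fun K => congrArg f (g.symm_apply_apply K)
      right_inv := fun f => funext fun i => congrArg f (g.apply_symm_apply i)
      map_add' := fun _ _ => rfl }⟩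

end Shading

end LinkDiagram

/-! ### Split extensions and the conclusion -/

theorem AddMonoidHom.isCompl_ker_range_of_comp_eq_id {M N : Type*} [AddCommGroup M]
    [AddCommGroup N] {v : M →+ N} {u : N →+ M} (h : v.comp u = AddMonoidHom.id N) :
    IsCompl v.ker u.range := by
  have h' : ∀ x, v (u x) = x := DFunLike.congr_fun h
  rw [isCompl_iff, disjoint_iff, codisjoint_iff]
  constructor
  · rw [eq_bot_iff]
    rintro _ ⟨hx, y, rfl⟩
    have hy : v (u y) = 0 := hx
    rw [h'] at hy
    rw [hy, map_zero]
    exact AddSubgroup.zero_mem _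
  · rw [eq_top_iff]
    intro m _
    refine AddSubgroup.mem_sup.2 ⟨m - u (v m), ?_, u (v m), ⟨_, rfl⟩, sub_add_cancel _ _⟩
    rw [AddMonoidHom.mem_ker, map_sub, h', sub_self]

/-- A split extension of abelian groups is a direct sum. -/
def AddMonoidHom.equivProdKer {M N : Type*} [AddCommGroup M] [AddCommGroup N] {v : M →+ N}
    {u : N →+ M} (h : v.comp u = AddMonoidHom.id N) : M ≃+ N × v.ker where
  toFun m := (v m, ⟨m - u (v m), by
    rw [AddMonoidHom.mem_ker, map_sub, show v (u (v m)) = v m from DFunLike.congr_fun h _,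
      sub_self]⟩)
  invFun x := u x.1 + x.2
  left_inv m := add_sub_cancel _ _
  right_inv := by
    rintro ⟨x, k, hk⟩
    have e : v (u x + k) = x := by
      rw [map_add, AddMonoidHom.mem_ker.1 hk, add_zero]
      exact DFunLike.congr_fun h x
    refine Prod.ext e (Subtype.ext ?_)
    simp only [e, add_sub_cancel_left]
  map_add' m m' := by
    refine Prod.ext (map_add v m m') (Subtype.ext ?_)
    simp only [map_add, Prod.snd_add, AddSubgroup.coe_add]
    abel

theorem theorem14 (D : LinkDiagram) (s : D.Shading) (A : Type*) [AddCommGroup A] :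
    ∃ _ : Finite D.Face, ∃ v : D.dehnColorings A →+ s.kerGoeritz A,
      (∀ (d : D.dehnColorings A) (F : s.Unshaded),
        (v d : s.Unshaded → A) F = (d : D.Face → A) F.1) ∧
      Function.Surjective v ∧
      (∃ u : s.kerGoeritz A →+ D.dehnColorings A, v.comp u = AddMonoidHom.id _) ∧
      (∃ H : AddSubgroup (D.dehnColorings A), IsCompl v.ker H ∧ Nonempty (H ≃+ s.kerGoeritz A)) ∧
      Nonempty (v.ker ≃+ (Fin s.beta → A)) ∧
      Nonempty (D.dehnColorings A ≃+ s.kerGoeritz A × (Fin s.beta → A)) := by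
  refine ⟨inferInstance, ?_⟩
  obtain ⟨v, hv⟩ := s.exists_restriction A
  obtain ⟨u, hu⟩ := s.exists_extension (A := A)
  have hvu : v.comp u = AddMonoidHom.id _ := by
    ext x F
    exact (hv (u x) F).trans (hu x F)
  have hvu' : Function.LeftInverse v u := DFunLike.congr_fun hvu
  obtain ⟨e⟩ := s.nonempty_ker_equiv hv
  exact ⟨v, hv, hvu'.surjective, ⟨u, hvu⟩,
    ⟨u.range, AddMonoidHom.isCompl_ker_range_of_comp_eq_id hvu,
      ⟨(AddMonoidHom.ofInjective hvu'.injective).symm⟩⟩, ⟨e⟩,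
    ⟨(AddMonoidHom.equivProdKer hvu).trans ((AddEquiv.refl _).prodCongr e)⟩⟩
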